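/- For $\theta\in\mathbb{R}$ let $H(\theta)=\{re^{i(\theta+\phi)} : r>0,\ -\pi/2<\phi<\pi/2\}$. For $a,\omega_1,\dots,\omega_n\in H(\theta)$, the Barnes zeta-function $\zeta_n(s,a;\omega_1,\dots,\omega_n)$ is the meromorphic continuation to $\mathbb{C}$ of $$\sum_{m_1=0}^\infty\cdots\sum_{m_n=0}^\infty (a+\omega_1m_1+\cdots+\omega_nm_n)^{-s}\qquad(\Re s>n),$$ where the argument of $a+\omega_1m_1+\cdots+\omega_nm_n$ is taken in $(\theta-\pi/2,\theta+\pi/2)$. Theorem (functional equations). Let $n\ge 2$, $\theta\in\mathbb{R}$ and $\omega_1,\dots,\omega_n\in H(\theta)$ with $\Im(\omega_j/\omega_k)\ne 0$ for all $j\ne k$. For $0\le y<1$ put $a(y)=\omega_1(1-y)+\cdots+\omega_n(1-y)$. Then, for every $0\le y<1$, the above series with $a=a(y)$ converges absolutely for $\Re s>n$ and has a meromorphic continuation $\zeta_n(s,a(y);\omega_1,\dots,\omega_n)$ to $\mathbb{C}$. For $0<y<1$ one has, on the whole of $\mathbb{C}$, $$\zeta_n(s,a(y);\omega_1,\dots,\omega_n)=-\frac{2\pi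 i}{\Gamma(s)(e^{2\pi is}-1)}\sum_{k=1}^n\sum_{m\in\mathbb{Z}\setminus\{0\}}\omega_k^{-1}\Bigl(\prod_{\substack{j=1\\ j\ne k}}^n\frac{e^{(2m\pi i\omega_j/\omega_k)y}}{e^{2m\pi i\omega_j/\omega_k}-1}\Bigr)(2m\pi i\omega_k^{-1})^{s-1}e^{2m\pi iy},$$ and for $y=0$ the same equation holds on the region $\Re s<0$. Here the argument of $2m\pi i\omega_k^{-1}$ is taken in $(-\theta,-\theta+2\pi)$. The series on the right-hand side converges absolutely uniformly on compact subsets of $\mathbb{C}$ if $0<y<1$, and on compact subsets of $\{\Re s<0\}$ if $y=0$. In particular, if $y=1/2$, then on the whole of $\mathbb{C}$ $$\zeta_n\bigl(s,(\omega_1+\cdots+\omega_n)/2;\omega_1,\dots,\omega_n\bigr)=-\frac{1}{2^{n-1}}\frac{2\pi i}{\Gamma(s)(e^{2\pi is}-1)}\sum_{k=1}^n\sum_{m\in\mathbb{Z}\setminus\{0\}}\omega_k^{-1}(-1)^m\Bigl(\prod_{\substack{j=1\\ j\ne k}}^n\frac{1}{\sinh(m\pi i\omega_j/\omega_k)}\Bigr)(2m\pi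 i\omega_k^{-1})^{s-1},$$ with the same convergence. The equations are identities of meromorphic functions: they hold literally for $s\notin\mathbb{Z}$, and at each integer $s\notin\{1,\dots,n\}$ of the region the left-hand side is the limit of the right-hand side. -/

import Mathlib

noncomputable section

/-- The open half plane `H(θ) = {r e^{i(θ+φ)} : r > 0, -π/2 < φ < π/2}` with normal
vector `e^{iθ}`, written as `Re (z e^{-iθ}) > 0`. -/
def halfPlane (θ : ℝ) : Set ℂ :=
  {z | 0 < (z * Complex.exp (-(θ * Complex.I))).re}

/-- The branch of `z ^ s` for which the argument of `z` is taken in `(φ - π, φ + π]`. -/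
def branchPow (φ : ℝ) (z s : ℂ) : ℂ :=
  Complex.exp (s * (Complex.log (z * Complex.exp (-(φ * Complex.I))) + φ * Complex.I))

/-- The term of index `m = (m_1, …, m_n)` of the Barnes multiple Dirichlet series,
`(a + ω_1 m_1 + ⋯ + ω_n m_n)^{-s}`.  For `a, ω_j ∈ H(θ)` the base lies in `H(θ)` and its
argument is the one in `(θ - π/2, θ + π/2)`. -/
def barnesSeriesTerm {n : ℕ} (θ : ℝ) (ω : Fin n → ℂ) (a s : ℂ) (m : Fin n → ℕ) : ℂ :=
  branchPow θ (a + ∑ j, ω j * (m j : ℂ)) (-s)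

/-- `Z` is the meromorphic continuation to `ℂ` of the Barnes multiple Dirichlet series, which
is given for `Re s > n`.  A meromorphic function in normal form takes its
continuous value wherever it has one, and the value `0` at each of its poles, so there is at
most one such `Z`. -/
structure IsBarnesContinuation {n : ℕ} (θ : ℝ) (ω : Fin n → ℂ) (a : ℂ) (Z : ℂ → ℂ) : Prop where
  meromorphic : MeromorphicNFOn Z Set.univ
  hasSum : ∀ s : ℂ, (n : ℝ) < s.re → HasSum (barnesSeriesTerm θ ω a s) (Z s)

open Classical in
/-- The Barnes zeta-function `ζ_n(s, a; ω_1, …, ω_n)` on `ℂ`: the meromorphic continuation of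
the Barnes multiple Dirichlet series (and the zero function if there were none). -/
def barnesZeta {n : ℕ} (θ : ℝ) (ω : Fin n → ℂ) (a : ℂ) : ℂ → ℂ :=
  if h : ∃ Z : ℂ → ℂ, IsBarnesContinuation θ ω a Z then h.choose else 0

/-- The parameter `a(y) = ω_1 (1 - y) + ⋯ + ω_n (1 - y)`. -/
def barnesParam {n : ℕ} (ω : Fin n → ℂ) (y : ℝ) : ℂ :=
  ∑ j, ω j * (1 - (y : ℂ))

/-- The power `(2mπi ω_k^{-1})^{s-1}`, the argument of the base being taken in
`(-θ, -θ + 2π)` (for `ω_k ∈ H(θ)` and `m ≠ 0` the base is not on the ray of argument `-θ`). -/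
def polePow {n : ℕ} (θ : ℝ) (ω : Fin n → ℂ) (k : Fin n) (m : ℤ) (s : ℂ) : ℂ :=
  branchPow (Real.pi - θ) (2 * (m : ℂ) * Real.pi * Complex.I * (ω k)⁻¹) (s - 1)

/-- The term of index `(k, m)` of the series in the functional equation. -/
def funcEqTerm {n : ℕ} (θ : ℝ) (ω : Fin n → ℂ) (y : ℝ)
    (p : Fin n × {m : ℤ // m ≠ 0}) (s : ℂ) : ℂ :=
  (ω p.1)⁻¹ *
    (∏ j ∈ Finset.univ.erase p.1,
      Complex.exp (2 * (p.2.1 : ℂ) * Real.pi * Complex.I * (ω j / ω p.1) * y) /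
        (Complex.exp (2 * (p.2.1 : ℂ) * Real.pi * Complex.I * (ω j / ω p.1)) - 1)) *
    polePow θ ω p.1 p.2.1 s *
    Complex.exp (2 * (p.2.1 : ℂ) * Real.pi * Complex.I * y)

/-- The term of index `(k, m)` of the series with hyperbolic sines (the case `y = 1/2`). -/
def sinhTerm {n : ℕ} (θ : ℝ) (ω : Fin n → ℂ)
    (p : Fin n × {m : ℤ // m ≠ 0}) (s : ℂ) : ℂ :=
  (ω p.1)⁻¹ * (-1 : ℂ) ^ p.2.1 *
    (∏ j ∈ Finset.univ.erase p.1,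
      1 / Complex.sinh ((p.2.1 : ℂ) * Real.pi * Complex.I * (ω j / ω p.1))) *
    polePow θ ω p.1 p.2.1 s

/-- The factor `-2πi / (Γ(s) (e^{2πis} - 1))`, literally correct for `s ∉ ℤ`. -/
def gammaFactor (s : ℂ) : ℂ :=
  -(2 * Real.pi * Complex.I /
    (Complex.Gamma s * (Complex.exp (2 * Real.pi * Complex.I * s) - 1)))

/-- The right-hand side of the functional equation. -/
def funcEqRHS {n : ℕ} (θ : ℝ) (ω : Fin n → ℂ) (y : ℝ) (s : ℂ) : ℂ :=
  gammaFactor s * ∑ k : Fin n, ∑' m : {m : ℤ // m ≠ 0}, funcEqTerm θ ω y (k, m) s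

/-- The right-hand side of the functional equation for `y = 1/2`. -/
def sinhRHS {n : ℕ} (θ : ℝ) (ω : Fin n → ℂ) (s : ℂ) : ℂ :=
  1 / 2 ^ (n - 1) * gammaFactor s *
    ∑ k : Fin n, ∑' m : {m : ℤ // m ≠ 0}, sinhTerm θ ω (k, m) s

/-- The series `∑ f i` of functions converges absolutely uniformly on `U`, i.e. `∑ |f i|`
converges uniformly on every compact subset of `U`. -/
def ConvergesAbsUniformlyOn {ι : Type*} (f : ι → ℂ → ℂ) (U : Set ℂ) : Prop :=
  ∀ K : Set ℂ, K ⊆ U → IsCompact K → SummableUniformlyOn (fun i s => ‖f i s‖) K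

/-- The identity `Z = R` of meromorphic functions on `U`, where `R` carries the factor
`1 / (Γ(s) (e^{2πis} - 1))`, which has to be read as a limit at integers, and the
only possible poles of `Z` are `1, …, n`: equality at every non-integer `s`, and
at every integer other than `1, …, n` the value of `Z` is the limit of `R`. -/
def EqualsOn (n : ℕ) (Z R : ℂ → ℂ) (U : Set ℂ) : Prop :=
  (∀ s ∈ U, (∀ N : ℤ, s ≠ N) → Z s = R s) ∧
  (∀ N : ℤ, (N : ℂ) ∈ U → (N < 1 ∨ (n : ℤ) < N) →
    Filter.Tendsto R (nhdsWithin (N : ℂ) {(N : ℂ)}ᶜ) (nhds (Z N)))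

end

open Real Filter Topology MeasureTheory

/-! For 0 < y < 1 and Re s > n, expanding each e^{ω_j y t}/(e^{ω_j t} - 1) in a geometric series and
integrating termwise shows that Γ(s) ζ_n(s, a(y)) is the integral of t^{s-1} ∏_j e^{ω_j y t}/(e^{ω_j
t} - 1) along the ray arg t = -θ (`hasSum_Gamma_mul_barnesSeriesTerm`). A full turn of the ray
multiplies the integral by e^{2πis}, so (1 - e^{2πis}) Γ(s) ζ_n is the total of the jumps of the
integral while the ray turns. Jumps occur only at the 2n rays that carry the poles ±2πim/ω_k, m > 0.
Since the ratios ω_j/ω_k are not real, these rays are distinct and the other n - 1 kernels decay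
exponentially along each of them; the jump is 2πi times the sum of the residues
(`integral_sub_integral_rotated`, `sum_rayResidue`).

Everything is written in the coordinate t = e^w, where rays become horizontal lines and no branch of
t^s has to be chosen. The jump across one ray is obtained without contours around infinitely many
poles: on the two sides of the ray the singular kernel has two different geometric expansions, whose
terms are entire; moving each term onto the ray itself gives the two halves of one series over ℤ of
Fourier integrals, and Poisson summation turns it into the sum over the poles
(`integral_line_sub_integral_line`, `poisson_log`).

The right-hand side is a meromorphic factor times an entire function, hence it is the continuation.
Values at integers come from the reflection formula (`gammaFactor_eq`) and, for integers above n,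
from analyticity of the Dirichlet series (`equalsOn_gammaFactor_mul`).

At y = 0 the kernels lose their decay in one direction. There the continuation comes from the Taylor
series in the parameter, ζ_n(s, a + δ) = ∑_k C(-s, k) δ^k ζ_n(s + k, a), around a = a(y₀) with small
y₀ > 0 (`taylorShift`). It is continuous in δ, so the equation for y > 0 passes to the limit y → 0+
wherever the right-hand side also converges, namely for Re s < 0 (`barnesZeta_zero`). -/

/-! ### Line integrals with doubly exponential decay, and shifting the line. -/

/-- `f` is bounded on the lines `Im w ∈ S` by a multiple of `e^{b u - c e^u}`, `u = Re w`. -/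
def StripBound (f : ℂ → ℂ) (b c : ℝ) (S : Set ℝ) : Prop :=
  ∃ C : ℝ, 0 ≤ C ∧ ∀ w : ℂ, w.im ∈ S → ‖f w‖ ≤ C * Real.exp (b * w.re - c * Real.exp w.re)

theorem StripBound.mul {f g : ℂ → ℂ} {b c b' c' : ℝ} {S : Set ℝ} (hf : StripBound f b c S)
    (hg : StripBound g b' c' S) : StripBound (fun w => f w * g w) (b + b') (c + c') S := by
  obtain ⟨C, hC, hf⟩ := hf
  obtain ⟨C', hC', hg⟩ := hg
  refine ⟨C * C', by positivity, fun w hw => ?_⟩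
  rw [norm_mul]
  calc ‖f w‖ * ‖g w‖ ≤ (C * Real.exp (b * w.re - c * Real.exp w.re)) *
        (C' * Real.exp (b' * w.re - c' * Real.exp w.re)) := by
        gcongr
        exacts [hf w hw, hg w hw]
    _ = _ := by
        rw [mul_mul_mul_comm, ← Real.exp_add]
        ring_nf

theorem StripBound.mono {f : ℂ → ℂ} {b c : ℝ} {S T : Set ℝ} (hf : StripBound f b c S)
    (h : T ⊆ S) : StripBound f b c T := by
  obtain ⟨C, hC, hf⟩ := hf
  exact ⟨C, hC, fun w hw => hf w (h hw)⟩

theorem StripBound.prod {ι : Type*} {f : ι → ℂ → ℂ} {b c : ℝ} {S : Set ℝ} (s : Finset ι)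
    (hf : ∀ i ∈ s, StripBound (f i) b c S) :
    StripBound (fun w => ∏ i ∈ s, f i w) (s.card * b) (s.card * c) S := by
  classical
  induction s using Finset.induction_on with
  | empty => exact ⟨1, by simp, fun w _ => by simp⟩
  | insert a s ha ih =>
    have h1 := (hf a (by simp)).mul (ih fun i hi => hf i (by simp [hi]))
    simp only [Finset.prod_insert ha, Finset.card_insert_of_notMem ha]
    convert h1 using 1 <;> push_cast <;> ring

theorem stripBound_exp_mul (s : ℂ) {S : Set ℝ} {M : ℝ} (hS : ∀ φ ∈ S, |φ| ≤ M) :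
    StripBound (fun w => Complex.exp (s * w)) s.re 0 S := by
  refine ⟨Real.exp (|s.im| * M), by positivity, fun w hw => ?_⟩
  rw [Complex.norm_exp, ← Real.exp_add, Real.exp_le_exp, Complex.mul_re]
  have h1 : |s.im * w.im| ≤ |s.im| * M := by
    rw [abs_mul]
    exact mul_le_mul_of_nonneg_left (hS _ hw) (abs_nonneg _)
  linarith [neg_abs_le (s.im * w.im)]

/-- The term b u gives decay at -∞ and c e^u gives decay at +∞; merging them into e^{-b|u|} makes
one estimate serve integrability and the limits at both ends. For u ≥ 0 the constant comes from e^u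
≥ u²/2 and the square (c u - 2b)² ≥ 0. -/
theorem exp_sub_exp_le {b c : ℝ} (hc : 0 < c) (hb : 0 < b) (u : ℝ) :
    Real.exp (b * u - c * Real.exp u) ≤ Real.exp (2 * b ^ 2 / c) * Real.exp (-(b * |u|)) := by
  rw [← Real.exp_add, Real.exp_le_exp]
  rcases le_total 0 u with hu | hu
  · rw [abs_of_nonneg hu]
    have h1 : u ^ 2 / 2 ≤ Real.exp u := by
      have := Real.quadratic_le_exp_of_nonneg hu
      linarith
    have h2 : 2 * b * u - c * (u ^ 2 / 2) ≤ 2 * b ^ 2 / c := by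
      rw [le_div_iff₀ hc]
      nlinarith [sq_nonneg (c * u - 2 * b)]
    nlinarith
  · rw [abs_of_nonpos hu]
    have : 0 ≤ 2 * b ^ 2 / c := by positivity
    have := mul_pos hc (Real.exp_pos u)
    linarith

theorem integrable_exp_neg_mul_abs {b : ℝ} (hb : 0 < b) :
    Integrable (fun u : ℝ => Real.exp (-(b * |u|))) := by
  refine ((integrable_inv_one_add_sq).const_mul (1 + 2 / b ^ 2)).mono' (by fun_prop) ?_
  refine Eventually.of_forall fun u => ?_
  rw [Real.norm_eq_abs, abs_of_pos (Real.exp_pos _), Real.exp_neg, ← div_eq_mul_inv,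
    le_div_iff₀ (by positivity), inv_mul_le_iff₀ (by positivity)]
  have h1 := Real.quadratic_le_exp_of_nonneg (mul_nonneg hb.le (abs_nonneg u))
  have h2 : (b * |u|) ^ 2 = b ^ 2 * u ^ 2 := by rw [mul_pow, sq_abs]
  rw [h2] at h1
  have h3 : 0 ≤ b * |u| := by positivity
  have h5 : (1 : ℝ) + u ^ 2 ≤ (1 + b ^ 2 * u ^ 2 / 2) * (1 + 2 / b ^ 2) := by
    have : (1 + b ^ 2 * u ^ 2 / 2) * (1 + 2 / b ^ 2)
      = 1 + u ^ 2 + b ^ 2 * u ^ 2 / 2 + 2 / b ^ 2 := by field_simp; ring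
    rw [this]
    have : 0 ≤ b ^ 2 * u ^ 2 / 2 + 2 / b ^ 2 := by positivity
    linarith
  refine h5.trans ?_
  gcongr
  linarith

theorem integrable_exp_sub_exp {b c : ℝ} (hb : 0 < b) (hc : 0 < c) :
    Integrable (fun u : ℝ => Real.exp (b * u - c * Real.exp u)) := by
  refine ((integrable_exp_neg_mul_abs hb).const_mul (Real.exp (2 * b ^ 2 / c))).mono'
    (by fun_prop) (Eventually.of_forall fun u => ?_)
  rw [Real.norm_eq_abs, abs_of_pos (Real.exp_pos _)]
  exact exp_sub_exp_le hc hb u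

theorem tendsto_exp_sub_exp_atTop {b c : ℝ} (hb : 0 < b) (hc : 0 < c) :
    Tendsto (fun u : ℝ => Real.exp (b * u - c * Real.exp u)) atTop (𝓝 0) := by
  refine squeeze_zero (fun _ => (Real.exp_pos _).le) (exp_sub_exp_le hc hb) ?_
  rw [← mul_zero (Real.exp (2 * b ^ 2 / c))]
  refine Tendsto.const_mul _ ?_
  exact Real.tendsto_exp_neg_atTop_nhds_zero.comp
    (tendsto_abs_atTop_atTop.const_mul_atTop hb)

theorem tendsto_exp_sub_exp_atBot {b c : ℝ} (hb : 0 < b) (hc : 0 < c) :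
    Tendsto (fun u : ℝ => Real.exp (b * u - c * Real.exp u)) atBot (𝓝 0) := by
  refine squeeze_zero (fun _ => (Real.exp_pos _).le) (exp_sub_exp_le hc hb) ?_
  rw [← mul_zero (Real.exp (2 * b ^ 2 / c))]
  refine Tendsto.const_mul _ ?_
  exact Real.tendsto_exp_neg_atTop_nhds_zero.comp
    (tendsto_abs_atBot_atTop.const_mul_atTop hb)

theorem integrable_line {f : ℂ → ℂ} {φ b c : ℝ} {S : Set ℝ} (hφ : φ ∈ S)
    (hd : ∀ w : ℂ, w.im ∈ S → DifferentiableAt ℂ f w) (hb : 0 < b) (hc : 0 < c)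
    (hf : StripBound f b c S) : Integrable (fun u : ℝ => f (u + φ * Complex.I)) := by
  obtain ⟨C, hC, hf⟩ := hf
  refine ((integrable_exp_sub_exp hb hc).const_mul C).mono' ?_ (Eventually.of_forall fun u => ?_)
  · refine Continuous.aestronglyMeasurable (continuous_iff_continuousAt.2 fun u => ?_)
    refine ContinuousAt.comp (f := fun u : ℝ => (u : ℂ) + φ * Complex.I)
      (hd _ (by simpa using hφ)).continuousAt (by fun_prop)
  · simpa using hf (u + φ * Complex.I) (by simpa using hφ)

/-- Shifting the line of integration of a holomorphic function in a strip. -/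
theorem integral_line_eq {f : ℂ → ℂ} {φ₁ φ₂ b c : ℝ} (h : φ₁ ≤ φ₂)
    (hd : ∀ w : ℂ, w.im ∈ Set.Icc φ₁ φ₂ → DifferentiableAt ℂ f w) (hb : 0 < b) (hc : 0 < c)
    (hf : StripBound f b c (Set.Icc φ₁ φ₂)) :
    ∫ u : ℝ, f (u + φ₁ * Complex.I) = ∫ u : ℝ, f (u + φ₂ * Complex.I) := by
  have hi1 := integrable_line (Set.left_mem_Icc.2 h) hd hb hc hf
  have hi2 := integrable_line (Set.right_mem_Icc.2 h) hd hb hc hf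
  obtain ⟨C, hC, hf⟩ := hf
  have key : ∀ T : ℝ, (∫ x : ℝ in (-T)..T, f (x + φ₁ * Complex.I)) -
      (∫ x : ℝ in (-T)..T, f (x + φ₂ * Complex.I)) =
      Complex.I • (∫ y : ℝ in φ₁..φ₂, f ((-T : ℝ) + y * Complex.I)) -
      Complex.I • (∫ y : ℝ in φ₁..φ₂, f (T + y * Complex.I)) := by
    intro T
    have := Complex.integral_boundary_rect_eq_zero_of_differentiableOn f
      (⟨-T, φ₁⟩ : ℂ) (⟨T, φ₂⟩ : ℂ) (fun w hw => (hd w (by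
        have := hw.2
        simpa [Set.uIcc_of_le h] using this)).differentiableWithinAt)
    simp only at this
    linear_combination this
  -- The vertical sides have fixed length and the bound tends to 0 along them; `g` is T or -T, so
  -- both sides are treated at once.
  have vert : ∀ (g : ℝ → ℝ), Tendsto (fun T => Real.exp (b * g T - c * Real.exp (g T))) atTop (𝓝 0)
      → Tendsto (fun T : ℝ => Complex.I • (∫ y : ℝ in φ₁..φ₂, f ((g T : ℝ) + y * Complex.I)))
        atTop (𝓝 0) := by
    intro g hg
    have h0 : Tendsto (fun T => C * Real.exp (b * g T - c * Real.exp (g T)) * |φ₂ - φ₁|)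
        atTop (𝓝 0) := by
      simpa using (hg.const_mul C).mul_const |φ₂ - φ₁|
    refine squeeze_zero_norm (fun T => ?_) h0
    rw [norm_smul, Complex.norm_I, one_mul]
    refine intervalIntegral.norm_integral_le_of_norm_le_const fun y hy => ?_
    rw [Set.uIoc_of_le h] at hy
    simpa using hf (g T + y * Complex.I) (by simpa using ⟨hy.1.le, hy.2⟩)
  have hl := (intervalIntegral_tendsto_integral hi1 tendsto_neg_atTop_atBot tendsto_id).sub
    (intervalIntegral_tendsto_integral hi2 tendsto_neg_atTop_atBot tendsto_id)
  have hr := (vert (fun T => -T)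
    ((tendsto_exp_sub_exp_atBot hb hc).comp tendsto_neg_atTop_atBot)).sub
    (vert (fun T => T) (tendsto_exp_sub_exp_atTop hb hc))
  have := tendsto_nhds_unique hl (hr.congr fun T => (key T).symm)
  rwa [sub_zero, sub_eq_zero] at this

/-! ### The kernel e^{ωyt}/(e^{ωt} - 1): symmetry, bounds, geometric expansion. -/

/-- The meromorphic function `e^{ω y t} / (e^{ω t} - 1)`. -/
noncomputable def bernoulliKernel (ω : ℂ) (y : ℝ) (t : ℂ) : ℂ :=
  Complex.exp (ω * t * y) / (Complex.exp (ω * t) - 1)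

/-- Multiply numerator and denominator by e^{-ωt}. The symmetry reduces Re(ωt) < 0 to Re(ωt) > 0,
and the poles on the ray opposite to 2πim/ω to those on the ray itself. -/
theorem bernoulliKernel_reflect (ω : ℂ) (y : ℝ) (t : ℂ) :
    bernoulliKernel ω y t = -bernoulliKernel (-ω) (1 - y) t := by
  unfold bernoulliKernel
  have h0 : Complex.exp (ω * t) ≠ 0 := Complex.exp_ne_zero _
  have h1 : Complex.exp (-ω * t * ((1 - y : ℝ) : ℂ)) =
      (Complex.exp (ω * t))⁻¹ * Complex.exp (ω * t * y) := by
    rw [← Complex.exp_neg, ← Complex.exp_add]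
    congr 1
    push_cast
    ring
  rw [h1, neg_mul, Complex.exp_neg]
  -- At a pole both sides are 0 by the convention for division by zero.
  by_cases h : Complex.exp (ω * t) = 1
  · simp [h]
  · have h2 : Complex.exp (ω * t) - 1 ≠ 0 := sub_ne_zero.2 h
    have h3 : (Complex.exp (ω * t))⁻¹ - 1 ≠ 0 := by
      rw [sub_ne_zero]
      simpa [inv_eq_one] using h
    field_simp
    ring

theorem exp_ne_one_of_re_ne_zero {z : ℂ} (hz : z.re ≠ 0) : Complex.exp z ≠ 1 := by
  intro h
  have := congrArg norm h
  rw [Complex.norm_exp, norm_one, Real.exp_eq_one_iff] at this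
  exact hz this

/-- The decay rate is 1 - y when Re(ωt) > 0 and y when Re(ωt) < 0, hence the minimum. At y = 0 the
minimum is 0: the kernel is still bounded away from Re(ωt) = 0, but this bound gives no decay. -/
theorem norm_bernoulliKernel_le {ω t : ℂ} {y : ℝ} (hy0 : 0 ≤ y) (hy1 : y ≤ 1)
    (hz : (ω * t).re ≠ 0) :
    ‖bernoulliKernel ω y t‖ ≤
      Real.exp (-(min y (1 - y) * |(ω * t).re|)) / (1 - Real.exp (-|(ω * t).re|)) := by
  wlog hpos : 0 < (ω * t).re generalizing ω y
  · have := this (ω := -ω) (y := 1 - y) (by linarith) (by linarith)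
      (by rw [neg_mul, Complex.neg_re]; exact neg_ne_zero.2 hz)
      (by rw [neg_mul, Complex.neg_re]; exact neg_pos.2 (lt_of_le_of_ne (not_lt.1 hpos) hz))
    rw [bernoulliKernel_reflect, norm_neg]
    rw [neg_mul, Complex.neg_re, abs_neg, min_comm] at this
    simpa only [sub_sub_cancel] using this
  unfold bernoulliKernel
  set z := ω * t
  rw [abs_of_pos hpos, norm_div, Complex.norm_exp]
  have h1 : Real.exp z.re - 1 ≤ ‖Complex.exp z - 1‖ := by
    have := norm_sub_norm_le (Complex.exp z) 1
    rwa [Complex.norm_exp, norm_one] at this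
  have h2 : 0 < Real.exp z.re - 1 := by
    have := Real.add_one_lt_exp hpos.ne'
    linarith
  have h3 : 0 < 1 - Real.exp (-z.re) := by
    have : Real.exp (-z.re) < 1 := Real.exp_lt_one_iff.2 (by linarith)
    linarith
  have h4 : Real.exp z.re - 1 = Real.exp z.re * (1 - Real.exp (-z.re)) := by
    rw [mul_sub, ← Real.exp_add]
    simp
  calc Real.exp (z * (y : ℂ)).re / ‖Complex.exp z - 1‖
      ≤ Real.exp (z * (y : ℂ)).re / (Real.exp z.re - 1) := by gcongr
    _ = Real.exp ((z * (y : ℂ)).re - z.re) / (1 - Real.exp (-z.re)) := by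
        rw [h4, ← div_div, ← Real.exp_sub]
    _ ≤ _ := by
        gcongr
        simp only [Complex.mul_re, Complex.ofReal_re, Complex.ofReal_im, mul_zero, sub_zero]
        have := mul_le_mul_of_nonneg_right (min_le_right y (1 - y)) hpos.le
        linarith

theorem one_div_one_sub_exp_neg_le {x : ℝ} (hx : 0 < x) :
    1 / (1 - Real.exp (-x)) ≤ 1 + 1 / x := by
  have h3 : 0 < 1 - Real.exp (-x) := by
    have : Real.exp (-x) < 1 := Real.exp_lt_one_iff.2 (by linarith)
    linarith
  have h4 : Real.exp (-x) * (1 + x) ≤ 1 := by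
    rw [Real.exp_neg, inv_mul_le_iff₀ (Real.exp_pos _)]
    linarith [Real.add_one_le_exp x]
  rw [div_le_iff₀ h3]
  have : (1 + 1 / x) * (1 - Real.exp (-x)) = (1 + x - Real.exp (-x) * (1 + x)) / x := by
    field_simp
    ring
  rw [this, le_div_iff₀ hx]
  linarith

theorem re_mul_exp (ω w : ℂ) : (ω * Complex.exp w).re =
    Real.exp w.re * (ω * Complex.exp (w.im * Complex.I)).re := by
  conv_lhs => rw [← Complex.re_add_im w, Complex.exp_add, ← Complex.ofReal_exp,
    mul_left_comm, Complex.re_ofReal_mul]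

/-- The exponent -1 is the price of the simple pole at t = 0. Half of the exponential decay is spent
on bounding the constant, the other half remains in the bound. -/
theorem stripBound_bernoulliKernel {ω : ℂ} {y κ : ℝ} {S : Set ℝ} (hy0 : 0 < y) (hy1 : y < 1)
    (hκ : 0 < κ) (hS : ∀ φ ∈ S, κ ≤ |(ω * Complex.exp (φ * Complex.I)).re|) :
    StripBound (fun w => bernoulliKernel ω y (Complex.exp w)) (-1)
      (min y (1 - y) * κ / 2) S := by
  set c := min y (1 - y) with hcdef
  have hc : 0 < c := lt_min hy0 (by linarith)
  refine ⟨2 / (c * κ) + 1 / κ, by positivity, fun w hw => ?_⟩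
  set r := Real.exp w.re with hr
  have hrpos : 0 < r := Real.exp_pos _
  have hx : κ * r ≤ |(ω * Complex.exp w).re| := by
    rw [re_mul_exp, abs_mul, abs_of_pos hrpos, mul_comm]
    exact mul_le_mul_of_nonneg_left (hS _ hw) hrpos.le
  have hκr : 0 < κ * r := by positivity
  have hxpos : 0 < |(ω * Complex.exp w).re| := hκr.trans_le hx
  refine (norm_bernoulliKernel_le hy0.le hy1.le (abs_pos.1 hxpos)).trans ?_
  rw [div_eq_mul_one_div]
  set x := |(ω * Complex.exp w).re|
  calc Real.exp (-(c * x)) * (1 / (1 - Real.exp (-x)))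
      ≤ Real.exp (-(c * (κ * r))) * (1 + 1 / (κ * r)) := by
        refine mul_le_mul ?_ ((one_div_one_sub_exp_neg_le hxpos).trans ?_) ?_ (Real.exp_pos _).le
        · gcongr
        · gcongr
        · have : Real.exp (-x) < 1 := Real.exp_lt_one_iff.2 (by linarith)
          rw [one_div]
          exact inv_nonneg.2 (by linarith)
    _ = (Real.exp (-(c * κ * r / 2)) * r + Real.exp (-(c * κ * r / 2)) / κ) *
          Real.exp (-1 * w.re - c * κ / 2 * r) := by
        have : Real.exp (-1 * w.re - c * κ / 2 * r) = Real.exp (-(c * κ * r / 2)) / r := by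
          rw [hr, ← Real.exp_sub]
          ring_nf
        rw [this]
        have : Real.exp (-(c * (κ * r))) =
            Real.exp (-(c * κ * r / 2)) * Real.exp (-(c * κ * r / 2)) := by
          rw [← Real.exp_add]
          ring_nf
        rw [this]
        field_simp
    _ ≤ _ := by
        gcongr
        · rw [Real.exp_neg, inv_mul_le_iff₀ (Real.exp_pos _), mul_div_assoc', le_div_iff₀ (by positivity)]
          have := Real.add_one_le_exp (c * κ * r / 2)
          nlinarith
        · rw [Real.exp_le_one_iff]
          have : 0 < c * κ * r / 2 := by positivity
          linarith

theorem differentiableAt_bernoulliKernel_exp {ω w : ℂ} (y : ℝ)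
    (h : (ω * Complex.exp (w.im * Complex.I)).re ≠ 0) :
    DifferentiableAt ℂ (fun w => bernoulliKernel ω y (Complex.exp w)) w := by
  unfold bernoulliKernel
  refine DifferentiableAt.div (by fun_prop) (by fun_prop) (sub_ne_zero.2 ?_)
  refine exp_ne_one_of_re_ne_zero ?_
  rw [re_mul_exp]
  exact mul_ne_zero (Real.exp_pos _).ne' h

/-- The terms are entire in t, so the line of integration of each term can cross the poles of the
kernel, which the kernel itself does not allow. -/
theorem hasSum_bernoulliKernel {ω t : ℂ} (y : ℝ) (h : 0 < (ω * t).re) :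
    HasSum (fun l : ℕ => Complex.exp (ω * (y - (l + 1)) * t)) (bernoulliKernel ω y t) := by
  have hq : ‖Complex.exp (-(ω * t))‖ < 1 := by
    rw [Complex.norm_exp, Real.exp_lt_one_iff]
    simpa using h
  have h1 := (hasSum_geometric_of_norm_lt_one hq).mul_left
    (Complex.exp (ω * t * y) * Complex.exp (-(ω * t)))
  convert! h1 using 1
  · funext l
    rw [← Complex.exp_nat_mul, ← Complex.exp_add, ← Complex.exp_add]
    ring_nf
  · unfold bernoulliKernel
    have h2 : Complex.exp (ω * t) - 1 ≠ 0 := sub_ne_zero.2 (exp_ne_one_of_re_ne_zero h.ne')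
    have h3 : 1 - Complex.exp (-(ω * t)) = Complex.exp (-(ω * t)) * (Complex.exp (ω * t) - 1) := by
      rw [mul_sub, ← Complex.exp_add]
      simp
    rw [h3]
    have := Complex.exp_ne_zero (-(ω * t))
    field_simp

/-- Termwise integration of the geometric expansion of the kernel along a line. -/
theorem hasSum_integral_bernoulliKernel {ω : ℂ} {y φ b c : ℝ} {g : ℂ → ℂ} (hy0 : 0 < y)
    (hy1 : y < 1) (hφ : 0 < (ω * Complex.exp (φ * Complex.I)).re)
    (hd : ∀ w : ℂ, w.im = φ → DifferentiableAt ℂ g w) (hb : 0 < b) (hc : 0 < c)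
    (hg : StripBound g (1 + b) c {φ}) :
    HasSum (fun l : ℕ => ∫ u : ℝ, g (u + φ * Complex.I) *
        Complex.exp (ω * (y - (l + 1)) * Complex.exp (u + φ * Complex.I)))
      (∫ u : ℝ, g (u + φ * Complex.I) * bernoulliKernel ω y (Complex.exp (u + φ * Complex.I))) := by
  set κ := (ω * Complex.exp (φ * Complex.I)).re with hκ
  have hcont : Continuous (fun u : ℝ => g (u + φ * Complex.I)) :=
    continuous_iff_continuousAt.2 fun u =>
      ContinuousAt.comp (f := fun u : ℝ => (u : ℂ) + φ * Complex.I)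
        (hd _ (by simp)).continuousAt (by fun_prop)
  have hre : ∀ u : ℝ, (ω * Complex.exp (u + φ * Complex.I)).re = κ * Real.exp u := by
    intro u
    rw [re_mul_exp]
    simp [hκ, mul_comm]
  have hre' : ∀ (u : ℝ) (l : ℕ), ‖Complex.exp (ω * (y - (l + 1)) *
      Complex.exp (u + φ * Complex.I))‖ = Real.exp (κ * (y - (l + 1)) * Real.exp u) := by
    intro u l
    rw [Complex.norm_exp]
    have : ω * (y - (l + 1)) * Complex.exp (u + φ * Complex.I) =
      ((y - (l + 1) : ℝ) : ℂ) * (ω * Complex.exp (u + φ * Complex.I)) := by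
      push_cast
      ring
    rw [this, Complex.re_ofReal_mul, hre]
    ring_nf
  -- The absolute values of the terms form the same series with the real frequency κ, so the
  -- dominating sum is again a kernel. Its pole at t = 0 is paid for by the 1 in the exponent 1 + b
  -- of `hg`.
  have hreal : ∀ u : ℝ, HasSum (fun l : ℕ => Real.exp (κ * (y - (l + 1)) * Real.exp u))
      (bernoulliKernel κ y (Complex.exp u)).re := by
    intro u
    have h1 := Complex.hasSum_re (hasSum_bernoulliKernel (ω := κ) (t := Complex.exp u) y (by
      rw [← Complex.ofReal_exp, ← Complex.ofReal_mul, Complex.ofReal_re]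
      exact mul_pos hφ (Real.exp_pos _)))
    convert! h1 using 2 with l
    rw [← Complex.exp_ofReal_re]
    push_cast
    rfl
  refine hasSum_integral_of_dominated_convergence
    (fun l u => ‖g (u + φ * Complex.I)‖ * Real.exp (κ * (y - (l + 1)) * Real.exp u))
    (fun l => ?_) (fun l => ?_) ?_ ?_ ?_
  · refine Continuous.aestronglyMeasurable (hcont.mul (by fun_prop))
  · refine Eventually.of_forall fun u => ?_
    rw [norm_mul, hre']
  · exact Eventually.of_forall fun u => ((hreal u).summable).mul_left _
  · obtain ⟨C, hC, hg⟩ := hg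
    obtain ⟨C', hC', hk⟩ := stripBound_bernoulliKernel (ω := κ) (S := {0}) hy0 hy1 hφ
      (by simpa using le_abs_self _)
    have : ∀ u : ℝ, ∑' l : ℕ, ‖g (u + φ * Complex.I)‖ * Real.exp (κ * (y - (l + 1)) * Real.exp u)
        = ‖g (u + φ * Complex.I)‖ * (bernoulliKernel κ y (Complex.exp u)).re := fun u =>
      ((hreal u).mul_left _).tsum_eq
    simp only [this]
    refine ((integrable_exp_sub_exp hb hc).const_mul (C * C')).mono' ?_
      (Eventually.of_forall fun u => ?_)
    · refine Continuous.aestronglyMeasurable (hcont.norm.mul (Complex.continuous_re.comp ?_))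
      refine continuous_iff_continuousAt.2 fun u => ?_
      exact ContinuousAt.comp (f := fun u : ℝ => (u : ℂ))
        (differentiableAt_bernoulliKernel_exp (ω := κ) (w := u) y (by simpa using hφ.ne')).continuousAt
        (by fun_prop)
    · have h1 := hg (u + φ * Complex.I) (by simp)
      have h2 := hk u (by simp)
      rw [norm_mul, norm_norm]
      have h3 : ‖(bernoulliKernel κ y (Complex.exp u)).re‖ ≤ ‖bernoulliKernel κ y (Complex.exp u)‖ :=
        Complex.abs_re_le_norm _
      have hmin : 0 < min y (1 - y) := lt_min hy0 (by linarith)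
      calc _ ≤ (C * Real.exp ((1 + b) * u - c * Real.exp u)) *
            (C' * Real.exp (-1 * u - min y (1 - y) * κ / 2 * Real.exp u)) := by
            refine mul_le_mul (by simpa using h1) (h3.trans (by simpa using h2)) (norm_nonneg _)
              (by positivity)
        _ ≤ (C * Real.exp ((1 + b) * u - c * Real.exp u)) * (C' * Real.exp (-1 * u)) := by
            gcongr
            have : 0 < min y (1 - y) * κ / 2 * Real.exp u := by positivity
            linarith
        _ = C * C' * Real.exp (b * u - c * Real.exp u) := by
            rw [mul_mul_mul_comm, ← Real.exp_add]
            ring_nf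
  · refine Eventually.of_forall fun u => ?_
    refine (hasSum_bernoulliKernel y ?_).mul_left _
    rw [hre]
    exact mul_pos hφ (Real.exp_pos _)

/-! ### Poisson summation and the jump across one ray of poles. -/

theorem integral_Ioi_eq_integral_exp (r : ℝ) (hr : 0 < r) (f : ℝ → ℂ) :
    ∫ x in Set.Ioi 0, f x = ∫ u : ℝ, ((r * Real.exp u : ℝ) : ℂ) * f (r * Real.exp u) := by
  have himg : (fun u : ℝ => r * Real.exp u) '' Set.univ = Set.Ioi 0 := by
    ext x
    constructor
    · rintro ⟨u, -, rfl⟩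
      exact mul_pos hr (Real.exp_pos u)
    · intro hx
      refine ⟨Real.log (x / r), trivial, ?_⟩
      simp only
      rw [Real.exp_log (div_pos hx hr)]
      field_simp
  have h := integral_image_eq_integral_abs_deriv_smul (s := Set.univ)
    (f := fun u : ℝ => r * Real.exp u) (f' := fun u : ℝ => r * Real.exp u) MeasurableSet.univ
    (fun x _ => ((Real.hasDerivAt_exp x).const_mul r).hasDerivWithinAt)
    (fun x _ y _ hxy => Real.exp_injective (mul_left_cancel₀ hr.ne' hxy)) f
  rw [himg, setIntegral_univ] at h
  rw [h]
  refine integral_congr_ae (Eventually.of_forall fun u => ?_)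
  simp only [Complex.real_smul, abs_of_pos (mul_pos hr (Real.exp_pos u))]

/-- Poisson summation for a function on a half line, in logarithmic coordinates. -/
theorem poisson_log {g : ℂ → ℂ} {α b c R : ℝ} (hR : 0 < R) (y : ℝ)
    (hd : ∀ w : ℂ, w.im = α → DifferentiableAt ℂ g w) (hb : 0 < b) (hc : 0 < c)
    (hg : StripBound g (1 + b) c {α}) {B : ℂ}
    (hsum : HasSum (fun l : ℤ => ∫ u : ℝ, g (u + α * Complex.I) *
      Complex.exp (R * Complex.I * (y - l) * Real.exp u)) B) :
    B = ∑' m : ℕ, g (Real.log (2 * π * (m + 1) / R) + α * Complex.I) *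
      Complex.exp (2 * π * Complex.I * (m + 1) * y) / (m + 1) := by
  -- With x = r e^u the phase R l e^u becomes 2π l x, the phase of the Fourier transform at the
  -- integer l.
  set r : ℝ := R / (2 * π) with hr
  have hrpos : 0 < r := by positivity
  -- The division by x is the Jacobian du = dx/x. It lowers the exponent 1 + b to b > 0, which still
  -- makes G continuous at 0.
  set G : ℝ → ℂ := Set.indicator (Set.Ioi 0) fun x =>
    g (Real.log (x / r) + α * Complex.I) * Complex.exp (2 * π * Complex.I * x * y) / x with hG
  have hGpos : ∀ x : ℝ, 0 < x → G x =
      g (Real.log (x / r) + α * Complex.I) * Complex.exp (2 * π * Complex.I * x * y) / x :=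
    fun x hx => Set.indicator_of_mem (s := Set.Ioi 0) hx _
  have hGneg : ∀ x : ℝ, x ≤ 0 → G x = 0 :=
    fun x hx => Set.indicator_of_notMem (s := Set.Ioi 0) (by simpa using hx) _
  obtain ⟨C, hC, hg⟩ := hg
  have hbound : ∀ x : ℝ, 0 < x →
      ‖G x‖ ≤ C / r * Real.exp (b * Real.log (x / r) - c * Real.exp (Real.log (x / r))) := by
    intro x hx
    have hxr : 0 < x / r := div_pos hx hrpos
    rw [hGpos x hx, norm_div, norm_mul]
    have h1 : ‖Complex.exp (2 * π * Complex.I * x * y)‖ = 1 := by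
      rw [show (2 * π * Complex.I * x * y : ℂ) = ((2 * π * x * y : ℝ) : ℂ) * Complex.I by
        push_cast; ring]
      exact Complex.norm_exp_ofReal_mul_I _
    rw [h1, mul_one, Complex.norm_real, Real.norm_eq_abs, abs_of_pos hx, div_le_iff₀ hx]
    refine (hg _ (by simp)).trans (le_of_eq ?_)
    have h2 : Real.exp ((1 + b) * Real.log (x / r) - c * Real.exp (Real.log (x / r))) =
        x / r * Real.exp (b * Real.log (x / r) - c * Real.exp (Real.log (x / r))) := by
      rw [show (1 + b) * Real.log (x / r) - c * Real.exp (Real.log (x / r)) =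
        Real.log (x / r) + (b * Real.log (x / r) - c * Real.exp (Real.log (x / r))) by ring,
        Real.exp_add]
      congr 1
      exact Real.exp_log hxr
    simp only [Complex.add_re, Complex.ofReal_re, Complex.mul_re, Complex.I_re, mul_zero,
      Complex.ofReal_im, Complex.I_im, mul_one, sub_self, add_zero]
    rw [h2]
    field_simp
  have hcont : Continuous G := by
    rw [continuous_iff_continuousAt]
    intro x
    rcases lt_trichotomy x 0 with hx | rfl | hx
    · refine ContinuousAt.congr (f := fun _ => (0 : ℂ)) continuousAt_const ?_
      filter_upwards [gt_mem_nhds hx] with z hz using (hGneg z hz.le).symm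
    · rw [ContinuousAt, hGneg 0 le_rfl]
      have h1 : Tendsto (fun x : ℝ => Real.log (x / r)) (𝓝[>] 0) atBot := by
        refine Real.tendsto_log_nhdsGT_zero.comp ?_
        refine tendsto_nhdsWithin_iff.2 ⟨?_, ?_⟩
        · have : Tendsto (fun x : ℝ => x / r) (𝓝 0) (𝓝 (0 / r)) :=
            (continuous_id.div_const r).tendsto 0
          rw [zero_div] at this
          exact this.mono_left nhdsWithin_le_nhds
        · filter_upwards [self_mem_nhdsWithin] with z hz using div_pos hz hrpos
      have h2 := ((tendsto_exp_sub_exp_atBot hb hc).comp h1).const_mul (C / r)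
      rw [mul_zero] at h2
      have h3 : Tendsto G (𝓝[>] 0) (𝓝 0) := by
        refine squeeze_zero_norm' ?_ h2
        filter_upwards [self_mem_nhdsWithin] with z hz using hbound z hz
      have h4 : Tendsto G (𝓝[≤] 0) (𝓝 0) := by
        refine tendsto_const_nhds.congr' ?_
        filter_upwards [self_mem_nhdsWithin] with z hz using (hGneg z hz).symm
      have := h4.sup h3
      rwa [← nhdsWithin_union, Set.Iic_union_Ioi, nhdsWithin_univ] at this
    · have : ContinuousAt (fun x : ℝ => g (Real.log (x / r) + α * Complex.I) *
          Complex.exp (2 * π * Complex.I * x * y) / x) x := by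
        refine ContinuousAt.div (ContinuousAt.mul ?_ (by fun_prop)) (by fun_prop)
          (by exact_mod_cast hx.ne')
        refine ContinuousAt.comp (f := fun x : ℝ => ((Real.log (x / r) : ℝ) : ℂ) + α * Complex.I)
          (hd _ (by simp)).continuousAt ?_
        have : ContinuousAt (fun x : ℝ => Real.log (x / r)) x :=
          (continuousAt_id.div_const r).log (div_pos hx hrpos).ne'
        exact (Complex.continuous_ofReal.continuousAt.comp this).add continuousAt_const
      refine this.congr ?_
      filter_upwards [lt_mem_nhds hx] with z hz using (hGpos z hz).symm
  -- G decays faster than any power at +∞; the exponent 2 is just one that exceeds 1.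
  have hO : G =O[cocompact ℝ] fun x : ℝ => |x| ^ (-2 : ℝ) := by
    obtain ⟨K, hK⟩ : ∃ K : ℝ, ∀ u : ℝ, Real.exp ((b + 2) * u - c * Real.exp u) ≤ K :=
      ⟨Real.exp (2 * (b + 2) ^ 2 / c) , fun u => (exp_sub_exp_le hc (by linarith) u).trans (by
        have : Real.exp (-((b + 2) * |u|)) ≤ 1 := by
          rw [Real.exp_le_one_iff]
          have : 0 ≤ (b + 2) * |u| := by positivity
          linarith
        exact mul_le_of_le_one_right (Real.exp_pos _).le this)⟩
    have hK0 : 0 ≤ K := (Real.exp_pos _).le.trans (hK 0)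
    refine Asymptotics.IsBigO.of_bound (C / r * K * r ^ 2) (Eventually.of_forall fun x => ?_)
    rcases le_or_gt x 0 with hx | hx
    · rw [hGneg x hx, norm_zero]
      positivity
    · refine (hbound x hx).trans ?_
      have hxr : 0 < x / r := div_pos hx hrpos
      have h2 : Real.exp (b * Real.log (x / r) - c * Real.exp (Real.log (x / r))) =
          Real.exp ((b + 2) * Real.log (x / r) - c * Real.exp (Real.log (x / r))) *
            (x / r) ^ (-2 : ℝ) := by
        rw [Real.rpow_def_of_pos hxr, ← Real.exp_add]
        ring_nf
      rw [h2, Real.norm_eq_abs, abs_of_pos (by positivity), abs_of_pos hx,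
        Real.div_rpow hx.le hrpos.le, Real.rpow_neg hx.le, Real.rpow_neg hrpos.le]
      norm_cast
      have := hK (Real.log (x / r))
      calc _ ≤ C / r * (K * ((x ^ 2)⁻¹ / (r ^ 2)⁻¹)) := by gcongr
        _ = _ := by field_simp
  have hF : ∀ l : ℤ, FourierTransform.fourier G l = ∫ u : ℝ, g (u + α * Complex.I) *
      Complex.exp (R * Complex.I * (y - l) * Real.exp u) := by
    intro l
    rw [Real.fourier_real_eq_integral_exp_smul]
    have h1 : (fun v : ℝ => Complex.exp (((-2 * π * v * l : ℝ) : ℂ) * Complex.I) • G v) =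
        Set.indicator (Set.Ioi 0) (fun x : ℝ => g (Real.log (x / r) + α * Complex.I) *
          Complex.exp (2 * π * Complex.I * x * (y - l)) / x) := by
      funext v
      by_cases hv : v ∈ Set.Ioi (0 : ℝ)
      · rw [hGpos v hv, Set.indicator_of_mem hv, smul_eq_mul, mul_div_assoc', mul_left_comm,
          ← Complex.exp_add]
        push_cast
        ring_nf
      · rw [hGneg v (by simpa using hv), Set.indicator_of_notMem hv, smul_zero]
    rw [h1, integral_indicator measurableSet_Ioi, integral_Ioi_eq_integral_exp r hrpos]
    refine integral_congr_ae (Eventually.of_forall fun u => ?_)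
    have h2 : Real.log (r * Real.exp u / r) = u := by
      rw [mul_div_cancel_left₀ _ hrpos.ne', Real.log_exp]
    have h3 : ((r * Real.exp u : ℝ) : ℂ) ≠ 0 := by
      exact_mod_cast (mul_pos hrpos (Real.exp_pos u)).ne'
    simp only [h2]
    rw [mul_div_cancel₀ _ h3]
    congr 2
    have hpi : (π : ℂ) ≠ 0 := by exact_mod_cast Real.pi_ne_zero
    rw [hr]
    push_cast
    field_simp
  -- No decay of the Fourier transform is estimated: the summability over the integers is the
  -- hypothesis `hsum`.
  have hP := Real.tsum_eq_tsum_fourier_of_rpow_decay_of_summable hcont one_lt_two hO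
    (by simpa only [hF] using hsum.summable) 0
  simp only [zero_add, hF, QuotientAddGroup.mk_zero, fourier_eval_zero, mul_one] at hP
  rw [hsum.tsum_eq] at hP
  rw [← hP]
  -- G vanishes at the integers l ≤ 0, so the sum over ℤ is a sum over m + 1 with m a natural
  -- number.
  have hinj : Function.Injective (fun m : ℕ => (m : ℤ) + 1) := fun a b h => by simpa using h
  rw [← hinj.tsum_eq]
  · refine tsum_congr fun m => ?_
    have hm : (0 : ℝ) < ((m : ℤ) + 1 : ℤ) := by
      push_cast
      positivity
    rw [hGpos _ hm]
    have : (((m : ℤ) + 1 : ℤ) : ℝ) / r = 2 * π * (m + 1) / R := by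
      rw [hr]
      push_cast
      field_simp
    rw [this]
    push_cast
    rfl
  · intro l hl
    by_contra hcon
    refine hl (hGneg _ ?_)
    have : ¬ (0 : ℤ) < l := fun h => hcon ⟨(l - 1).toNat, by simp only; omega⟩
    exact_mod_cast not_lt.1 this

/-- Here α is the direction in which ωt is positive imaginary, that is, the ray of the poles 2πim/ω
with m > 0. The formula shows on which side of that ray Re(ωt) is positive: at angles just below α.
-/
theorem re_mul_exp_of_ray {ω : ℂ} {α : ℝ}
    (hα : ω * Complex.exp (α * Complex.I) = ‖ω‖ * Complex.I) (φ : ℝ) :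
    (ω * Complex.exp (φ * Complex.I)).re = -(‖ω‖ * Real.sin (φ - α)) := by
  have : ω * Complex.exp (φ * Complex.I) =
      ‖ω‖ * (Complex.I * Complex.exp ((φ - α : ℝ) * Complex.I)) := by
    rw [← mul_assoc, ← hα, mul_assoc, ← Complex.exp_add]
    push_cast
    ring_nf
  rw [this, Complex.re_ofReal_mul, Complex.I_mul_re, Complex.exp_ofReal_mul_I_im]
  ring

theorem stripBound_of_re_nonpos {f : ℂ → ℂ} {S : Set ℝ}
    (h : ∀ w : ℂ, w.im ∈ S → (f w).re ≤ 0) : StripBound (fun w => Complex.exp (f w)) 0 0 S :=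
  ⟨1, zero_le_one, fun w hw => by simpa [Complex.norm_exp] using h w hw⟩

/-- The line integral jumps by the sum of the residues when the line crosses a ray of poles. -/
theorem integral_line_sub_integral_line {ω : ℂ} {y α φ₁ φ₂ b c : ℝ} {g : ℂ → ℂ}
    (hω : ω ≠ 0) (hα : ω * Complex.exp (α * Complex.I) = ‖ω‖ * Complex.I)
    (hy0 : 0 < y) (hy1 : y < 1) (h₁ : φ₁ < α) (h₂ : α < φ₂) (h₁' : α - π < φ₁) (h₂' : φ₂ < α + π)
    (hd : ∀ w : ℂ, w.im ∈ Set.Icc φ₁ φ₂ → DifferentiableAt ℂ g w) (hb : 0 < b) (hc : 0 < c)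
    (hg : StripBound g (1 + b) c (Set.Icc φ₁ φ₂)) :
    (∫ u : ℝ, g (u + φ₁ * Complex.I) * bernoulliKernel ω y (Complex.exp (u + φ₁ * Complex.I))) -
      (∫ u : ℝ, g (u + φ₂ * Complex.I) * bernoulliKernel ω y (Complex.exp (u + φ₂ * Complex.I))) =
      ∑' m : ℕ, g (Real.log (2 * π * (m + 1) / ‖ω‖) + α * Complex.I) *
        Complex.exp (2 * π * Complex.I * (m + 1) * y) / (m + 1) := by
  have hn : 0 < ‖ω‖ := norm_pos_iff.2 hω
  have hray := re_mul_exp_of_ray hα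
  have hpos1 : 0 < (ω * Complex.exp (φ₁ * Complex.I)).re := by
    rw [hray, neg_pos]
    exact mul_neg_of_pos_of_neg hn (Real.sin_neg_of_neg_of_neg_pi_lt (by linarith) (by linarith))
  have hpos2 : 0 < (-ω * Complex.exp (φ₂ * Complex.I)).re := by
    rw [neg_mul, Complex.neg_re, hray, neg_neg]
    exact mul_pos hn (Real.sin_pos_of_pos_of_lt_pi (by linarith) (by linarith))
  set A : ℤ → ℂ := fun l => ∫ u : ℝ, g (u + α * Complex.I) *
      Complex.exp (ω * (y - l) * Complex.exp (u + α * Complex.I)) with hA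
  have hdE : ∀ l : ℤ, ∀ w : ℂ, w.im ∈ Set.Icc φ₁ φ₂ →
      DifferentiableAt ℂ (fun w => g w * Complex.exp (ω * (y - l) * Complex.exp w)) w :=
    fun l w hw => (hd w hw).mul (by fun_prop)
  have hre : ∀ (l : ℤ) (w : ℂ), (ω * (y - l) * Complex.exp w).re =
      (l - y) * (Real.exp w.re * (‖ω‖ * Real.sin (w.im - α))) := by
    intro l w
    have : ω * (y - l) * Complex.exp w = ((y - l : ℝ) : ℂ) * (ω * Complex.exp w) := by
      push_cast
      ring
    rw [this, Complex.re_ofReal_mul, re_mul_exp, hray]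
    ring
  -- The factor e^{ω(y-l)t} is bounded by 1 where (y - l) Re(ωt) ≤ 0. For l ≥ 1 this holds between
  -- φ₁ and α, for l ≤ 0 between α and φ₂; either way the term can be moved onto the ray α.
  have hshift1 : ∀ l : ℤ, 1 ≤ l → A l = ∫ u : ℝ, g (u + φ₁ * Complex.I) *
      Complex.exp (ω * (y - l) * Complex.exp (u + φ₁ * Complex.I)) := by
    intro l hl
    have hsub : Set.Icc φ₁ α ⊆ Set.Icc φ₁ φ₂ := Set.Icc_subset_Icc_right h₂.le
    refine (integral_line_eq (f := fun w => g w * Complex.exp (ω * (y - l) * Complex.exp w))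
      h₁.le (fun w hw => hdE l w (hsub hw)) (b := 1 + b + 0) (c := c + 0) (by linarith)
      (by linarith) ((hg.mono hsub).mul (stripBound_of_re_nonpos fun w hw => ?_))).symm
    rw [hre]
    have h3 : (1 : ℝ) ≤ l := by exact_mod_cast hl
    refine mul_nonpos_of_nonneg_of_nonpos (by linarith) ?_
    refine mul_nonpos_of_nonneg_of_nonpos (Real.exp_pos _).le ?_
    exact mul_nonpos_of_nonneg_of_nonpos hn.le
      (Real.sin_nonpos_of_nonpos_of_neg_pi_le (by linarith [hw.2]) (by linarith [hw.1]))
  have hshift2 : ∀ l : ℤ, l ≤ 0 → A l = ∫ u : ℝ, g (u + φ₂ * Complex.I) *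
      Complex.exp (ω * (y - l) * Complex.exp (u + φ₂ * Complex.I)) := by
    intro l hl
    have hsub : Set.Icc α φ₂ ⊆ Set.Icc φ₁ φ₂ := Set.Icc_subset_Icc_left h₁.le
    refine integral_line_eq (f := fun w => g w * Complex.exp (ω * (y - l) * Complex.exp w))
      h₂.le (fun w hw => hdE l w (hsub hw)) (b := 1 + b + 0) (c := c + 0) (by linarith)
      (by linarith) ((hg.mono hsub).mul (stripBound_of_re_nonpos fun w hw => ?_))
    rw [hre]
    have h3 : (l : ℝ) ≤ 0 := by exact_mod_cast hl
    refine mul_nonpos_of_nonpos_of_nonneg (by linarith) ?_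
    refine mul_nonneg (Real.exp_pos _).le (mul_nonneg hn.le ?_)
    exact Real.sin_nonneg_of_nonneg_of_le_pi (by linarith [hw.1]) (by linarith [hw.2])
  have hs1 := hasSum_integral_bernoulliKernel hy0 hy1 hpos1
    (fun w hw => hd w (by rw [hw]; exact ⟨le_rfl, by linarith⟩)) hb hc
    (hg.mono (Set.singleton_subset_iff.2 ⟨le_rfl, by linarith⟩))
  have hs2 := hasSum_integral_bernoulliKernel (y := 1 - y) (by linarith) (by linarith) hpos2
    (fun w hw => hd w (by rw [hw]; exact ⟨by linarith, le_rfl⟩)) hb hc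
    (hg.mono (Set.singleton_subset_iff.2 ⟨by linarith, le_rfl⟩))
  -- Beyond the ray the expansion is that of the reflected kernel: it supplies the terms l ≤ 0 with
  -- a minus sign. So the difference of the two integrals is a single series over all l.
  have hker : (∫ u : ℝ, g (u + φ₂ * Complex.I) *
        bernoulliKernel ω y (Complex.exp (u + φ₂ * Complex.I))) =
      -∫ u : ℝ, g (u + φ₂ * Complex.I) *
        bernoulliKernel (-ω) (1 - y) (Complex.exp (u + φ₂ * Complex.I)) := by
    rw [← integral_neg]
    refine integral_congr_ae (Eventually.of_forall fun u => ?_)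
    simp only
    rw [bernoulliKernel_reflect ω y, mul_neg]
  rw [hker, sub_neg_eq_add]
  have hsumA : HasSum (fun j : ℤ => A (-j))
      ((∫ u : ℝ, g (u + φ₂ * Complex.I) *
        bernoulliKernel (-ω) (1 - y) (Complex.exp (u + φ₂ * Complex.I))) +
      ∫ u : ℝ, g (u + φ₁ * Complex.I) *
        bernoulliKernel ω y (Complex.exp (u + φ₁ * Complex.I))) := by
    refine HasSum.of_nat_of_neg_add_one ?_ ?_
    · convert hs2 using 2 with l
      rw [hshift2 _ (by omega)]
      refine integral_congr_ae (Eventually.of_forall fun u => ?_)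
      push_cast
      ring_nf
    · convert hs1 using 2 with l
      rw [hshift1 _ (by omega)]
      refine integral_congr_ae (Eventually.of_forall fun u => ?_)
      push_cast
      ring_nf
  have hsumA' : HasSum A ((∫ u : ℝ, g (u + φ₁ * Complex.I) *
        bernoulliKernel ω y (Complex.exp (u + φ₁ * Complex.I))) +
      ∫ u : ℝ, g (u + φ₂ * Complex.I) *
        bernoulliKernel (-ω) (1 - y) (Complex.exp (u + φ₂ * Complex.I))) := by
    rw [add_comm]
    convert! (Equiv.neg ℤ).hasSum_iff.2 hsumA using 1
    funext l
    simp
  refine poisson_log hn y (fun w hw => hd w (by rw [hw]; exact ⟨h₁.le, h₂.le⟩)) hb hc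
    (hg.mono (Set.singleton_subset_iff.2 ⟨h₁.le, h₂.le⟩)) ?_
  convert! hsumA' using 1
  funext l
  refine integral_congr_ae (Eventually.of_forall fun u => ?_)
  have : ω * (y - l) * Complex.exp (u + α * Complex.I) =
      ‖ω‖ * Complex.I * (y - l) * Real.exp u := by
    rw [← hα, Complex.exp_add]
    push_cast
    ring
  simp only [this]

/-! ### Adding up the jumps over all rays of poles. -/

/-- A function on an interval that is locally constant except for finitely many jumps. -/
theorem sub_eq_sum_jumps {P : Type*} [Fintype P] {α : P → ℝ} (hinj : Function.Injective α)
    {f : ℝ → ℂ} {R : P → ℂ} {a b : ℝ} (hab : a ≤ b) (hα : ∀ p, α p ∈ Set.Ioo a b)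
    (hreg : ∀ φ ∈ Set.Icc a b, (∀ p, α p ≠ φ) → ∀ᶠ φ' in 𝓝 φ, f φ' = f φ)
    (hjump : ∀ p, ∃ ε > 0, ∀ φ₁ ∈ Set.Ioo (α p - ε) (α p), ∀ φ₂ ∈ Set.Ioo (α p) (α p + ε),
      f φ₁ - f φ₂ = R p) :
    f a - f b = ∑ p, R p := by
  classical
  -- Adding to f the jumps already passed should leave a constant function.
  set J : ℝ → ℂ := fun φ => f φ + ∑ p, if α p < φ then R p else 0 with hJ
  have hloc : ∀ x, ∀ p, α p ≠ x → ∀ᶠ φ in 𝓝 x, (α p < φ ↔ α p < x) := by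
    intro x p hp
    rcases lt_or_gt_of_ne hp with h | h
    · filter_upwards [lt_mem_nhds h] with φ hφ using iff_of_true hφ h
    · filter_upwards [gt_mem_nhds h] with φ hφ using iff_of_false hφ.not_gt h.not_gt
  have hnonpole : ∀ x ∈ Set.Icc a b, (∀ p, α p ≠ x) → ∀ᶠ φ in 𝓝 x, J φ = J x := by
    intro x hx hne
    filter_upwards [hreg x hx hne, Filter.eventually_all.2 fun p => hloc x p (hne p)] with φ h1 h2
    simp only [hJ, h1, h2]
  -- Nothing is known about f at the jump points themselves, so J is replaced by its limit c through
  -- punctured neighbourhoods, which is locally constant everywhere.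
  have hlim : ∀ x ∈ Set.Icc a b, ∃ c, (∀ᶠ φ in 𝓝[≠] x, J φ = c) ∧
      ((∀ p, α p ≠ x) → J x = c) := by
    intro x hx
    by_cases hne : ∀ p, α p ≠ x
    · exact ⟨J x, (hnonpole x hx hne).filter_mono nhdsWithin_le_nhds, fun _ => rfl⟩
    · push Not at hne
      obtain ⟨p, rfl⟩ := hne
      obtain ⟨ε, hε, hj⟩ := hjump p
      set S : ℂ := ∑ q ∈ Finset.univ.erase p, if α q < α p then R q else 0
      have h3 : ∀ᶠ φ in 𝓝 (α p), ∀ q ∈ Finset.univ.erase p, (α q < φ ↔ α q < α p) :=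
        (Filter.eventually_all_finset _).2 fun q hq =>
          hloc _ q fun h => (Finset.ne_of_mem_erase hq) (hinj h)
      refine ⟨f (α p - ε / 2) + S, ?_, fun h => absurd rfl (h p)⟩
      have hmem1 : α p - ε / 2 ∈ Set.Ioo (α p - ε) (α p) := ⟨by linarith, by linarith⟩
      have hmem2 : α p + ε / 2 ∈ Set.Ioo (α p) (α p + ε) := ⟨by linarith, by linarith⟩
      have h4 : ∀ᶠ φ in 𝓝 (α p), φ ∈ Set.Ioo (α p - ε) (α p + ε) :=
        Ioo_mem_nhds (by linarith) (by linarith)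
      rw [eventually_nhdsWithin_iff]
      filter_upwards [h3, h4] with φ h5 h6 h7
      have h8 : (∑ q ∈ Finset.univ.erase p, if α q < φ then R q else 0) = S :=
        Finset.sum_congr rfl fun q hq => by simp only [h5 q hq]
      simp only [hJ]
      rw [← Finset.add_sum_erase _ _ (Finset.mem_univ p), h8]
      rcases lt_or_gt_of_ne h7 with h | h
      · rw [if_neg h.not_gt]
        have e1 := hj φ ⟨h6.1, h⟩ _ hmem2
        have e2 := hj _ hmem1 _ hmem2
        linear_combination e1 - e2
      · rw [if_pos h]
        have e1 := hj _ hmem1 φ ⟨h, h6.2⟩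
        linear_combination -e1
  choose! c hc1 hc2 using hlim
  have hconst : ∀ x ∈ Set.Icc a b, ∀ᶠ x' in 𝓝[Set.Icc a b] x, c x' = c x := by
    intro x hx
    have h1 := eventually_eventually_nhdsWithin.2 (hc1 x hx)
    rw [eventually_nhdsWithin_iff] at h1
    rw [eventually_nhdsWithin_iff]
    filter_upwards [h1] with x' h2 h3
    by_cases hxx : x' = x
    · rw [hxx]
    · have h4 : ∀ᶠ φ in 𝓝[≠] x', J φ = c x := by
        have h5 := h2 hxx
        rw [isOpen_compl_singleton.nhdsWithin_eq hxx] at h5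
        exact h5.filter_mono nhdsWithin_le_nhds
      -- A punctured neighbourhood of x' is nonempty, and on it J equals both c x and c x'.
      obtain ⟨φ, h7, h8⟩ := (h4.and (hc1 x' h3)).exists
      exact h8.symm.trans h7
  have hcab : c a = c b := by
    have h := constant_of_has_deriv_right_zero (f := c) (a := a) (b := b)
      (fun x hx => by
        refine ContinuousWithinAt.congr_of_eventuallyEq continuousWithinAt_const
          (hconst x hx) rfl) (fun x hx => by
        have h1 : ∀ᶠ x' in 𝓝[Set.Ici x] x, c x' = c x := by
          have h2 : Set.Icc a b ∈ 𝓝[Set.Ici x] x := by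
            filter_upwards [self_mem_nhdsWithin,
              mem_nhdsWithin_of_mem_nhds (gt_mem_nhds hx.2)] with z hz hz'
            exact ⟨hx.1.trans hz, le_of_lt hz'⟩
          exact (hconst x ⟨hx.1, hx.2.le⟩).filter_mono
            (nhdsWithin_le_of_mem h2)
        exact (hasDerivWithinAt_const x _ (c x)).congr_of_eventuallyEq h1 rfl)
    exact (h b ⟨hab, le_rfl⟩).symm
  have ha : J a = c a := hc2 a ⟨le_rfl, hab⟩ fun p => (hα p).1.ne'
  have hb : J b = c b := hc2 b ⟨hab, le_rfl⟩ fun p => (hα p).2.ne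
  have hJa : J a = f a := by
    simp only [hJ]
    rw [Finset.sum_eq_zero fun p _ => if_neg (hα p).1.not_gt, add_zero]
  have hJb : J b = f b + ∑ p, R p := by
    simp only [hJ]
    rw [Finset.sum_congr rfl fun p _ => if_pos (hα p).2]
  rw [← hJa, ha, hcab, ← hb, hJb]
  ring

/-- The product of the kernels over `T`, times `t ^ s`, in the logarithmic coordinate. -/
noncomputable def kernelProd {n : ℕ} (ω : Fin n → ℂ) (y : ℝ) (s : ℂ) (T : Finset (Fin n))
    (w : ℂ) : ℂ :=
  (∏ j ∈ T, bernoulliKernel (ω j) y (Complex.exp w)) * Complex.exp (s * w)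

theorem exists_uniform_re_bound {n : ℕ} (ω : Fin n → ℂ) (T : Finset (Fin n)) {φ₀ : ℝ}
    (h : ∀ j ∈ T, (ω j * Complex.exp (φ₀ * Complex.I)).re ≠ 0) :
    ∃ ε > 0, ∃ κ > 0, ∀ φ ∈ Set.Icc (φ₀ - ε) (φ₀ + ε), ∀ j ∈ T,
      κ ≤ |(ω j * Complex.exp (φ * Complex.I)).re| := by
  obtain ⟨κ, hκ, hκ'⟩ : ∃ κ > 0, ∀ j ∈ T, κ < |(ω j * Complex.exp (φ₀ * Complex.I)).re| := by
    have : ∀ᶠ κ : ℝ in 𝓝[>] 0, ∀ j ∈ T, κ < |(ω j * Complex.exp (φ₀ * Complex.I)).re| :=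
      ((Filter.eventually_all_finset _).2 fun j hj =>
        gt_mem_nhds (abs_pos.2 (h j hj))).filter_mono nhdsWithin_le_nhds
    obtain ⟨κ, h1, h2⟩ := (this.and self_mem_nhdsWithin).exists
    exact ⟨κ, h2, h1⟩
  have : ∀ᶠ φ : ℝ in 𝓝 φ₀, ∀ j ∈ T, κ < |(ω j * Complex.exp (φ * Complex.I)).re| :=
    (Filter.eventually_all_finset _).2 fun j hj => by
      have hc : Continuous fun φ : ℝ => |(ω j * Complex.exp (φ * Complex.I)).re| :=
        continuous_abs.comp (Complex.continuous_re.comp (by fun_prop))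
      exact hc.continuousAt.eventually (lt_mem_nhds (hκ' j hj))
  obtain ⟨ε, hε, hball⟩ := Metric.nhds_basis_closedBall.eventually_iff.1 this
  refine ⟨ε, hε, κ, hκ, fun φ hφ j hj => (hball ?_ j hj).le⟩
  rwa [Real.closedBall_eq_Icc]

/-- Each kernel has a simple pole at t = 0 and lowers the exponent by one. With all n kernels the
exponent is positive exactly for Re s > n. -/
theorem stripBound_kernelProd {n : ℕ} {ω : Fin n → ℂ} {y κ M : ℝ} (s : ℂ) {T : Finset (Fin n)}
    {S : Set ℝ} (hy0 : 0 < y) (hy1 : y < 1) (hκ : 0 < κ)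
    (hS : ∀ φ ∈ S, ∀ j ∈ T, κ ≤ |(ω j * Complex.exp (φ * Complex.I)).re|)
    (hM : ∀ φ ∈ S, |φ| ≤ M) :
    StripBound (kernelProd ω y s T) (s.re - T.card) (T.card * (min y (1 - y) * κ / 2)) S := by
  have h1 := (StripBound.prod T fun j hj =>
    stripBound_bernoulliKernel (ω := ω j) hy0 hy1 hκ fun φ hφ => hS φ hφ j hj).mul
    (stripBound_exp_mul s hM)
  unfold kernelProd
  convert h1 using 1 <;> ring

theorem differentiableAt_kernelProd {n : ℕ} {ω : Fin n → ℂ} (y : ℝ) (s : ℂ) {T : Finset (Fin n)}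
    {w : ℂ} (h : ∀ j ∈ T, (ω j * Complex.exp (w.im * Complex.I)).re ≠ 0) :
    DifferentiableAt ℂ (kernelProd ω y s T) w := by
  unfold kernelProd
  refine DifferentiableAt.mul ?_ (by fun_prop)
  exact DifferentiableAt.fun_finsetProd fun j hj => differentiableAt_bernoulliKernel_exp y (h j hj)

theorem mem_halfPlane_ne_zero {θ : ℝ} {z : ℂ} (hz : z ∈ halfPlane θ) : z ≠ 0 := by
  rintro rfl
  simp [halfPlane] at hz

/-- The direction in `(-θ, π - θ)` of the poles `2 π i m / ω`, `m > 0`. -/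
noncomputable def poleAngle (θ : ℝ) (ω : ℂ) : ℝ :=
  π / 2 - θ - Complex.arg (ω * Complex.exp (-(θ * Complex.I)))

theorem poleAngle_mem {θ : ℝ} {ω : ℂ} (hω : ω ∈ halfPlane θ) :
    poleAngle θ ω ∈ Set.Ioo (-θ) (π - θ) := by
  have h := Complex.abs_arg_lt_pi_div_two_iff.2 (Or.inl hω)
  rw [abs_lt] at h
  unfold poleAngle
  constructor <;> linarith [h.1, h.2]

theorem mul_exp_poleAngle (θ : ℝ) (ω : ℂ) :
    ω * Complex.exp (poleAngle θ ω * Complex.I) = ‖ω‖ * Complex.I := by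
  have h1 := Complex.norm_mul_exp_arg_mul_I (ω * Complex.exp (-(θ * Complex.I)))
  have h2 : ‖ω * Complex.exp (-(θ * Complex.I))‖ = ‖ω‖ := by
    rw [norm_mul, show (-(θ * Complex.I) : ℂ) = ((-θ : ℝ) : ℂ) * Complex.I by push_cast; ring,
      Complex.norm_exp_ofReal_mul_I, mul_one]
  rw [h2] at h1
  set A := Complex.arg (ω * Complex.exp (-(θ * Complex.I)))
  have h3 : Complex.exp (poleAngle θ ω * Complex.I) =
      Complex.I * (Complex.exp (-(θ * Complex.I)) * (Complex.exp (A * Complex.I))⁻¹) := by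
    have h4 : (poleAngle θ ω * Complex.I : ℂ) =
        π / 2 * Complex.I + (-(θ * Complex.I) + -(A * Complex.I)) := by
      unfold poleAngle
      push_cast
      ring
    rw [h4, Complex.exp_add, Complex.exp_add, Complex.exp_neg (A * Complex.I),
      Complex.exp_pi_div_two_mul_I]
  rw [h3, ← mul_assoc, ← mul_assoc, mul_right_comm ω, ← h1]
  have := Complex.exp_ne_zero (A * Complex.I)
  field_simp

theorem neg_mul_exp_poleAngle_add_pi (θ : ℝ) (ω : ℂ) :
    -ω * Complex.exp ((poleAngle θ ω + π : ℝ) * Complex.I) = ‖-ω‖ * Complex.I := by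
  rw [norm_neg, ← mul_exp_poleAngle θ ω]
  push_cast
  rw [add_mul, Complex.exp_add, Complex.exp_pi_mul_I]
  ring

/-- If both products were purely imaginary, their quotient ω/ω' would be real. Thus no two periods
share a ray of poles, and only one kernel is singular on each ray. -/
theorem re_mul_exp_ne_zero_of_ratio {ω ω' : ℂ} (h : (ω / ω').im ≠ 0) {φ : ℝ}
    (h' : (ω' * Complex.exp (φ * Complex.I)).re = 0) :
    (ω * Complex.exp (φ * Complex.I)).re ≠ 0 := by
  intro h0
  apply h
  have he := Complex.exp_ne_zero (φ * Complex.I)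
  rw [← mul_div_mul_right ω ω' he, Complex.div_im, h0, h']
  ring

theorem re_mul_exp_eq_zero_cases {θ φ : ℝ} {ω : ℂ} (hω : ω ∈ halfPlane θ)
    (hφ : φ ∈ Set.Icc (-θ) (2 * π - θ)) (h : (ω * Complex.exp (φ * Complex.I)).re = 0) :
    φ = poleAngle θ ω ∨ φ = poleAngle θ ω + π := by
  rw [re_mul_exp_of_ray (mul_exp_poleAngle θ ω), neg_eq_zero, mul_eq_zero, norm_eq_zero,
    or_iff_right (mem_halfPlane_ne_zero hω), Real.sin_eq_zero_iff] at h
  obtain ⟨k, hk⟩ := h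
  have hp := poleAngle_mem hω
  have h1 : (-1 : ℝ) < k := by
    by_contra hcon
    have := mul_le_mul_of_nonneg_right (not_lt.1 hcon) Real.pi_pos.le
    linarith [hφ.1, hp.2]
  have h2 : (k : ℝ) < 2 := by
    by_contra hcon
    have := mul_le_mul_of_nonneg_right (not_lt.1 hcon) Real.pi_pos.le
    linarith [hφ.2, hp.1]
  have h3 : (-1 : ℤ) < k := by exact_mod_cast h1
  have h4 : k < (2 : ℤ) := by exact_mod_cast h2
  interval_cases k
  · left
    norm_num at hk
    linarith
  · right
    norm_num at hk
    linarith

theorem kernelProd_erase {n : ℕ} (ω : Fin n → ℂ) (y : ℝ) (s : ℂ) (k : Fin n) (w : ℂ) :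
    kernelProd ω y s (Finset.univ.erase k) w * bernoulliKernel (ω k) y (Complex.exp w) =
      kernelProd ω y s Finset.univ w := by
  unfold kernelProd
  rw [← Finset.mul_prod_erase _ _ (Finset.mem_univ k)]
  ring

/-- The direction of the poles `± 2 π i m / ω_k`, `m > 0`. -/
noncomputable def rayAngle {n : ℕ} (θ : ℝ) (ω : Fin n → ℂ) (p : Fin n × Bool) : ℝ :=
  if p.2 then poleAngle θ (ω p.1) else poleAngle θ (ω p.1) + π

/-- The contribution of the poles `± 2 π i m / ω_k`, `m > 0`. -/
noncomputable def rayResidue {n : ℕ} (θ : ℝ) (ω : Fin n → ℂ) (y : ℝ) (s : ℂ)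
    (p : Fin n × Bool) : ℂ :=
  if p.2 then ∑' m : ℕ, kernelProd ω y s (Finset.univ.erase p.1)
      (Real.log (2 * π * (m + 1) / ‖ω p.1‖) + poleAngle θ (ω p.1) * Complex.I) *
      Complex.exp (2 * π * Complex.I * (m + 1) * y) / (m + 1)
  else -∑' m : ℕ, kernelProd ω y s (Finset.univ.erase p.1)
      (Real.log (2 * π * (m + 1) / ‖-ω p.1‖) + (poleAngle θ (ω p.1) + π : ℝ) * Complex.I) *
      Complex.exp (2 * π * Complex.I * (m + 1) * (1 - y : ℝ)) / (m + 1)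

/-- Between rays of poles the integral does not depend on the direction, by Cauchy's theorem; at
each of the 2n rays exactly one kernel is singular and the one-ray formula gives the jump. -/
theorem integral_sub_integral_rotated {n : ℕ} (hn : 2 ≤ n) {θ : ℝ} {ω : Fin n → ℂ}
    (hω : ∀ j, ω j ∈ halfPlane θ) (hratio : ∀ j k, j ≠ k → (ω j / ω k).im ≠ 0)
    {y : ℝ} (hy0 : 0 < y) (hy1 : y < 1) {s : ℂ} (hs : (n : ℝ) < s.re) :
    (∫ u : ℝ, kernelProd ω y s Finset.univ (u + (-θ : ℝ) * Complex.I)) -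
      (∫ u : ℝ, kernelProd ω y s Finset.univ (u + (2 * π - θ : ℝ) * Complex.I)) =
      ∑ p, rayResidue θ ω y s p := by
  have hpi := Real.pi_pos
  have hmin : 0 < min y (1 - y) := lt_min hy0 (by linarith)
  have hray0 : ∀ p : Fin n × Bool,
      (ω p.1 * Complex.exp (rayAngle θ ω p * Complex.I)).re = 0 := by
    rintro ⟨k, σ⟩
    rw [re_mul_exp_of_ray (mul_exp_poleAngle θ (ω k))]
    cases σ <;> simp [rayAngle]
  have hother : ∀ p : Fin n × Bool, ∀ j ∈ Finset.univ.erase p.1,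
      (ω j * Complex.exp (rayAngle θ ω p * Complex.I)).re ≠ 0 := fun p j hj =>
    re_mul_exp_ne_zero_of_ratio (hratio j p.1 (Finset.ne_of_mem_erase hj)) (hray0 p)
  refine sub_eq_sum_jumps (α := rayAngle θ ω)
    (f := fun φ => ∫ u : ℝ, kernelProd ω y s Finset.univ (u + φ * Complex.I)) ?_ (by linarith)
    ?_ ?_ ?_
  · rintro ⟨k, σ⟩ ⟨j, τ⟩ h
    have hkj : k = j := by
      by_contra hne
      refine hother (k, σ) j (by simp [Ne.symm hne]) ?_
      rw [h]
      exact hray0 (j, τ)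
    subst hkj
    cases σ <;> cases τ <;> simp [rayAngle, hpi.ne'] at h ⊢
  · rintro ⟨k, σ⟩
    have := poleAngle_mem (hω k)
    cases σ <;> simp only [rayAngle, Bool.false_eq_true, if_false, if_true] <;>
      constructor <;> linarith [this.1, this.2]
  · intro φ hφ hne
    have hreg : ∀ j ∈ Finset.univ, (ω j * Complex.exp (φ * Complex.I)).re ≠ 0 := by
      intro j _ h
      rcases re_mul_exp_eq_zero_cases (hω j) hφ h with h | h
      · exact hne (j, true) (by simp [rayAngle, h])
      · exact hne (j, false) (by simp [rayAngle, h])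
    obtain ⟨ε, hε, κ, hκ, hb⟩ := exists_uniform_re_bound ω Finset.univ hreg
    have hSB := stripBound_kernelProd (M := |φ| + ε) s hy0 hy1 hκ hb (fun ψ hψ => by
      have := abs_le.2 (show -ε ≤ ψ - φ ∧ ψ - φ ≤ ε from ⟨by linarith [hψ.1], by linarith [hψ.2]⟩)
      calc |ψ| = |φ + (ψ - φ)| := by ring_nf
        _ ≤ |φ| + |ψ - φ| := abs_add_le _ _
        _ ≤ _ := by linarith)
    rw [Finset.card_univ, Fintype.card_fin] at hSB
    have hd : ∀ w : ℂ, w.im ∈ Set.Icc (φ - ε) (φ + ε) →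
        DifferentiableAt ℂ (kernelProd ω y s Finset.univ) w := fun w hw =>
      differentiableAt_kernelProd y s fun j hj => abs_pos.1 (hκ.trans_le (hb _ hw j hj))
    have hn0 : (0 : ℝ) < n := by
      have : 0 < n := by omega
      exact_mod_cast this
    have hc : 0 < n * (min y (1 - y) * κ / 2) := by positivity
    filter_upwards [Icc_mem_nhds (show φ - ε < φ by linarith) (show φ < φ + ε by linarith)]
      with ψ hψ
    rcases le_total ψ φ with h | h
    · have hsub : Set.Icc ψ φ ⊆ Set.Icc (φ - ε) (φ + ε) :=
        Set.Icc_subset_Icc hψ.1 (by linarith)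
      exact integral_line_eq h (fun w hw => hd w (hsub hw)) (by linarith) hc (hSB.mono hsub)
    · have hsub : Set.Icc φ ψ ⊆ Set.Icc (φ - ε) (φ + ε) :=
        Set.Icc_subset_Icc (by linarith) hψ.2
      exact (integral_line_eq h (fun w hw => hd w (hsub hw)) (by linarith) hc (hSB.mono hsub)).symm
  · intro p
    obtain ⟨ε, hε, κ, hκ, hb⟩ := exists_uniform_re_bound ω _ (hother p)
    set φ := rayAngle θ ω p with hφdef
    have hSB := stripBound_kernelProd (M := |φ| + ε) s hy0 hy1 hκ hb (fun ψ hψ => by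
      have := abs_le.2 (show -ε ≤ ψ - φ ∧ ψ - φ ≤ ε from ⟨by linarith [hψ.1], by linarith [hψ.2]⟩)
      calc |ψ| = |φ + (ψ - φ)| := by ring_nf
        _ ≤ |φ| + |ψ - φ| := abs_add_le _ _
        _ ≤ _ := by linarith)
    -- With n ≥ 2 at least one kernel remains after removing the singular one, and it provides the
    -- decay at infinity along the ray.
    have hn1 : (1 : ℝ) < n := by
      have : 1 < n := by omega
      exact_mod_cast this
    rw [Finset.card_erase_of_mem (Finset.mem_univ _), Finset.card_univ, Fintype.card_fin,
      Nat.cast_sub (by omega), Nat.cast_one, show s.re - (n - 1) = 1 + (s.re - n) by ring] at hSB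
    have hd : ∀ w : ℂ, w.im ∈ Set.Icc (φ - ε) (φ + ε) →
        DifferentiableAt ℂ (kernelProd ω y s (Finset.univ.erase p.1)) w := fun w hw =>
      differentiableAt_kernelProd y s fun j hj => abs_pos.1 (hκ.trans_le (hb _ hw j hj))
    have hc : 0 < ((n : ℝ) - 1) * (min y (1 - y) * κ / 2) := by
      have : (0 : ℝ) < n - 1 := by linarith
      positivity
    -- Within ε of the ray the other kernels are regular; within π of it the singular kernel meets
    -- no other of its own rays.
    refine ⟨min ε π, lt_min hε hpi, fun φ₁ hφ₁ φ₂ hφ₂ => ?_⟩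
    have he1 := min_le_left ε π
    have he2 := min_le_right ε π
    have hsub : Set.Icc φ₁ φ₂ ⊆ Set.Icc (φ - ε) (φ + ε) :=
      Set.Icc_subset_Icc (by linarith [hφ₁.1]) (by linarith [hφ₂.2])
    have hω0 : ω p.1 ≠ 0 := mem_halfPlane_ne_zero (hω p.1)
    simp only [← kernelProd_erase ω y s p.1]
    rcases p with ⟨k, σ⟩
    cases σ
    -- The opposite ray is the ray of positive poles of -ω_k, so the formula is used with -ω_k and 1
    -- - y; the reflection brings the minus sign.
    · have hα : -ω k * Complex.exp (φ * Complex.I) = ‖-ω k‖ * Complex.I := by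
        rw [hφdef]
        simpa [rayAngle] using neg_mul_exp_poleAngle_add_pi θ (ω k)
      have h := integral_line_sub_integral_line (neg_ne_zero.2 hω0) hα (y := 1 - y)
        (by linarith) (by linarith) hφ₁.2 hφ₂.1 (by linarith [hφ₁.1]) (by linarith [hφ₂.2])
        (fun w hw => hd w (hsub hw)) (b := s.re - n) (by linarith) hc (hSB.mono hsub)
      simp only [bernoulliKernel_reflect (ω k) y, mul_neg, integral_neg]
      rw [neg_sub_neg, ← neg_sub, h]
      simp [rayResidue, hφdef, rayAngle]
    · have hα : ω k * Complex.exp (φ * Complex.I) = ‖ω k‖ * Complex.I := by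
        rw [hφdef]
        simpa [rayAngle] using mul_exp_poleAngle θ (ω k)
      rw [integral_line_sub_integral_line hω0 hα
        hy0 hy1 hφ₁.2 hφ₂.1 (by linarith [hφ₁.1]) (by linarith [hφ₂.2])
        (fun w hw => hd w (hsub hw)) (b := s.re - n) (by linarith) hc (hSB.mono hsub)]
      simp [rayResidue, hφdef, rayAngle]

/-! ### The Mellin integral of the Barnes series. -/

theorem hasSum_prod_mul_of_summable_norm {𝕜 ι κ : Type*} [NormedField 𝕜] [CompleteSpace 𝕜]
    {f : ι → 𝕜} {g : κ → 𝕜} {a b : 𝕜} (hf : HasSum f a) (hg : HasSum g b)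
    (hf' : Summable fun i => ‖f i‖) (hg' : Summable fun i => ‖g i‖) :
    HasSum (fun x : ι × κ => f x.1 * g x.2) (a * b) ∧
      Summable fun x : ι × κ => ‖f x.1 * g x.2‖ :=
  ⟨hf.mul hg (Summable.mul_norm hf' hg').of_norm, Summable.mul_norm hf' hg'⟩

theorem hasSum_pi_prod {𝕜 : Type*} [NormedField 𝕜] [CompleteSpace 𝕜] {n : ℕ}
    {f : Fin n → ℕ → 𝕜} {a : Fin n → 𝕜} (h : ∀ j, HasSum (f j) (a j))
    (hs : ∀ j, Summable fun l => ‖f j l‖) :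
    HasSum (fun m : Fin n → ℕ => ∏ j, f j (m j)) (∏ j, a j) ∧
      Summable fun m : Fin n → ℕ => ‖∏ j, f j (m j)‖ := by
  induction n with
  | zero => exact ⟨by simp, (hasSum_fintype (fun _ : Fin 0 → ℕ => ‖(1 : 𝕜)‖)).summable.congr (by simp)⟩
  | succ n ih =>
    obtain ⟨h2, hs2⟩ := ih (fun j => h j.succ) fun j => hs j.succ
    obtain ⟨h3, hs3⟩ := hasSum_prod_mul_of_summable_norm (h 0) h2 (hs 0) hs2
    rw [Fin.prod_univ_succ, ← (Fin.consEquiv fun _ : Fin (n + 1) => ℕ).hasSum_iff,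
      ← (Fin.consEquiv fun _ : Fin (n + 1) => ℕ).summable_iff]
    have h4 : (fun m : Fin (n + 1) → ℕ => ∏ j, f j (m j)) ∘ (Fin.consEquiv fun _ => ℕ) =
        fun x : ℕ × (Fin n → ℕ) => f 0 x.1 * ∏ j, f j.succ (x.2 j) := by
      funext x
      simp [Fin.prod_univ_succ, Fin.consEquiv]
    refine ⟨h4 ▸ h3, ?_⟩
    have h5 : (fun m : Fin (n + 1) → ℕ => ‖∏ j, f j (m j)‖) ∘ (Fin.consEquiv fun _ => ℕ) =
        fun x : ℕ × (Fin n → ℕ) => ‖f 0 x.1 * ∏ j, f j.succ (x.2 j)‖ := by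
      funext x
      exact congrArg norm (congrFun h4 x)
    exact h5 ▸ hs3

theorem integral_exp_sub_exp_eq_Gamma {s : ℂ} (hs : 0 < s.re) :
    ∫ u : ℝ, Complex.exp (s * u) * Complex.exp (-Complex.exp u) = Complex.Gamma s := by
  rw [Complex.Gamma_eq_integral hs, Complex.GammaIntegral, integral_Ioi_eq_integral_exp 1 one_pos]
  refine integral_congr_ae (Eventually.of_forall fun u => ?_)
  have h : ((Real.exp u : ℝ) : ℂ) ≠ 0 := by exact_mod_cast (Real.exp_pos u).ne'
  simp only [one_mul]
  rw [Complex.cpow_def_of_ne_zero h, ← Complex.ofReal_log (Real.exp_pos u).le, Real.log_exp,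
    mul_sub, mul_one, Complex.exp_sub, Complex.ofReal_exp, Complex.ofReal_exp, Complex.ofReal_neg,
    Complex.ofReal_exp, mul_comm (s : ℂ)]
  have := Complex.exp_ne_zero (u : ℂ)
  field_simp

/-- Euler's integral along a rotated ray: the integrand decays like e^{-cos(ψ) e^u} throughout the
sector, so the line can be shifted as long as |ψ| < π/2. -/
theorem integral_line_exp_sub_exp_eq_Gamma {s : ℂ} (hs : 0 < s.re) {ψ : ℝ} (hψ : |ψ| < π / 2) :
    ∫ u : ℝ, Complex.exp (s * (u + ψ * Complex.I)) *
      Complex.exp (-Complex.exp (u + ψ * Complex.I)) = Complex.Gamma s := by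
  have hcos : 0 < Real.cos ψ := Real.cos_pos_of_mem_Ioo (by
    rw [abs_lt] at hψ
    exact hψ)
  have key : ∀ S : Set ℝ, (∀ φ ∈ S, |φ| ≤ |ψ|) →
      StripBound (fun w => Complex.exp (s * w) * Complex.exp (-Complex.exp w)) (s.re + 0)
        (0 + Real.cos ψ) S := by
    intro S hS
    refine (stripBound_exp_mul s hS).mul ⟨1, zero_le_one, fun w hw => ?_⟩
    rw [Complex.norm_exp, one_mul, Real.exp_le_exp, Complex.neg_re, Complex.exp_re]
    have h1 : Real.cos ψ ≤ Real.cos w.im := by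
      rw [← Real.cos_abs ψ, ← Real.cos_abs w.im]
      exact Real.cos_le_cos_of_nonneg_of_le_pi (abs_nonneg _) (by linarith [Real.pi_pos]) (hS _ hw)
    have := mul_le_mul_of_nonneg_left h1 (Real.exp_pos w.re).le
    linarith
  have hd : ∀ w : ℂ, DifferentiableAt ℂ
      (fun w => Complex.exp (s * w) * Complex.exp (-Complex.exp w)) w := fun w => by fun_prop
  rw [← integral_exp_sub_exp_eq_Gamma hs]
  rcases le_total 0 ψ with h | h
  · have := integral_line_eq h (fun w _ => hd w) (by linarith) (by linarith)
      (key (Set.Icc 0 ψ) fun φ hφ => by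
        rw [abs_of_nonneg hφ.1, abs_of_nonneg h]
        exact hφ.2)
    simpa using this.symm
  · have := integral_line_eq h (fun w _ => hd w) (by linarith) (by linarith)
      (key (Set.Icc ψ 0) fun φ hφ => by
        rw [abs_of_nonpos hφ.2, abs_of_nonpos h]
        linarith [hφ.1])
    simpa using this

/-- The substitution t → t/z in Euler's integral. In the logarithmic coordinate its modulus is a
translation of u and its argument a change of line; the angle -θ of the ray selects the branch of
z^{-s}. -/
theorem integral_line_eq_Gamma_mul_branchPow {s z : ℂ} {θ : ℝ} (hs : 0 < s.re)
    (hz : z ∈ halfPlane θ) :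
    ∫ u : ℝ, Complex.exp (s * (u + (-θ : ℝ) * Complex.I)) *
      Complex.exp (-(z * Complex.exp (u + (-θ : ℝ) * Complex.I))) =
      Complex.Gamma s * branchPow θ z (-s) := by
  set z' := z * Complex.exp (-(θ * Complex.I)) with hz'
  have hre : 0 < z'.re := hz
  have hz0 : z' ≠ 0 := by
    intro h
    simp [h] at hre
  have harg := Complex.abs_arg_lt_pi_div_two_iff.2 (Or.inl hre)
  rw [← integral_line_exp_sub_exp_eq_Gamma hs harg, ← integral_mul_const]
  rw [← integral_add_right_eq_self (fun u : ℝ => Complex.exp (s * (u + z'.arg * Complex.I)) *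
    Complex.exp (-Complex.exp (u + z'.arg * Complex.I)) * branchPow θ z (-s)) (Real.log ‖z'‖)]
  refine integral_congr_ae (Eventually.of_forall fun u => ?_)
  have hlog : Complex.log z' = Real.log ‖z'‖ + z'.arg * Complex.I := rfl
  have h1 : branchPow θ z (-s) =
      Complex.exp (-s * (Real.log ‖z'‖ + z'.arg * Complex.I + θ * Complex.I)) := by
    rw [branchPow, ← hz', hlog]
  have h2 : z * Complex.exp (u + (-θ : ℝ) * Complex.I) =
      Complex.exp ((u + Real.log ‖z'‖ : ℝ) + z'.arg * Complex.I) := by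
    have h3 : Complex.exp (Real.log ‖z'‖ + z'.arg * Complex.I) =
        z * Complex.exp (-(θ * Complex.I)) := by
      rw [← hlog, Complex.exp_log hz0]
    rw [Complex.ofReal_add, add_assoc, Complex.exp_add, Complex.exp_add, h3]
    push_cast
    ring_nf
  simp only
  have h4 : Complex.exp (s * (u + (-θ : ℝ) * Complex.I)) =
      Complex.exp (s * ((u + Real.log ‖z'‖ : ℝ) + z'.arg * Complex.I)) * branchPow θ z (-s) := by
    rw [h1, ← Complex.exp_add]
    congr 1
    push_cast
    ring
  rw [h2, h4, mul_right_comm]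

/-- This identity is the reason for the form of a(y): the exponents in the product of the geometric
expansions are the bases of the Barnes series with the sign changed. -/
theorem param_add_eq {n : ℕ} (ω : Fin n → ℂ) (y : ℝ) (m : Fin n → ℕ) :
    barnesParam ω y + ∑ j, ω j * (m j : ℂ) = -∑ j, ω j * (y - (m j + 1)) := by
  rw [barnesParam, ← Finset.sum_add_distrib, ← Finset.sum_neg_distrib]
  exact Finset.sum_congr rfl fun j _ => by ring

theorem smul_mem_halfPlane_sum {n : ℕ} (hn : 0 < n) {θ : ℝ} {ω : Fin n → ℂ}
    (hω : ∀ j, ω j ∈ halfPlane θ) {x : Fin n → ℝ} (hx : ∀ j, 0 < x j) :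
    ∑ j, ω j * (x j : ℂ) ∈ halfPlane θ := by
  have : Nonempty (Fin n) := ⟨⟨0, hn⟩⟩
  simp only [halfPlane, Set.mem_ofPred_eq, Finset.sum_mul, Complex.re_sum]
  refine Finset.sum_pos (fun j _ => ?_) Finset.univ_nonempty
  rw [mul_right_comm, Complex.re_mul_ofReal]
  exact mul_pos (hω j) (hx j)

theorem param_add_mem {n : ℕ} (hn : 0 < n) {θ : ℝ} {ω : Fin n → ℂ}
    (hω : ∀ j, ω j ∈ halfPlane θ) {y : ℝ} (hy : y < 1) (m : Fin n → ℕ) :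
    barnesParam ω y + ∑ j, ω j * (m j : ℂ) ∈ halfPlane θ := by
  have := smul_mem_halfPlane_sum hn hω (x := fun j => m j + 1 - y) (fun j => by
    have : (0 : ℝ) ≤ m j := Nat.cast_nonneg _
    linarith)
  convert this using 1
  rw [param_add_eq, ← Finset.sum_neg_distrib]
  refine Finset.sum_congr rfl fun j _ => ?_
  push_cast
  ring

/-- The Mellin-type integral representation of the Barnes series. -/
theorem hasSum_Gamma_mul_barnesSeriesTerm {n : ℕ} (hn : 0 < n) {θ : ℝ} {ω : Fin n → ℂ}
    (hω : ∀ j, ω j ∈ halfPlane θ) {y : ℝ} (hy0 : 0 < y) (hy1 : y < 1) {s : ℂ}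
    (hs : (n : ℝ) < s.re) :
    HasSum (fun m => Complex.Gamma s * barnesSeriesTerm θ ω (barnesParam ω y) s m)
      (∫ u : ℝ, kernelProd ω y s Finset.univ (u + (-θ : ℝ) * Complex.I)) := by
  have hn0 : (0 : ℝ) < n := by exact_mod_cast hn
  have hs0 : 0 < s.re := by linarith
  have hmin : 0 < min y (1 - y) := lt_min hy0 (by linarith)
  -- On the ray of angle -θ all ω_j t have positive real part κ_j e^u, so all kernels can be
  -- expanded at once; the absolute values are the expansion for the real periods κ_j.
  set κ : Fin n → ℝ := fun j => (ω j * Complex.exp ((-θ : ℝ) * Complex.I)).re with hκdef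
  have hκ : ∀ j, 0 < κ j := by
    intro j
    have := hω j
    simp only [halfPlane, Set.mem_ofPred_eq] at this
    simpa [hκdef] using this
  have hre : ∀ (j : Fin n) (u : ℝ), (ω j * Complex.exp (u + (-θ : ℝ) * Complex.I)).re =
      κ j * Real.exp u := by
    intro j u
    rw [re_mul_exp]
    simp [hκdef, mul_comm]
  have hterm : ∀ m : Fin n → ℕ, Complex.Gamma s * barnesSeriesTerm θ ω (barnesParam ω y) s m =
      ∫ u : ℝ, Complex.exp (s * (u + (-θ : ℝ) * Complex.I)) *
        ∏ j, Complex.exp (ω j * (y - (m j + 1)) * Complex.exp (u + (-θ : ℝ) * Complex.I)) := by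
    intro m
    rw [barnesSeriesTerm, ← integral_line_eq_Gamma_mul_branchPow hs0 (param_add_mem hn hω hy1 m)]
    refine integral_congr_ae (Eventually.of_forall fun u => ?_)
    simp only
    rw [← Complex.exp_sum, param_add_eq, neg_mul, neg_neg, Finset.sum_mul]
  simp only [hterm]
  have hnorm : ∀ (u : ℝ) (m : Fin n → ℕ),
      ‖∏ j, Complex.exp (ω j * (y - (m j + 1)) * Complex.exp (u + (-θ : ℝ) * Complex.I))‖ =
        ∏ j, Real.exp (κ j * (y - (m j + 1)) * Real.exp u) := by
    intro u m
    rw [norm_prod]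
    refine Finset.prod_congr rfl fun j _ => ?_
    rw [Complex.norm_exp]
    have : ω j * (y - (m j + 1)) * Complex.exp (u + (-θ : ℝ) * Complex.I) =
      ((y - (m j + 1) : ℝ) : ℂ) * (ω j * Complex.exp (u + (-θ : ℝ) * Complex.I)) := by
      push_cast
      ring
    rw [this, Complex.re_ofReal_mul, hre]
    ring_nf
  have hreal : ∀ u : ℝ, HasSum
      (fun m : Fin n → ℕ => ∏ j, Real.exp (κ j * (y - (m j + 1)) * Real.exp u))
      (∏ j, (bernoulliKernel (κ j) y (Complex.exp u)).re) := by
    intro u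
    have h0 : ∀ j, HasSum (fun l : ℕ => Real.exp (κ j * (y - (l + 1)) * Real.exp u))
        (bernoulliKernel (κ j) y (Complex.exp u)).re := fun j => ?_
    · exact (hasSum_pi_prod (f := fun j l => Real.exp (κ j * (y - (l + 1)) * Real.exp u)) h0
        fun j => (h0 j).summable.norm).1
    have h1 := Complex.hasSum_re (hasSum_bernoulliKernel (ω := κ j) (t := Complex.exp u) y (by
      rw [← Complex.ofReal_exp, ← Complex.ofReal_mul, Complex.ofReal_re]
      exact mul_pos (hκ j) (Real.exp_pos _)))
    convert! h1 using 2 with l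
    rw [← Complex.exp_ofReal_re]
    push_cast
    rfl
  have hκbd : ∀ φ ∈ ({0} : Set ℝ), ∀ j ∈ (Finset.univ : Finset (Fin n)),
      0 < |((κ j : ℂ) * Complex.exp (φ * Complex.I)).re| := by
    intro φ hφ j _
    rw [Set.mem_singleton_iff.1 hφ]
    simpa using (hκ j).ne'
  obtain ⟨κ₀, hκ₀, hκ₀'⟩ : ∃ κ₀ > 0, ∀ j, κ₀ ≤ κ j := by
    have : Nonempty (Fin n) := ⟨⟨0, hn⟩⟩
    obtain ⟨i, hi⟩ := Finite.exists_min κ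
    exact ⟨κ i, hκ i, hi⟩
  obtain ⟨C, hC, hbd⟩ := stripBound_kernelProd (ω := fun j => (κ j : ℂ)) (S := {0}) (M := 0)
    (T := Finset.univ) s.re hy0 hy1 hκ₀ (fun φ hφ j _ => by
      rw [Set.mem_singleton_iff.1 hφ]
      simpa using (hκ₀' j).trans (le_abs_self _)) (fun φ hφ => by
      rw [Set.mem_singleton_iff.1 hφ, abs_zero])
  rw [Finset.card_univ, Fintype.card_fin, Complex.ofReal_re] at hbd
  have hexp : ∀ u : ℝ, ‖Complex.exp (s * (u + (-θ : ℝ) * Complex.I))‖ =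
      Real.exp (s.im * θ) * Real.exp (s.re * u) := by
    intro u
    rw [Complex.norm_exp, ← Real.exp_add]
    simp [Complex.mul_re]
    ring
  refine hasSum_integral_of_dominated_convergence
    (fun m u => ‖Complex.exp (s * (u + (-θ : ℝ) * Complex.I))‖ *
      ∏ j, Real.exp (κ j * (y - (m j + 1)) * Real.exp u))
    (fun m => ?_) (fun m => ?_) ?_ ?_ ?_
  · exact Continuous.aestronglyMeasurable (by fun_prop)
  · refine Eventually.of_forall fun u => ?_
    rw [norm_mul, hnorm]
  · exact Eventually.of_forall fun u => ((hreal u).summable).mul_left _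
  · have : ∀ u : ℝ, ∑' m : Fin n → ℕ, ‖Complex.exp (s * (u + (-θ : ℝ) * Complex.I))‖ *
        ∏ j, Real.exp (κ j * (y - (m j + 1)) * Real.exp u)
        = ‖Complex.exp (s * (u + (-θ : ℝ) * Complex.I))‖ *
          ∏ j, (bernoulliKernel (κ j) y (Complex.exp u)).re := fun u =>
      ((hreal u).mul_left _).tsum_eq
    simp only [this]
    refine ((integrable_exp_sub_exp (b := s.re - n) (c := n * (min y (1 - y) * κ₀ / 2))
      (by linarith) (by positivity)).const_mul (Real.exp (s.im * θ) * C)).mono' ?_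
      (Eventually.of_forall fun u => ?_)
    · refine Continuous.aestronglyMeasurable (Continuous.mul (by fun_prop) ?_)
      refine continuous_finsetProd _ fun j _ => Complex.continuous_re.comp ?_
      refine continuous_iff_continuousAt.2 fun u => ?_
      exact ContinuousAt.comp (f := fun u : ℝ => (u : ℂ))
        (differentiableAt_bernoulliKernel_exp (ω := κ j) (w := u) y
          (by simpa using (hκ j).ne')).continuousAt (by fun_prop)
    · have h1 := hbd u (by simp)
      rw [norm_mul, norm_norm, hexp, norm_prod, mul_assoc, mul_assoc]
      refine mul_le_mul_of_nonneg_left ?_ (Real.exp_pos _).le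
      simp only [Complex.ofReal_re] at h1
      refine le_trans ?_ h1
      rw [kernelProd, norm_mul, norm_prod, Complex.norm_exp, mul_comm]
      have h2 : ((s.re : ℂ) * (u : ℂ)).re = s.re * u := by simp
      rw [h2]
      refine mul_le_mul_of_nonneg_right ?_ (Real.exp_pos _).le
      exact Finset.prod_le_prod (fun _ _ => norm_nonneg _) fun j _ => Complex.abs_re_le_norm _
  · refine Eventually.of_forall fun u => ?_
    have h0 : ∀ j, HasSum (fun l : ℕ =>
        Complex.exp (ω j * (y - (l + 1)) * Complex.exp (u + (-θ : ℝ) * Complex.I)))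
        (bernoulliKernel (ω j) y (Complex.exp (u + (-θ : ℝ) * Complex.I))) := fun j =>
      hasSum_bernoulliKernel y (by
        rw [hre]
        exact mul_pos (hκ j) (Real.exp_pos _))
    have h := (hasSum_pi_prod (f := fun j l =>
      Complex.exp (ω j * (y - (l + 1)) * Complex.exp (u + (-θ : ℝ) * Complex.I))) h0
      fun j => (h0 j).summable.norm).1
    rw [kernelProd, mul_comm (∏ j, _)]
    exact h.mul_left _

/-! ### Convergence of the series in the functional equation. -/

theorem norm_branchPow_le {φ : ℝ} {z : ℂ} (hz : z ≠ 0) (s : ℂ) :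
    ‖branchPow φ z s‖ ≤ ‖z‖ ^ s.re * Real.exp ((|φ| + π) * |s.im|) := by
  have hn : 0 < ‖z‖ := norm_pos_iff.2 hz
  set z' := z * Complex.exp (-(φ * Complex.I)) with hz'
  have hnz : ‖z'‖ = ‖z‖ := by
    rw [hz', norm_mul, show (-(φ * Complex.I) : ℂ) = ((-φ : ℝ) : ℂ) * Complex.I by push_cast; ring,
      Complex.norm_exp_ofReal_mul_I, mul_one]
  have hlog : Complex.log z' = Real.log ‖z‖ + z'.arg * Complex.I := by
    rw [← hnz]
    rfl
  rw [branchPow, ← hz', Complex.norm_exp, hlog, Real.rpow_def_of_pos hn, ← Real.exp_add,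
    Real.exp_le_exp]
  have h1 : (s * (Real.log ‖z‖ + z'.arg * Complex.I + φ * Complex.I)).re =
      Real.log ‖z‖ * s.re - (φ + z'.arg) * s.im := by
    simp [Complex.mul_re]
    ring
  rw [h1]
  have h2 : |(φ + z'.arg) * s.im| ≤ (|φ| + π) * |s.im| := by
    rw [abs_mul]
    gcongr
    exact (abs_add_le _ _).trans (by linarith [Complex.abs_arg_le_pi z'])
  linarith [neg_abs_le ((φ + z'.arg) * s.im)]

/-- At a pole t = 2πim/ω_k one has |Re(ω_j t)| = 2π |m| |Im(ω_j/ω_k)|, so x₀ is a common rate of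
growth for all pairs. -/
theorem exists_abs_im_ratio_bound {n : ℕ} {ω : Fin n → ℂ}
    (hratio : ∀ j k, j ≠ k → (ω j / ω k).im ≠ 0) :
    ∃ x₀ > 0, ∀ j k, j ≠ k → x₀ ≤ 2 * π * |(ω j / ω k).im| := by
  have : ∀ᶠ x : ℝ in 𝓝[>] 0, ∀ j k, j ≠ k → x < 2 * π * |(ω j / ω k).im| := by
    refine Filter.Eventually.filter_mono nhdsWithin_le_nhds ?_
    refine Filter.eventually_all.2 fun j => Filter.eventually_all.2 fun k => ?_
    by_cases h : j = k
    · simp [h]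
    · have : 0 < 2 * π * |(ω j / ω k).im| := by
        have := abs_pos.2 (hratio j k h)
        have := Real.pi_pos
        positivity
      filter_upwards [gt_mem_nhds this] with x hx _ using hx
  obtain ⟨x, h1, h2⟩ := (this.and self_mem_nhdsWithin).exists
  exact ⟨x, h2, fun j k h => (h1 j k h).le⟩

theorem funcEqTerm_eq {n : ℕ} (θ : ℝ) (ω : Fin n → ℂ) (y : ℝ)
    (p : Fin n × {m : ℤ // m ≠ 0}) (s : ℂ) :
    funcEqTerm θ ω y p s = (ω p.1)⁻¹ *
      (∏ j ∈ Finset.univ.erase p.1,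
        bernoulliKernel (ω j) y (2 * (p.2.1 : ℂ) * π * Complex.I * (ω p.1)⁻¹)) *
      polePow θ ω p.1 p.2.1 s * Complex.exp (2 * (p.2.1 : ℂ) * π * Complex.I * y) := by
  unfold funcEqTerm bernoulliKernel
  congr 3
  refine Finset.prod_congr rfl fun j _ => ?_
  rw [show ω j * (2 * (p.2.1 : ℂ) * π * Complex.I * (ω p.1)⁻¹) =
    2 * (p.2.1 : ℂ) * π * Complex.I * (ω j / ω p.1) by ring]

/-- The constants do not depend on y, so one bound serves both regimes: for 0 < y < 1 the
exponential in |m| wins for every s, while for y near 0 only the power |m|^{Re s - 1} can be used,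
which needs Re s < 0. -/
theorem norm_funcEqTerm_le {n : ℕ} (hn : 2 ≤ n) (θ : ℝ) {ω : Fin n → ℂ} (h0 : ∀ j, ω j ≠ 0)
    (hratio : ∀ j k, j ≠ k → (ω j / ω k).im ≠ 0) :
    ∃ K > 0, ∃ B > 0, ∃ x₀ > 0, ∀ y : ℝ, 0 ≤ y → y ≤ 1 →
      ∀ (p : Fin n × {m : ℤ // m ≠ 0}) (s : ℂ), ‖funcEqTerm θ ω y p s‖ ≤
        K * Real.exp (B * ‖s‖) * Real.exp (-(min y (1 - y) * x₀ * |(p.2.1 : ℝ)|)) *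
          |(p.2.1 : ℝ)| ^ (s.re - 1) := by
  obtain ⟨x₀, hx₀, hx⟩ := exists_abs_im_ratio_bound hratio
  have hpi := Real.pi_pos
  set N : ℝ := ∑ k, ‖(ω k)⁻¹‖ with hN
  set L : ℝ := ∑ k, |Real.log (2 * π * ‖(ω k)⁻¹‖)| with hL
  have hNk : ∀ k, ‖(ω k)⁻¹‖ ≤ N := fun k =>
    Finset.single_le_sum (f := fun k => ‖(ω k)⁻¹‖) (fun _ _ => norm_nonneg _) (Finset.mem_univ k)
  have hLk : ∀ k, |Real.log (2 * π * ‖(ω k)⁻¹‖)| ≤ L := fun k =>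
    Finset.single_le_sum (f := fun k => |Real.log (2 * π * ‖(ω k)⁻¹‖)|)
      (fun _ _ => abs_nonneg _) (Finset.mem_univ k)
  have hL0 : 0 ≤ L := Finset.sum_nonneg fun _ _ => abs_nonneg _
  have hN0 : 0 < N := by
    have : 0 < ‖(ω ⟨0, by omega⟩)⁻¹‖ := norm_pos_iff.2 (inv_ne_zero (h0 _))
    exact this.trans_le (hNk _)
  set A : ℝ := 1 / (1 - Real.exp (-x₀)) with hA
  have hden : 0 < 1 - Real.exp (-x₀) := by
    have : Real.exp (-x₀) < 1 := Real.exp_lt_one_iff.2 (by linarith)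
    linarith
  have hA0 : 0 < A := by positivity
  refine ⟨N * A ^ (n - 1) * Real.exp L, by positivity, L + (|π - θ| + π), by positivity,
    x₀, hx₀, fun y hy0 hy1 p s => ?_⟩
  obtain ⟨k, m, hm⟩ := p
  have hm1 : (1 : ℝ) ≤ |(m : ℝ)| := by exact_mod_cast Int.one_le_abs hm
  have hm0 : 0 < |(m : ℝ)| := by linarith
  have hmin : 0 ≤ min y (1 - y) := le_min hy0 (by linarith)
  rw [funcEqTerm_eq, norm_mul, norm_mul, norm_mul]
  simp only
  have e1 : ‖Complex.exp (2 * (m : ℂ) * π * Complex.I * y)‖ = 1 := by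
    rw [show (2 * (m : ℂ) * π * Complex.I * y : ℂ) = ((2 * m * π * y : ℝ) : ℂ) * Complex.I by
      push_cast; ring]
    exact Complex.norm_exp_ofReal_mul_I _
  have e2 : ‖∏ j ∈ Finset.univ.erase k,
      bernoulliKernel (ω j) y (2 * (m : ℂ) * π * Complex.I * (ω k)⁻¹)‖ ≤
      A ^ (n - 1) * Real.exp (-(min y (1 - y) * x₀ * |(m : ℝ)|)) := by
    have hfac : ∀ j ∈ Finset.univ.erase k,
        ‖bernoulliKernel (ω j) y (2 * (m : ℂ) * π * Complex.I * (ω k)⁻¹)‖ ≤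
          Real.exp (-(min y (1 - y) * x₀ * |(m : ℝ)|)) * A := by
      intro j hj
      have hre : |(ω j * (2 * (m : ℂ) * π * Complex.I * (ω k)⁻¹)).re| =
          2 * π * |(ω j / ω k).im| * |(m : ℝ)| := by
        have : ω j * (2 * (m : ℂ) * π * Complex.I * (ω k)⁻¹) =
            ((2 * π * m : ℝ) : ℂ) * (Complex.I * (ω j / ω k)) := by
          push_cast
          ring
        rw [this, Complex.re_ofReal_mul, Complex.I_mul_re, abs_mul, abs_mul, abs_neg,
          abs_of_pos (by positivity : 0 < 2 * π)]
        ring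
      have h1 := hx j k (Finset.ne_of_mem_erase hj)
      have h2 : x₀ * |(m : ℝ)| ≤ |(ω j * (2 * (m : ℂ) * π * Complex.I * (ω k)⁻¹)).re| := by
        rw [hre]
        gcongr
      have h3 : x₀ ≤ |(ω j * (2 * (m : ℂ) * π * Complex.I * (ω k)⁻¹)).re| :=
        le_trans (by nlinarith) h2
      refine (norm_bernoulliKernel_le hy0 hy1 (abs_pos.1 (hx₀.trans_le h3))).trans ?_
      rw [div_eq_mul_one_div, hA]
      have h4 : min y (1 - y) * x₀ * |(m : ℝ)| ≤
          min y (1 - y) * |(ω j * (2 * (m : ℂ) * π * Complex.I * (ω k)⁻¹)).re| := by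
        rw [mul_assoc]
        gcongr
      refine mul_le_mul (Real.exp_le_exp.2 (neg_le_neg h4)) ?_ ?_ (Real.exp_pos _).le
      · gcongr
      · rw [one_div, inv_nonneg, sub_nonneg, Real.exp_le_one_iff]
        exact neg_nonpos.2 (abs_nonneg _)
    rw [norm_prod]
    refine (Finset.prod_le_prod (fun _ _ => norm_nonneg _) hfac).trans ?_
    rw [Finset.prod_const, Finset.card_erase_of_mem (Finset.mem_univ _), Finset.card_univ,
      Fintype.card_fin, mul_pow, mul_comm]
    refine mul_le_mul_of_nonneg_left ?_ (by positivity)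
    -- Only one of the n - 1 ≥ 1 exponential factors is kept.
    refine pow_le_of_le_one (Real.exp_pos _).le ?_ (by omega)
    rw [Real.exp_le_one_iff]
    have : 0 ≤ min y (1 - y) * x₀ * |(m : ℝ)| := by positivity
    linarith
  have e3 : ‖polePow θ ω k m s‖ ≤
      Real.exp L * Real.exp ((L + (|π - θ| + π)) * ‖s‖) * |(m : ℝ)| ^ (s.re - 1) := by
    have hz : (2 * (m : ℂ) * π * Complex.I * (ω k)⁻¹) ≠ 0 := by
      have : (π : ℂ) ≠ 0 := by exact_mod_cast hpi.ne'
      have : (m : ℂ) ≠ 0 := by exact_mod_cast hm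
      have := inv_ne_zero (h0 k)
      simp [*]
    have hzn : ‖(2 * (m : ℂ) * π * Complex.I * (ω k)⁻¹)‖ = 2 * π * ‖(ω k)⁻¹‖ * |(m : ℝ)| := by
      rw [norm_mul, norm_mul, norm_mul, norm_mul, Complex.norm_I, Complex.norm_real,
        Real.norm_eq_abs, abs_of_pos hpi, Complex.norm_intCast]
      simp only [Complex.norm_ofNat]
      ring
    have hlam : 0 < 2 * π * ‖(ω k)⁻¹‖ := by
      have := norm_pos_iff.2 (inv_ne_zero (h0 k))
      positivity
    refine (norm_branchPow_le hz _).trans ?_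
    rw [hzn, Real.mul_rpow hlam.le hm0.le, Real.rpow_def_of_pos hlam]
    simp only [Complex.sub_re, Complex.one_re, Complex.sub_im, Complex.one_im, sub_zero]
    rw [mul_right_comm, ← Real.exp_add, ← Real.exp_add]
    refine mul_le_mul_of_nonneg_right ?_ (by positivity)
    rw [Real.exp_le_exp]
    have h5 : Real.log (2 * π * ‖(ω k)⁻¹‖) * (s.re - 1) ≤ L * (‖s‖ + 1) := by
      refine (le_abs_self _).trans ?_
      rw [abs_mul]
      refine mul_le_mul (hLk k) ?_ (abs_nonneg _) hL0
      refine (abs_sub _ _).trans ?_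
      rw [abs_one]
      linarith [Complex.abs_re_le_norm s]
    have h6 : (|π - θ| + π) * |s.im| ≤ (|π - θ| + π) * ‖s‖ := by
      gcongr
      exact Complex.abs_im_le_norm s
    linarith
  rw [e1, mul_one]
  calc _ ≤ N * (A ^ (n - 1) * Real.exp (-(min y (1 - y) * x₀ * |(m : ℝ)|))) *
        (Real.exp L * Real.exp ((L + (|π - θ| + π)) * ‖s‖) * |(m : ℝ)| ^ (s.re - 1)) := by
        gcongr
        exact hNk k
    _ = _ := by ring

theorem summable_abs_rpow_index {n : ℕ} {b : ℝ} (hb : 1 < b) (C : ℝ) :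
    Summable fun p : Fin n × {m : ℤ // m ≠ 0} => C * |(p.2.1 : ℝ)| ^ (-b) := by
  have h1 : Summable fun m : {m : ℤ // m ≠ 0} => |(m.1 : ℝ)| ^ (-b) :=
    (Real.summable_abs_int_rpow hb).comp_injective Subtype.val_injective
  have h2 : Summable fun _ : Fin n => C := (hasSum_fintype _).summable
  exact summable_mul_of_summable_norm (f := fun _ : Fin n => C)
    (g := fun m : {m : ℤ // m ≠ 0} => |(m.1 : ℝ)| ^ (-b)) h2.norm h1.norm

theorem norm_funcEqTerm_le_of_pos {n : ℕ} (hn : 2 ≤ n) (θ : ℝ) {ω : Fin n → ℂ}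
    (h0 : ∀ j, ω j ≠ 0) (hratio : ∀ j k, j ≠ k → (ω j / ω k).im ≠ 0) {y : ℝ} (hy0 : 0 < y)
    (hy1 : y < 1) (R : ℝ) :
    ∃ C, ∀ (p : Fin n × {m : ℤ // m ≠ 0}) (s : ℂ), ‖s‖ ≤ R →
      ‖funcEqTerm θ ω y p s‖ ≤ C * |(p.2.1 : ℝ)| ^ (-2 : ℝ) := by
  obtain ⟨K, hK, B, hB, x₀, hx₀, h⟩ := norm_funcEqTerm_le hn θ h0 hratio
  set d := min y (1 - y) * x₀ with hd
  have hdpos : 0 < d := mul_pos (lt_min hy0 (by linarith)) hx₀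
  -- The exponential beats any power of |m|; the estimate is `exp_sub_exp_le` at u = log t. The
  -- power |R| + 1 leaves room for the summable |m|^{-2}.
  obtain ⟨M, hM⟩ : ∃ M : ℝ, ∀ t : ℝ, 1 ≤ t → Real.exp (-(d * t)) * t ^ (|R| + 1) ≤ M := by
    refine ⟨Real.exp (2 * (|R| + 1) ^ 2 / d), fun t ht => ?_⟩
    have ht0 : 0 < t := by linarith
    have h1 := exp_sub_exp_le hdpos (by positivity : 0 < |R| + 1) (Real.log t)
    rw [Real.exp_log ht0] at h1
    rw [Real.rpow_def_of_pos ht0, ← Real.exp_add]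
    refine le_trans (le_of_eq ?_) (h1.trans (mul_le_of_le_one_right (Real.exp_pos _).le ?_))
    · ring_nf
    · rw [Real.exp_le_one_iff]
      have : 0 ≤ (|R| + 1) * |Real.log t| := by positivity
      linarith
  refine ⟨K * Real.exp (B * |R|) * M, fun p s hs => ?_⟩
  have hm1 : (1 : ℝ) ≤ |(p.2.1 : ℝ)| := by exact_mod_cast Int.one_le_abs p.2.2
  have hm0 : 0 < |(p.2.1 : ℝ)| := by linarith
  have hsR : ‖s‖ ≤ |R| := hs.trans (le_abs_self R)
  have hre : s.re - 1 ≤ |R| + 1 + -2 := by linarith [Complex.re_le_norm s]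
  calc ‖funcEqTerm θ ω y p s‖ ≤ K * Real.exp (B * ‖s‖) * Real.exp (-(d * |(p.2.1 : ℝ)|)) *
          |(p.2.1 : ℝ)| ^ (s.re - 1) := h y hy0.le hy1.le p s
    _ ≤ K * Real.exp (B * |R|) * Real.exp (-(d * |(p.2.1 : ℝ)|)) *
          |(p.2.1 : ℝ)| ^ (|R| + 1 + -2) := by gcongr
    _ = K * Real.exp (B * |R|) * (Real.exp (-(d * |(p.2.1 : ℝ)|)) *
          |(p.2.1 : ℝ)| ^ (|R| + 1)) * |(p.2.1 : ℝ)| ^ (-2 : ℝ) := by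
        rw [Real.rpow_add hm0]
        ring
    _ ≤ _ := by
        gcongr
        exact hM _ hm1

/-- The exponential factor is simply dropped. Uniformity in y is what later allows the limit y → 0+
under the sum. -/
theorem norm_funcEqTerm_le_of_re_neg {n : ℕ} (hn : 2 ≤ n) (θ : ℝ) {ω : Fin n → ℂ}
    (h0 : ∀ j, ω j ≠ 0) (hratio : ∀ j k, j ≠ k → (ω j / ω k).im ≠ 0) (R : ℝ) (δ : ℝ) :
    ∃ C, ∀ (y : ℝ), 0 ≤ y → y ≤ 1 → ∀ (p : Fin n × {m : ℤ // m ≠ 0}) (s : ℂ), ‖s‖ ≤ R →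
      s.re ≤ -δ → ‖funcEqTerm θ ω y p s‖ ≤ C * |(p.2.1 : ℝ)| ^ (-(1 + δ)) := by
  obtain ⟨K, hK, B, hB, x₀, hx₀, h⟩ := norm_funcEqTerm_le hn θ h0 hratio
  refine ⟨K * Real.exp (B * R), fun y hy0 hy1 p s hs hre => (h y hy0 hy1 p s).trans ?_⟩
  have hm1 : (1 : ℝ) ≤ |(p.2.1 : ℝ)| := by exact_mod_cast Int.one_le_abs p.2.2
  have h1 : Real.exp (-(min y (1 - y) * x₀ * |(p.2.1 : ℝ)|)) ≤ 1 := by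
    rw [Real.exp_le_one_iff]
    have : 0 ≤ min y (1 - y) := le_min hy0 (by linarith)
    have : 0 ≤ min y (1 - y) * x₀ * |(p.2.1 : ℝ)| := by positivity
    linarith
  calc _ ≤ K * Real.exp (B * R) * 1 * |(p.2.1 : ℝ)| ^ (-(1 + δ)) := by
        gcongr
        linarith
    _ = _ := by rw [mul_one]

theorem convergesAbsUniformlyOn_of_bound {n : ℕ}
    {f : Fin n × {m : ℤ // m ≠ 0} → ℂ → ℂ} {U : Set ℂ}
    (h : ∀ K ⊆ U, IsCompact K → ∃ C b : ℝ, 1 < b ∧ ∀ p, ∀ s ∈ K,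
      ‖f p s‖ ≤ C * |(p.2.1 : ℝ)| ^ (-b)) : ConvergesAbsUniformlyOn f U := by
  intro K hKU hK
  obtain ⟨C, b, hb, hle⟩ := h K hKU hK
  exact (HasSumUniformlyOn.of_norm_le_summable (summable_abs_rpow_index hb C)
    fun p s hs => by simpa using hle p s hs).summableUniformlyOn

theorem convergesAbsUniformlyOn_funcEqTerm {n : ℕ} (hn : 2 ≤ n) (θ : ℝ) {ω : Fin n → ℂ}
    (h0 : ∀ j, ω j ≠ 0) (hratio : ∀ j k, j ≠ k → (ω j / ω k).im ≠ 0) {y : ℝ} (hy0 : 0 < y)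
    (hy1 : y < 1) : ConvergesAbsUniformlyOn (funcEqTerm θ ω y) Set.univ := by
  refine convergesAbsUniformlyOn_of_bound fun K _ hK => ?_
  obtain ⟨R, hR⟩ := hK.exists_bound_of_continuousOn continuousOn_id
  obtain ⟨C, hC⟩ := norm_funcEqTerm_le_of_pos hn θ h0 hratio hy0 hy1 R
  exact ⟨C, 2, one_lt_two, fun p s hs => hC p s (hR s hs)⟩

theorem convergesAbsUniformlyOn_funcEqTerm_zero {n : ℕ} (hn : 2 ≤ n) (θ : ℝ) {ω : Fin n → ℂ}
    (h0 : ∀ j, ω j ≠ 0) (hratio : ∀ j k, j ≠ k → (ω j / ω k).im ≠ 0) :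
    ConvergesAbsUniformlyOn (funcEqTerm θ ω 0) {s : ℂ | s.re < 0} := by
  refine convergesAbsUniformlyOn_of_bound fun K hKU hK => ?_
  rcases K.eq_empty_or_nonempty with rfl | hne
  · exact ⟨0, 2, one_lt_two, fun p s hs => absurd hs (Set.notMem_empty s)⟩
  obtain ⟨R, hR⟩ := hK.exists_bound_of_continuousOn continuousOn_id
  obtain ⟨s₀, hs₀, hmax⟩ := hK.exists_isMaxOn hne Complex.continuous_re.continuousOn
  have hneg : s₀.re < 0 := hKU hs₀
  obtain ⟨C, hC⟩ := norm_funcEqTerm_le_of_re_neg hn θ h0 hratio R (-s₀.re)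
  refine ⟨C, 1 + -s₀.re, by linarith, fun p s hs => hC 0 le_rfl zero_le_one p s (hR s hs) ?_⟩
  rw [neg_neg]
  exact hmax hs

theorem differentiable_funcEqTerm {n : ℕ} (θ : ℝ) (ω : Fin n → ℂ) (y : ℝ)
    (p : Fin n × {m : ℤ // m ≠ 0}) : Differentiable ℂ (funcEqTerm θ ω y p) := by
  unfold funcEqTerm polePow branchPow
  fun_prop

/-- The sum of the series in the functional equation. -/
noncomputable def funcEqSum {n : ℕ} (θ : ℝ) (ω : Fin n → ℂ) (y : ℝ) (s : ℂ) : ℂ :=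
  ∑ k : Fin n, ∑' m : {m : ℤ // m ≠ 0}, funcEqTerm θ ω y (k, m) s

theorem differentiable_funcEqSum {n : ℕ} (hn : 2 ≤ n) (θ : ℝ) {ω : Fin n → ℂ}
    (h0 : ∀ j, ω j ≠ 0) (hratio : ∀ j k, j ≠ k → (ω j / ω k).im ≠ 0) {y : ℝ} (hy0 : 0 < y)
    (hy1 : y < 1) : Differentiable ℂ (funcEqSum θ ω y) := by
  intro s₀
  unfold funcEqSum
  refine DifferentiableAt.fun_sum fun k _ => ?_
  obtain ⟨C, hC⟩ := norm_funcEqTerm_le_of_pos hn θ h0 hratio hy0 hy1 (‖s₀‖ + 1)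
  have hmem : Metric.ball s₀ 1 ∈ 𝓝 s₀ := Metric.ball_mem_nhds _ one_pos
  refine (Complex.differentiableOn_tsum_of_summable_norm
    (((summable_abs_rpow_index one_lt_two C).comp_injective
      (Prod.mk_right_injective k) : Summable fun m : {m : ℤ // m ≠ 0} => _))
    (fun m => (differentiable_funcEqTerm θ ω y (k, m)).differentiableOn) Metric.isOpen_ball
    fun m s hs => hC (k, m) s ?_).differentiableAt hmem
  rw [mem_ball_iff_norm] at hs
  have := norm_le_norm_add_norm_sub' s s₀
  linarith

theorem differentiableAt_funcEqSum_zero {n : ℕ} (hn : 2 ≤ n) (θ : ℝ) {ω : Fin n → ℂ}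
    (h0 : ∀ j, ω j ≠ 0) (hratio : ∀ j k, j ≠ k → (ω j / ω k).im ≠ 0) {s₀ : ℂ}
    (hs₀ : s₀.re < 0) : DifferentiableAt ℂ (funcEqSum θ ω 0) s₀ := by
  unfold funcEqSum
  refine DifferentiableAt.fun_sum fun k _ => ?_
  obtain ⟨C, hC⟩ := norm_funcEqTerm_le_of_re_neg hn θ h0 hratio (‖s₀‖ + 1) (-s₀.re / 2)
  have hmem : Metric.ball s₀ 1 ∩ {s : ℂ | s.re < s₀.re / 2} ∈ 𝓝 s₀ :=
    inter_mem (Metric.ball_mem_nhds _ one_pos)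
      ((isOpen_lt Complex.continuous_re continuous_const).mem_nhds (by
        show s₀.re < s₀.re / 2
        linarith))
  refine (Complex.differentiableOn_tsum_of_summable_norm
    (((summable_abs_rpow_index (by linarith : 1 < 1 + -s₀.re / 2) C).comp_injective
      (Prod.mk_right_injective k) : Summable fun m : {m : ℤ // m ≠ 0} => _))
    (fun m => (differentiable_funcEqTerm θ ω 0 (k, m)).differentiableOn)
    (Metric.isOpen_ball.inter (isOpen_lt Complex.continuous_re continuous_const))
    fun m s hs => hC 0 le_rfl zero_le_one (k, m) s ?_ ?_).differentiableAt hmem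
  · have h1 := hs.1
    rw [mem_ball_iff_norm] at h1
    have := norm_le_norm_add_norm_sub' s s₀
    linarith
  · have h1 : s.re < s₀.re / 2 := hs.2
    linarith

theorem tendsto_funcEqSum_zero {n : ℕ} (hn : 2 ≤ n) (θ : ℝ) {ω : Fin n → ℂ}
    (h0 : ∀ j, ω j ≠ 0) (hratio : ∀ j k, j ≠ k → (ω j / ω k).im ≠ 0) {s : ℂ}
    (hs : s.re < 0) : Tendsto (fun y => funcEqSum θ ω y s) (𝓝[>] 0) (𝓝 (funcEqSum θ ω 0 s)) := by
  unfold funcEqSum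
  refine tendsto_finsetSum _ fun k _ => ?_
  obtain ⟨C, hC⟩ := norm_funcEqTerm_le_of_re_neg hn θ h0 hratio ‖s‖ (-s.re)
  refine tendsto_tsum_of_dominated_convergence
    (((summable_abs_rpow_index (by linarith : 1 < 1 + -s.re) C).comp_injective
      (Prod.mk_right_injective k) : Summable fun m : {m : ℤ // m ≠ 0} => _)) (fun m => ?_) ?_
  · refine Tendsto.mono_left ?_ nhdsWithin_le_nhds
    have : Continuous fun y : ℝ => funcEqTerm θ ω y (k, m) s := by
      unfold funcEqTerm
      fun_prop
    exact this.tendsto 0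
  · filter_upwards [self_mem_nhdsWithin,
      mem_nhdsWithin_of_mem_nhds (gt_mem_nhds (zero_lt_one (α := ℝ)))] with y h1 h2 m
    exact hC y (le_of_lt h1) (le_of_lt h2) (k, m) s le_rfl (by linarith)

/-! ### From the jumps to the functional equation in the half plane Re s > n. -/

theorem branchPow_exp {φ : ℝ} {w : ℂ} (h : w.im - φ ∈ Set.Ioc (-π) π) (s : ℂ) :
    branchPow φ (Complex.exp w) s = Complex.exp (s * w) := by
  have h1 : Complex.exp w * Complex.exp (-(φ * Complex.I)) = Complex.exp (w - φ * Complex.I) := by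
    rw [← Complex.exp_add, sub_eq_add_neg]
  rw [branchPow, h1, Complex.log_exp (by simpa using h.1) (by simpa using h.2), sub_add_cancel]

/-- At a pole w = log t the factor t^s is t^{s-1} times t = 2πim/ω_k: its 1/ω_k is the residue of
the removed kernel, and its m cancels the denominator of the Poisson sum. The interval for Im w is
the branch prescribed for t^{s-1}. -/
theorem kernelProd_erase_eq {n : ℕ} {θ : ℝ} {ω : Fin n → ℂ} (y : ℝ) (s : ℂ) (k : Fin n)
    (m : {m : ℤ // m ≠ 0}) {w : ℂ} (hw : Complex.exp w = 2 * (m.1 : ℂ) * π * Complex.I * (ω k)⁻¹)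
    (him : w.im ∈ Set.Ioo (-θ) (2 * π - θ)) :
    kernelProd ω y s (Finset.univ.erase k) w * Complex.exp (2 * (m.1 : ℂ) * π * Complex.I * y) =
      2 * π * Complex.I * m.1 * funcEqTerm θ ω y (k, m) s := by
  have h1 : polePow θ ω k m.1 s = Complex.exp ((s - 1) * w) := by
    rw [polePow, ← hw]
    exact branchPow_exp ⟨by linarith [him.1], by linarith [him.2]⟩ _
  have h2 : Complex.exp (s * w) =
      Complex.exp ((s - 1) * w) * (2 * (m.1 : ℂ) * π * Complex.I * (ω k)⁻¹) := by
    rw [← hw, ← Complex.exp_add]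
    ring_nf
  rw [funcEqTerm_eq, kernelProd, h2, h1, hw]
  ring

theorem hasSum_ne_zero_int {f : {m : ℤ // m ≠ 0} → ℂ} {a b : ℂ}
    (ha : HasSum (fun m : ℕ => f ⟨m + 1, by omega⟩) a)
    (hb : HasSum (fun m : ℕ => f ⟨-(m + 1), by omega⟩) b) : HasSum f (a + b) := by
  set e : ℕ ⊕ ℕ → {m : ℤ // m ≠ 0} :=
    Sum.elim (fun m => ⟨m + 1, by omega⟩) (fun m => ⟨-(m + 1), by omega⟩) with he
  have hbij : Function.Bijective e := by
    constructor
    · rintro (i | i) (j | j) h <;> simp [he] at h ⊢ <;> omega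
    · rintro ⟨m, hm⟩
      rcases lt_or_gt_of_ne hm with h | h
      · exact ⟨Sum.inr (-m - 1).toNat, Subtype.ext (by simp [he]; omega)⟩
      · exact ⟨Sum.inl (m - 1).toNat, Subtype.ext (by simp [he]; omega)⟩
  rw [← (Equiv.ofBijective e hbij).hasSum_iff]
  exact HasSum.sum ha hb

/-- For each k the ray at `poleAngle` gives the terms m > 0 and the opposite ray the terms m < 0. On
the latter e^{2πi(m+1)(1-y)} = e^{-2πi(m+1)y}, and the minus sign from the reflection compensates
the negative index. -/
theorem sum_rayResidue {n : ℕ} (hn : 2 ≤ n) {θ : ℝ} {ω : Fin n → ℂ}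
    (hω : ∀ j, ω j ∈ halfPlane θ) (hratio : ∀ j k, j ≠ k → (ω j / ω k).im ≠ 0)
    {y : ℝ} (hy0 : 0 < y) (hy1 : y < 1) (s : ℂ) :
    ∑ p, rayResidue θ ω y s p = 2 * π * Complex.I * funcEqSum θ ω y s := by
  have h0 : ∀ j, ω j ≠ 0 := fun j => mem_halfPlane_ne_zero (hω j)
  have hpi := Real.pi_pos
  rw [Fintype.sum_prod_type, funcEqSum, Finset.mul_sum]
  refine Finset.sum_congr rfl fun k _ => ?_
  rw [Fintype.sum_bool]
  have hnk : 0 < ‖ω k‖ := norm_pos_iff.2 (h0 k)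
  have hα := poleAngle_mem (hω k)
  obtain ⟨C, hC⟩ := norm_funcEqTerm_le_of_pos hn θ h0 hratio hy0 hy1 ‖s‖
  have hsum : Summable fun m : {m : ℤ // m ≠ 0} => funcEqTerm θ ω y (k, m) s :=
    Summable.of_norm_bounded ((summable_abs_rpow_index one_lt_two C).comp_injective
      (Prod.mk_right_injective k)) fun m => hC (k, m) s le_rfl
  have hp := (hsum.comp_injective (i := fun m : ℕ => (⟨m + 1, by omega⟩ : {m : ℤ // m ≠ 0}))
    fun a b h => by simpa using h).hasSum
  have hm := (hsum.comp_injective (i := fun m : ℕ => (⟨-(m + 1), by omega⟩ : {m : ℤ // m ≠ 0}))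
    fun a b h => by simpa using h).hasSum
  have htot := hasSum_ne_zero_int (f := fun m => funcEqTerm θ ω y (k, m) s) hp hm
  rw [htot.tsum_eq, mul_add, ← tsum_mul_left, ← tsum_mul_left]
  simp only [rayResidue, if_true, Bool.false_eq_true, if_false]
  have hexp : Complex.exp (poleAngle θ (ω k) * Complex.I) = ‖ω k‖ * Complex.I * (ω k)⁻¹ := by
    rw [← mul_exp_poleAngle θ (ω k), mul_right_comm, mul_inv_cancel₀ (h0 k), one_mul]
  have hnk' : (‖ω k‖ : ℂ) ≠ 0 := by exact_mod_cast hnk.ne'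
  have hlog : ∀ m : ℕ, Complex.exp (Real.log (2 * π * (m + 1) / ‖ω k‖)) =
      2 * π * (m + 1) / ‖ω k‖ := by
    intro m
    rw [← Complex.ofReal_exp, Real.exp_log (by positivity)]
    push_cast
    rfl
  congr 1
  · refine tsum_congr fun m => ?_
    have hm1 : (m : ℂ) + 1 ≠ 0 := by exact_mod_cast Nat.succ_ne_zero m
    have h := kernelProd_erase_eq (θ := θ) (ω := ω) y s k ⟨m + 1, by omega⟩
      (w := Real.log (2 * π * (m + 1) / ‖ω k‖) + poleAngle θ (ω k) * Complex.I) (by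
        rw [Complex.exp_add, hexp, hlog]
        push_cast
        field_simp) (by simpa using ⟨hα.1, by linarith [hα.2]⟩)
    rw [div_eq_iff hm1]
    simp only [Function.comp]
    simp only [Int.cast_add, Int.cast_natCast, Int.cast_one] at h
    have he : Complex.exp (2 * π * Complex.I * (m + 1) * y) =
        Complex.exp (2 * (m + 1) * π * Complex.I * y) := by ring_nf
    rw [he, h]
    ring
  · rw [← tsum_neg]
    refine tsum_congr fun m => ?_
    have hm1 : (m : ℂ) + 1 ≠ 0 := by exact_mod_cast Nat.succ_ne_zero m
    have h := kernelProd_erase_eq (θ := θ) (ω := ω) y s k ⟨-(m + 1), by omega⟩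
      (w := Real.log (2 * π * (m + 1) / ‖-ω k‖) + (poleAngle θ (ω k) + π : ℝ) * Complex.I) (by
        rw [norm_neg, Complex.exp_add, hlog, Complex.ofReal_add, add_mul, Complex.exp_add, hexp,
          Complex.exp_pi_mul_I]
        push_cast
        field_simp) (by
          simp only [Complex.add_im, Complex.ofReal_im, Complex.im_ofReal_mul, Complex.I_im, mul_one, zero_add]
          exact ⟨by linarith [hα.1], by linarith [hα.2]⟩)
    rw [← neg_div, div_eq_iff hm1]
    simp only [Function.comp]
    simp only [Int.cast_neg, Int.cast_add, Int.cast_natCast, Int.cast_one] at h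
    have he : Complex.exp (2 * π * Complex.I * (m + 1) * (1 - y : ℝ)) =
        Complex.exp (2 * -((m : ℂ) + 1) * π * Complex.I * y) := by
      have : (2 * π * Complex.I * (m + 1) * (1 - y : ℝ) : ℂ) =
          2 * -((m : ℂ) + 1) * π * Complex.I * y + ((m + 1 : ℕ) : ℂ) * (2 * π * Complex.I) := by
        push_cast
        ring
      rw [this, Complex.exp_add, Complex.exp_nat_mul_two_pi_mul_I, mul_one]
    rw [he]
    linear_combination -h

theorem exp_two_pi_mul_I_ne_one {s : ℂ} (hs : ∀ N : ℤ, s ≠ N) :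
    Complex.exp (2 * π * Complex.I * s) ≠ 1 := by
  rw [Ne, Complex.exp_eq_one_iff]
  rintro ⟨N, hN⟩
  refine hs N ?_
  have : (2 * π * Complex.I : ℂ) ≠ 0 := Complex.two_pi_I_ne_zero
  rw [mul_comm (N : ℂ)] at hN
  exact mul_left_cancel₀ this hN

/-- The kernels depend on t = e^w only, so a full turn affects t^s alone. This produces the factor
e^{2πis} - 1. -/
theorem kernelProd_add_two_pi {n : ℕ} (ω : Fin n → ℂ) (y : ℝ) (s : ℂ) (T : Finset (Fin n))
    (w : ℂ) : kernelProd ω y s T (w + 2 * π * Complex.I) =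
      Complex.exp (2 * π * Complex.I * s) * kernelProd ω y s T w := by
  rw [kernelProd, kernelProd, Complex.exp_periodic, mul_add, Complex.exp_add]
  ring_nf

/-- Convergence is read off from the Mellin integral, by dominated convergence, instead of counting
lattice points. -/
theorem summable_barnesSeriesTerm {n : ℕ} (hn : 2 ≤ n) {θ : ℝ} {ω : Fin n → ℂ}
    (hω : ∀ j, ω j ∈ halfPlane θ) {y : ℝ} (hy0 : 0 < y) (hy1 : y < 1) {s : ℂ}
    (hs : (n : ℝ) < s.re) : Summable (barnesSeriesTerm θ ω (barnesParam ω y) s) := by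
  have hs0 : 0 < s.re := lt_of_le_of_lt (Nat.cast_nonneg n) hs
  exact (summable_mul_left_iff (Complex.Gamma_ne_zero_of_re_pos hs0)).1
    (hasSum_Gamma_mul_barnesSeriesTerm (by omega) hω hy0 hy1 hs).summable

/-- The functional equation in the half plane of absolute convergence. -/
theorem hasSum_barnesSeriesTerm_funcEqRHS {n : ℕ} (hn : 2 ≤ n) {θ : ℝ} {ω : Fin n → ℂ}
    (hω : ∀ j, ω j ∈ halfPlane θ) (hratio : ∀ j k, j ≠ k → (ω j / ω k).im ≠ 0)
    {y : ℝ} (hy0 : 0 < y) (hy1 : y < 1) {s : ℂ} (hs : (n : ℝ) < s.re) (hN : ∀ N : ℤ, s ≠ N) :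
    HasSum (barnesSeriesTerm θ ω (barnesParam ω y) s) (funcEqRHS θ ω y s) := by
  have hs0 : 0 < s.re := lt_of_le_of_lt (Nat.cast_nonneg n) hs
  have hΓ := Complex.Gamma_ne_zero_of_re_pos hs0
  have h1 := (hasSum_Gamma_mul_barnesSeriesTerm (by omega) hω hy0 hy1 hs).mul_left
    (Complex.Gamma s)⁻¹
  simp only [inv_mul_cancel_left₀ hΓ] at h1
  convert! h1 using 1
  have h2 := integral_sub_integral_rotated hn hω hratio hy0 hy1 hs
  rw [sum_rayResidue hn hω hratio hy0 hy1] at h2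
  have h3 : ∀ u : ℝ, kernelProd ω y s Finset.univ (u + (2 * π - θ : ℝ) * Complex.I) =
      Complex.exp (2 * π * Complex.I * s) *
        kernelProd ω y s Finset.univ (u + (-θ : ℝ) * Complex.I) := by
    intro u
    rw [← kernelProd_add_two_pi]
    congr 1
    push_cast
    ring
  simp only [h3, integral_const_mul] at h2
  have h4 : Complex.exp (2 * π * Complex.I * s) - 1 ≠ 0 :=
    sub_ne_zero.2 (exp_two_pi_mul_I_ne_one hN)
  change gammaFactor s * funcEqSum θ ω y s = _
  rw [gammaFactor]
  generalize (∫ u : ℝ, kernelProd ω y s Finset.univ (u + (-θ : ℝ) * Complex.I)) = J at h2 ⊢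
  field_simp
  linear_combination h2

/-! ### Meromorphic continuation and the values at integers. -/

theorem eventually_ne_intCast (s : ℂ) : ∀ᶠ z : ℂ in 𝓝[≠] s, ∀ N : ℤ, z ≠ N := by
  by_cases hs : ∃ N₀ : ℤ, s = N₀
  · obtain ⟨N₀, rfl⟩ := hs
    filter_upwards [self_mem_nhdsWithin,
      mem_nhdsWithin_of_mem_nhds (Metric.ball_mem_nhds (N₀ : ℂ) one_pos)] with z h1 h2 N hN
    subst hN
    have h3 : N ≠ N₀ := fun h => h1 (by simp [h])
    rw [mem_ball_iff_norm] at h2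
    have h4 : ‖(N : ℂ) - N₀‖ = |((N - N₀ : ℤ) : ℝ)| := by
      rw [← Int.cast_sub, Complex.norm_intCast]
    rw [h4] at h2
    have h5 : |N - N₀| < 1 := by exact_mod_cast h2
    exact h3 (sub_eq_zero.1 (Int.abs_lt_one_iff.1 h5))
  · push Not at hs
    have h1 : (Set.range ((↑) : ℤ → ℂ))ᶜ ∈ 𝓝 s :=
      Complex.isOpen_compl_range_intCast.mem_nhds fun ⟨N, hN⟩ => hs N hN.symm
    filter_upwards [mem_nhdsWithin_of_mem_nhds h1] with z hz N hN
    exact hz ⟨N, hN.symm⟩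

theorem eventually_ne_intCast_nhds {s : ℂ} (hs : ∀ N : ℤ, s ≠ N) :
    ∀ᶠ z : ℂ in 𝓝 s, ∀ N : ℤ, z ≠ N := by
  have h1 : (Set.range ((↑) : ℤ → ℂ))ᶜ ∈ 𝓝 s :=
    Complex.isOpen_compl_range_intCast.mem_nhds fun ⟨N, hN⟩ => hs N hN.symm
  filter_upwards [h1] with z hz N hN
  exact hz ⟨N, hN.symm⟩

/-- The identity theorem for meromorphic functions on the plane. -/
theorem eventuallyEq_nhdsNE_of_meromorphicOn {f g : ℂ → ℂ} (hf : MeromorphicOn f Set.univ)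
    (hg : MeromorphicOn g Set.univ) {s₀ : ℂ} (h : f =ᶠ[𝓝[≠] s₀] g) (s : ℂ) :
    f =ᶠ[𝓝[≠] s] g := by
  have key : ∀ x, meromorphicOrderAt (f - g) x = ⊤ ↔ f =ᶠ[𝓝[≠] x] g := by
    intro x
    rw [meromorphicOrderAt_eq_top_iff]
    refine eventually_congr (Eventually.of_forall fun z => ?_)
    simp [sub_eq_zero]
  rw [← key]
  by_contra hne
  exact (hf.sub hg).meromorphicOrderAt_ne_top_of_isPreconnected isPreconnected_univ
    (Set.mem_univ s) (Set.mem_univ s₀) hne ((key s₀).2 h)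

theorem MeromorphicNFAt.eventuallyEq_nhds_of_analyticAt {Z G : ℂ → ℂ} {s : ℂ}
    (hZ : MeromorphicNFAt Z s) (hG : AnalyticAt ℂ G s) (h : Z =ᶠ[𝓝[≠] s] G) : Z =ᶠ[𝓝 s] G :=
  (hZ.eventuallyEq_nhdsNE_iff_eventuallyEq_nhds hG.meromorphicNFAt).1 h

theorem eventually_lt_re {x : ℝ} {s : ℂ} (hs : x < s.re) : ∀ᶠ z : ℂ in 𝓝 s, x < z.re :=
  (isOpen_lt continuous_const Complex.continuous_re).mem_nhds hs

/-- G may have wrong values at integers, where it is only a formal expression. The normal form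
repairs them: it agrees with the analytic sum D on punctured neighbourhoods, hence also at the
centre. -/
theorem isBarnesContinuation_toMeromorphicNFOn {n : ℕ} {θ : ℝ} {ω : Fin n → ℂ} {a : ℂ}
    {G D : ℂ → ℂ} (hG : MeromorphicOn G Set.univ)
    (hD : ∀ s : ℂ, (n : ℝ) < s.re → AnalyticAt ℂ D s)
    (hsum : ∀ s : ℂ, (n : ℝ) < s.re → HasSum (barnesSeriesTerm θ ω a s) (D s))
    (hGD : ∀ s : ℂ, (n : ℝ) < s.re → (∀ N : ℤ, s ≠ N) → G s = D s) :
    IsBarnesContinuation θ ω a (toMeromorphicNFOn G Set.univ) := by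
  refine ⟨meromorphicNFOn_toMeromorphicNFOn _ _, fun s hs => ?_⟩
  have h1 : toMeromorphicNFOn G Set.univ =ᶠ[𝓝[≠] s] D := by
    refine (hG.toMeromorphicNFOn_eq_self_on_nhdsNE (Set.mem_univ s)).trans ?_
    filter_upwards [eventually_ne_intCast s,
      (eventually_lt_re hs).filter_mono nhdsWithin_le_nhds] with z h2 h3 using hGD z h3 h2
  rw [((meromorphicNFOn_toMeromorphicNFOn G Set.univ
    (Set.mem_univ s)).eventuallyEq_nhds_of_analyticAt (hD s hs) h1).eq_of_nhds]
  exact hsum s hs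

theorem IsBarnesContinuation.eventuallyEq {n : ℕ} {θ : ℝ} {ω : Fin n → ℂ} {a : ℂ}
    {Z G : ℂ → ℂ} (hZ : IsBarnesContinuation θ ω a Z) (hG : MeromorphicOn G Set.univ)
    (hGD : ∀ s : ℂ, (n : ℝ) < s.re → (∀ N : ℤ, s ≠ N) →
      HasSum (barnesSeriesTerm θ ω a s) (G s)) (s : ℂ) : Z =ᶠ[𝓝[≠] s] G := by
  refine eventuallyEq_nhdsNE_of_meromorphicOn hZ.meromorphic.meromorphicOn hG
    (s₀ := (n + 1 : ℕ)) ?_ s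
  filter_upwards [eventually_ne_intCast _, (eventually_lt_re (x := n) (s := (n + 1 : ℕ))
    (by simp)).filter_mono nhdsWithin_le_nhds] with z h1 h2
  exact (hZ.hasSum z h2).unique (hGD z h2 h1)

theorem isBarnesContinuation_barnesZeta {n : ℕ} {θ : ℝ} {ω : Fin n → ℂ} {a : ℂ} {Z : ℂ → ℂ}
    (hZ : IsBarnesContinuation θ ω a Z) : IsBarnesContinuation θ ω a (barnesZeta θ ω a) := by
  have h : ∃ Z : ℂ → ℂ, IsBarnesContinuation θ ω a Z := ⟨Z, hZ⟩
  rw [barnesZeta, dif_pos h]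
  exact h.choose_spec

theorem IsBarnesContinuation.analyticAt {n : ℕ} {θ : ℝ} {ω : Fin n → ℂ} {a : ℂ} {Z D : ℂ → ℂ}
    (hZ : IsBarnesContinuation θ ω a Z) (hD : ∀ s : ℂ, (n : ℝ) < s.re → AnalyticAt ℂ D s)
    (hsum : ∀ s : ℂ, (n : ℝ) < s.re → HasSum (barnesSeriesTerm θ ω a s) (D s)) {s : ℂ}
    (hs : (n : ℝ) < s.re) : AnalyticAt ℂ Z s :=
  (hD s hs).congr ((eventually_lt_re hs).mono fun z hz => (hsum z hz).unique (hZ.hasSum z hz))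

/-- By Euler's reflection formula. The right-hand form is analytic at every integer N ≤ 0, so the
zeros of e^{2πis} - 1 are harmless there. -/
theorem gammaFactor_eq {s : ℂ} (hs : ∀ N : ℤ, s ≠ N) :
    gammaFactor s = -(Complex.Gamma (1 - s) * Complex.exp (-(π * Complex.I * s))) := by
  have hΓ : Complex.Gamma s ≠ 0 := Complex.Gamma_ne_zero fun m => by exact_mod_cast hs (-m)
  have h1 := Complex.Gamma_mul_Gamma_one_sub s
  have h2 : Complex.exp (2 * π * Complex.I * s) - 1 =
      Complex.exp (π * Complex.I * s) * (2 * Complex.I * Complex.sin (π * s)) := by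
    rw [Complex.sin, show (2 * π * Complex.I * s : ℂ) = π * Complex.I * s + π * Complex.I * s by
      ring, Complex.exp_add, show (π * s * Complex.I : ℂ) = π * Complex.I * s by ring,
      show (-(π * s) * Complex.I : ℂ) = -(π * Complex.I * s) by ring, Complex.exp_neg]
    have := Complex.exp_ne_zero (π * Complex.I * s)
    field_simp
    rw [Complex.I_sq]
    ring
  have h3 : Complex.exp (2 * π * Complex.I * s) - 1 ≠ 0 :=
    sub_ne_zero.2 (exp_two_pi_mul_I_ne_one hs)
  have h4 : Complex.sin (π * s) ≠ 0 := by
    intro h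
    rw [h2, h] at h3
    simp at h3
  rw [gammaFactor, h2, Complex.exp_neg]
  have h5 := Complex.exp_ne_zero (π * Complex.I * s)
  have h6 : Complex.Gamma (1 - s) = π / (Complex.Gamma s * Complex.sin (π * s)) := by
    rw [eq_div_iff (mul_ne_zero hΓ h4), ← mul_assoc, mul_comm _ (Complex.Gamma s), h1]
    field_simp
  rw [h6]
  have := Complex.I_ne_zero
  field_simp

theorem analyticAt_gammaFactor_extension {s : ℂ} (hs : ∀ m : ℕ, 1 - s ≠ -m) :
    AnalyticAt ℂ (fun s => -(Complex.Gamma (1 - s) * Complex.exp (-(π * Complex.I * s)))) s := by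
  have hev : ∀ᶠ z : ℂ in 𝓝 s, ∀ m : ℕ, 1 - z ≠ -m := by
    by_cases h : ∀ N : ℤ, s ≠ N
    · filter_upwards [eventually_ne_intCast_nhds h] with z hz m hm
      exact hz (m + 1) (by push_cast; linear_combination -hm)
    · have h1 := eventually_ne_intCast s
      rw [eventually_nhdsWithin_iff] at h1
      filter_upwards [h1] with z hz m hm
      by_cases hzs : z = s
      · exact hs m (hzs ▸ hm)
      · exact hz hzs (m + 1) (by push_cast; linear_combination -hm)
  rw [Complex.analyticAt_iff_eventually_differentiableAt]
  filter_upwards [hev] with z hz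
  have h1 : DifferentiableAt ℂ (fun s => Complex.Gamma (1 - s)) z :=
    (Complex.differentiableAt_Gamma (1 - z) hz).comp z (by fun_prop)
  exact (h1.mul (by fun_prop)).neg

theorem meromorphicOn_gammaFactor : MeromorphicOn gammaFactor Set.univ := by
  intro s _
  have h1 : gammaFactor = fun s => -(2 * π * Complex.I * (Complex.Gamma s)⁻¹ *
      (Complex.exp (2 * π * Complex.I * s) - 1)⁻¹) := by
    funext s
    rw [gammaFactor, div_eq_mul_inv, mul_inv, mul_assoc (2 * π * Complex.I : ℂ)]
  have h2 : AnalyticAt ℂ (fun s => (Complex.Gamma s)⁻¹) s :=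
    Complex.differentiable_one_div_Gamma.analyticAt s
  have h3 : AnalyticAt ℂ (fun s => Complex.exp (2 * π * Complex.I * s) - 1) s := by fun_prop
  rw [h1]
  exact (((MeromorphicAt.const _ s).mul h2.meromorphicAt).mul h3.meromorphicAt.inv).neg

theorem analyticAt_gammaFactor {s : ℂ} (hs : ∀ N : ℤ, s ≠ N) : AnalyticAt ℂ gammaFactor s := by
  refine (analyticAt_gammaFactor_extension fun m hm =>
    hs (m + 1) (by push_cast; linear_combination -hm)).congr ?_
  filter_upwards [eventually_ne_intCast_nhds hs] with z hz using (gammaFactor_eq hz).symm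

/-- Away from integers, and at N ≤ 0 after the reflection formula, the product is analytic and a
normal form must take its value. At N > n the factor may have a pole, and analyticity of Z is
supplied by `hlarge`; the limit of the right-hand side is then that of Z. -/
theorem equalsOn_gammaFactor_mul {n : ℕ} {Z S : ℂ → ℂ} {U : Set ℂ}
    (hZ : MeromorphicNFOn Z Set.univ) (hS : ∀ s ∈ U, AnalyticAt ℂ S s)
    (h : ∀ s ∈ U, Z =ᶠ[𝓝[≠] s] fun s => gammaFactor s * S s)
    (hlarge : ∀ s ∈ U, (n : ℝ) < s.re → AnalyticAt ℂ Z s) :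
    EqualsOn n Z (fun s => gammaFactor s * S s) U := by
  refine ⟨fun s hs hN => ?_, fun N hN hcase => ?_⟩
  · exact ((hZ (Set.mem_univ s)).eventuallyEq_nhds_of_analyticAt
      ((analyticAt_gammaFactor hN).mul (hS s hs)) (h s hs)).eq_of_nhds
  · have hZN : AnalyticAt ℂ Z N := by
      rcases hcase with hlt | hgt
      · have h1 : AnalyticAt ℂ (fun s => -(Complex.Gamma (1 - s) *
            Complex.exp (-(π * Complex.I * s))) * S s) N := by
          refine (analyticAt_gammaFactor_extension fun m hm => ?_).mul (hS N hN)
          have h2 : (1 - N : ℤ) = -m := by exact_mod_cast hm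
          omega
        refine h1.congr ?_
        symm
        refine (hZ (Set.mem_univ _)).eventuallyEq_nhds_of_analyticAt h1 ((h N hN).trans ?_)
        filter_upwards [eventually_ne_intCast (N : ℂ)] with z hz
        rw [gammaFactor_eq hz]
      · exact hlarge N hN (by simpa using (by exact_mod_cast hgt : (n : ℝ) < N))
    exact (hZN.continuousAt.tendsto.mono_left nhdsWithin_le_nhds).congr' (h N hN)

/-! ### Uniform control of the Barnes series, and the continuation for 0 < y < 1. -/

theorem norm_branchPow_ofReal {φ : ℝ} {z : ℂ} (hz : z ≠ 0) (x : ℝ) :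
    ‖branchPow φ z x‖ = ‖z‖ ^ x := by
  have hn : 0 < ‖z‖ := norm_pos_iff.2 hz
  have hnz : ‖z * Complex.exp (-(φ * Complex.I))‖ = ‖z‖ := by
    rw [norm_mul, show (-(φ * Complex.I) : ℂ) = ((-φ : ℝ) : ℂ) * Complex.I by push_cast; ring,
      Complex.norm_exp_ofReal_mul_I, mul_one]
  rw [branchPow, Complex.norm_exp, Complex.re_ofReal_mul, Complex.add_re, Complex.log_re, hnz,
    Complex.re_ofReal_mul, Complex.I_re, mul_zero, add_zero, Real.rpow_def_of_pos hn, mul_comm]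

theorem norm_branchPow_neg_le {θ ρ σ : ℝ} {z s : ℂ} (hρ : 0 < ρ) (hz : ρ ≤ ‖z‖)
    (hs : σ ≤ s.re) : ‖branchPow θ z (-s)‖ ≤
      ‖z‖ ^ (-σ) * ρ ^ (-(s.re - σ)) * Real.exp ((|θ| + π) * |s.im|) := by
  have hn : 0 < ‖z‖ := hρ.trans_le hz
  refine (norm_branchPow_le (norm_pos_iff.1 hn) (-s)).trans ?_
  rw [Complex.neg_re, Complex.neg_im, abs_neg]
  refine mul_le_mul_of_nonneg_right ?_ (Real.exp_pos _).le
  rw [show -s.re = -σ + -(s.re - σ) by ring, Real.rpow_add hn]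
  refine mul_le_mul_of_nonneg_left ?_ (by positivity)
  exact Real.rpow_le_rpow_of_nonpos hρ hz (by linarith)

/-- The points `a + ω · m` stay away from `0` and grow as those of a lattice cone. -/
structure BarnesCone {n : ℕ} (ω : Fin n → ℂ) (a : ℂ) (ρ : ℝ) : Prop where
  pos : 0 < ρ
  le_norm : ∀ m : Fin n → ℕ, ρ ≤ ‖a + ∑ j, ω j * (m j : ℂ)‖
  summable : ∀ σ : ℝ, (n : ℝ) < σ →
    Summable fun m : Fin n → ℕ => ‖a + ∑ j, ω j * (m j : ℂ)‖ ^ (-σ)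

/-- The shift s → s + k costs only ρ^{-k}, with the remaining factors independent of k: this is what
makes the Taylor series in δ converge for |δ| < ρ. The case k = 0 gives locally uniform convergence
in s. -/
theorem BarnesCone.norm_term_le {n : ℕ} {ω : Fin n → ℂ} {a : ℂ} {ρ : ℝ} (h : BarnesCone ω a ρ)
    (θ : ℝ) {σ R : ℝ} (hσ : 0 ≤ σ) {s : ℂ} (hs : σ ≤ s.re) (hR : ‖s‖ ≤ R) (k : ℕ)
    (m : Fin n → ℕ) : ‖barnesSeriesTerm θ ω a (s + k) m‖ ≤
      ‖a + ∑ j, ω j * (m j : ℂ)‖ ^ (-σ) *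
        Real.exp (|Real.log ρ| * (R + σ) + (|θ| + π) * R) * (ρ⁻¹) ^ k := by
  have hk : (0 : ℝ) ≤ k := Nat.cast_nonneg k
  have hnn : 0 ≤ ‖a + ∑ j, ω j * (m j : ℂ)‖ := norm_nonneg _
  refine (norm_branchPow_neg_le (θ := θ) (σ := σ) (s := s + k) h.pos (h.le_norm m)
    (by simpa using by linarith)).trans ?_
  simp only [Complex.add_re, Complex.natCast_re, Complex.add_im, Complex.natCast_im, add_zero]
  have e1 : ρ ^ (-(s.re + k - σ)) = ρ ^ (-(s.re - σ)) * (ρ⁻¹) ^ k := by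
    rw [show -(s.re + k - σ) = -(s.re - σ) + -(k : ℝ) by ring, Real.rpow_add h.pos,
      Real.rpow_neg h.pos.le (k : ℝ), Real.rpow_natCast, inv_pow]
  have hRe := Complex.abs_re_le_norm s
  have hIm := Complex.abs_im_le_norm s
  have e2 : ρ ^ (-(s.re - σ)) ≤ Real.exp (|Real.log ρ| * (R + σ)) := by
    rw [Real.rpow_def_of_pos h.pos, Real.exp_le_exp]
    refine (le_abs_self _).trans ?_
    rw [abs_mul, abs_neg]
    gcongr
    refine (abs_sub _ _).trans ?_
    rw [abs_of_nonneg hσ]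
    linarith
  have e3 : Real.exp ((|θ| + π) * |s.im|) ≤ Real.exp ((|θ| + π) * R) := by
    have := Real.pi_pos
    gcongr
    linarith
  rw [e1, Real.exp_add]
  have hp := inv_pos.2 h.pos
  calc _ ≤ ‖a + ∑ j, ω j * (m j : ℂ)‖ ^ (-σ) *
        (Real.exp (|Real.log ρ| * (R + σ)) * (ρ⁻¹) ^ k) * Real.exp ((|θ| + π) * R) := by
        gcongr
    _ = _ := by ring

theorem BarnesCone.summable_term {n : ℕ} {ω : Fin n → ℂ} {a : ℂ} {ρ : ℝ}
    (h : BarnesCone ω a ρ) (θ : ℝ) {s : ℂ} (hs : (n : ℝ) < s.re) :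
    Summable (barnesSeriesTerm θ ω a s) := by
  have hσ : 0 ≤ s.re := (Nat.cast_nonneg n).trans hs.le
  refine Summable.of_norm_bounded ((h.summable s.re hs).mul_right
    (Real.exp (|Real.log ρ| * (‖s‖ + s.re) + (|θ| + π) * ‖s‖))) fun m => ?_
  simpa using h.norm_term_le θ hσ le_rfl le_rfl 0 m

theorem BarnesCone.analyticAt_tsum {n : ℕ} {ω : Fin n → ℂ} {a : ℂ} {ρ : ℝ}
    (h : BarnesCone ω a ρ) (θ : ℝ) {s₀ : ℂ} (hs₀ : (n : ℝ) < s₀.re) :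
    AnalyticAt ℂ (fun s => ∑' m, barnesSeriesTerm θ ω a s m) s₀ := by
  obtain ⟨σ, hσ1, hσ2⟩ := exists_between hs₀
  have hσ : 0 ≤ σ := (Nat.cast_nonneg n).trans hσ1.le
  set V : Set ℂ := Metric.ball s₀ 1 ∩ {s : ℂ | σ < s.re}
  have hV : IsOpen V := Metric.isOpen_ball.inter (isOpen_lt continuous_const Complex.continuous_re)
  have hmem : V ∈ 𝓝 s₀ := hV.mem_nhds ⟨Metric.mem_ball_self one_pos, hσ2⟩
  refine DifferentiableOn.analyticAt (s := V) (Complex.differentiableOn_tsum_of_summable_norm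
    ((h.summable σ hσ1).mul_right
      (Real.exp (|Real.log ρ| * (‖s₀‖ + 1 + σ) + (|θ| + π) * (‖s₀‖ + 1))))
    (fun m => ?_) hV fun m s hs => ?_) hmem
  · unfold barnesSeriesTerm branchPow
    fun_prop
  · have h1 := hs.1
    rw [mem_ball_iff_norm] at h1
    have h2 : ‖s‖ ≤ ‖s₀‖ + 1 := by
      have := norm_le_norm_add_norm_sub' s s₀
      linarith
    simpa using h.norm_term_le θ hσ (le_of_lt hs.2) h2 0 m

theorem re_mul_le_norm {θ : ℝ} (z : ℂ) : (z * Complex.exp (-(θ * Complex.I))).re ≤ ‖z‖ := by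
  refine (Complex.re_le_norm _).trans (le_of_eq ?_)
  rw [norm_mul, show (-(θ * Complex.I) : ℂ) = ((-θ : ℝ) : ℂ) * Complex.I by push_cast; ring,
    Complex.norm_exp_ofReal_mul_I, mul_one]

/-- Project onto the direction e^{iθ}, where every ω_j m_j has a nonnegative component. The explicit
bound serves as radius of the Taylor disc around a(y). -/
theorem param_le_norm {n : ℕ} {θ : ℝ} {ω : Fin n → ℂ} (hω : ∀ j, ω j ∈ halfPlane θ) (y : ℝ)
    (m : Fin n → ℕ) : (1 - y) * ((∑ j, ω j) * Complex.exp (-(θ * Complex.I))).re ≤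
      ‖barnesParam ω y + ∑ j, ω j * (m j : ℂ)‖ := by
  refine le_trans ?_ (re_mul_le_norm (θ := θ) _)
  have h1 : (barnesParam ω y + ∑ j, ω j * (m j : ℂ)) * Complex.exp (-(θ * Complex.I)) =
      ((1 - y : ℝ) : ℂ) * ((∑ j, ω j) * Complex.exp (-(θ * Complex.I))) +
        ∑ j, ((m j : ℝ) : ℂ) * (ω j * Complex.exp (-(θ * Complex.I))) := by
    rw [barnesParam, ← Finset.sum_mul, add_mul, Finset.sum_mul (f := fun j => ω j * (m j : ℂ))]
    congr 1
    · push_cast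
      ring
    · refine Finset.sum_congr rfl fun j _ => ?_
      push_cast
      ring
  rw [h1, Complex.add_re, Complex.re_ofReal_mul, Complex.re_sum]
  refine le_add_of_nonneg_right (Finset.sum_nonneg fun j _ => ?_)
  rw [Complex.re_ofReal_mul]
  exact mul_nonneg (Nat.cast_nonneg _) (le_of_lt (hω j))

/-- For real s = σ the absolute value of a term of the Barnes series is exactly the power ‖a +
ω·m‖^{-σ}, so its summability is already known. -/
theorem barnesCone_param {n : ℕ} (hn : 2 ≤ n) {θ : ℝ} {ω : Fin n → ℂ}
    (hω : ∀ j, ω j ∈ halfPlane θ) {y : ℝ} (hy0 : 0 < y) (hy1 : y < 1) :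
    BarnesCone ω (barnesParam ω y)
      ((1 - y) * ((∑ j, ω j) * Complex.exp (-(θ * Complex.I))).re) where
  pos := by
    have h1 : ∑ j, ω j ∈ halfPlane θ := by
      simpa using smul_mem_halfPlane_sum (by omega) hω (x := fun _ => 1) fun _ => one_pos
    exact mul_pos (by linarith) h1
  le_norm := param_le_norm hω y
  summable σ hσ := by
    have h1 := (summable_barnesSeriesTerm hn hω hy0 hy1 (s := σ) (by simpa using hσ)).norm
    refine h1.congr fun m => ?_
    rw [barnesSeriesTerm, ← Complex.ofReal_neg, norm_branchPow_ofReal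
      (mem_halfPlane_ne_zero (param_add_mem (by omega) hω hy1 m))]

theorem meromorphicOn_funcEqRHS {n : ℕ} (hn : 2 ≤ n) {θ : ℝ} {ω : Fin n → ℂ}
    (hω : ∀ j, ω j ∈ halfPlane θ) (hratio : ∀ j k, j ≠ k → (ω j / ω k).im ≠ 0)
    {y : ℝ} (hy0 : 0 < y) (hy1 : y < 1) : MeromorphicOn (funcEqRHS θ ω y) Set.univ := by
  intro s hs
  exact (meromorphicOn_gammaFactor s hs).mul
    ((differentiable_funcEqSum hn θ (fun j => mem_halfPlane_ne_zero (hω j))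
      hratio hy0 hy1).analyticAt s).meromorphicAt

theorem exists_isBarnesContinuation_of_pos {n : ℕ} (hn : 2 ≤ n) {θ : ℝ} {ω : Fin n → ℂ}
    (hω : ∀ j, ω j ∈ halfPlane θ) (hratio : ∀ j k, j ≠ k → (ω j / ω k).im ≠ 0)
    {y : ℝ} (hy0 : 0 < y) (hy1 : y < 1) :
    IsBarnesContinuation θ ω (barnesParam ω y) (barnesZeta θ ω (barnesParam ω y)) :=
  isBarnesContinuation_barnesZeta (isBarnesContinuation_toMeromorphicNFOn
    (meromorphicOn_funcEqRHS hn hω hratio hy0 hy1)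
    (fun _ hs => (barnesCone_param hn hω hy0 hy1).analyticAt_tsum θ hs)
    (fun _ hs => ((barnesCone_param hn hω hy0 hy1).summable_term θ hs).hasSum)
    fun _ hs hN => (hasSum_barnesSeriesTerm_funcEqRHS hn hω hratio hy0 hy1 hs hN).tsum_eq.symm)

theorem analyticAt_barnesZeta_of_pos {n : ℕ} (hn : 2 ≤ n) {θ : ℝ} {ω : Fin n → ℂ}
    (hω : ∀ j, ω j ∈ halfPlane θ) (hratio : ∀ j k, j ≠ k → (ω j / ω k).im ≠ 0)
    {y : ℝ} (hy0 : 0 < y) (hy1 : y < 1) {s : ℂ} (hs : (n : ℝ) < s.re) :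
    AnalyticAt ℂ (barnesZeta θ ω (barnesParam ω y)) s :=
  (exists_isBarnesContinuation_of_pos hn hω hratio hy0 hy1).analyticAt
    (fun _ hs => (barnesCone_param hn hω hy0 hy1).analyticAt_tsum θ hs)
    (fun _ hs => ((barnesCone_param hn hω hy0 hy1).summable_term θ hs).hasSum) hs

theorem equalsOn_barnesZeta_of_pos {n : ℕ} (hn : 2 ≤ n) {θ : ℝ} {ω : Fin n → ℂ}
    (hω : ∀ j, ω j ∈ halfPlane θ) (hratio : ∀ j k, j ≠ k → (ω j / ω k).im ≠ 0)
    {y : ℝ} (hy0 : 0 < y) (hy1 : y < 1) :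
    EqualsOn n (barnesZeta θ ω (barnesParam ω y)) (funcEqRHS θ ω y) Set.univ := by
  have hZ := exists_isBarnesContinuation_of_pos hn hω hratio hy0 hy1
  exact equalsOn_gammaFactor_mul (S := funcEqSum θ ω y) hZ.meromorphic
    (fun s _ => (differentiable_funcEqSum hn θ (fun j => mem_halfPlane_ne_zero (hω j))
      hratio hy0 hy1).analyticAt s)
    (fun s _ => hZ.eventuallyEq (meromorphicOn_funcEqRHS hn hω hratio hy0 hy1)
      (fun s hs hN => hasSum_barnesSeriesTerm_funcEqRHS hn hω hratio hy0 hy1 hs hN) s)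
    fun s _ hs => analyticAt_barnesZeta_of_pos hn hω hratio hy0 hy1 hs

/-! ### The Taylor series in the parameter. -/

theorem ringChoose_eq_prod (r : ℂ) (k : ℕ) :
    Ring.choose r k = (∏ i ∈ Finset.range k, (r - i)) / (k.factorial : ℂ) := by
  have h1 : (descPochhammer ℤ k).smeval r = ∏ i ∈ Finset.range k, (r - i) := by
    induction k with
    | zero => simp
    | succ k ih =>
      rw [descPochhammer_succ_right, Polynomial.smeval_mul, ih, Finset.prod_range_succ]
      simp [Polynomial.smeval_natCast]
  have h2 := Ring.descPochhammer_eq_factorial_smul_choose r k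
  rw [h1, nsmul_eq_mul] at h2
  rw [h2]
  have : (k.factorial : ℂ) ≠ 0 := by exact_mod_cast k.factorial_ne_zero
  field_simp

theorem differentiable_ringChoose_neg (k : ℕ) :
    Differentiable ℂ fun s : ℂ => Ring.choose (-s) k := by
  simp only [ringChoose_eq_prod]
  fun_prop

/-- Factor by factor, |s + i| ≤ R + i. One binomial series with exponent -R thus majorises all s in
a disc. -/
theorem norm_ringChoose_neg_le {s : ℂ} {R : ℝ} (hs : ‖s‖ ≤ R) (k : ℕ) :
    ‖Ring.choose (-s) k‖ ≤ ‖Ring.choose (-(R : ℂ)) k‖ := by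
  have hR : 0 ≤ R := (norm_nonneg s).trans hs
  rw [ringChoose_eq_prod, ringChoose_eq_prod, norm_div, norm_div, norm_prod, norm_prod]
  gcongr with i
  rw [show (-s - i : ℂ) = -(s + i) by ring, show (-(R : ℂ) - i : ℂ) = -((R + i : ℝ) : ℂ) by
    push_cast; ring, norm_neg, norm_neg, Complex.norm_real, Real.norm_of_nonneg (by positivity)]
  refine (norm_add_le _ _).trans ?_
  simpa using hs

theorem coeff_binomialSeries (r : ℂ) (k : ℕ) :
    (binomialSeries ℂ r).coeff k = Ring.choose r k := by
  rw [binomialSeries, FormalMultilinearSeries.coeff_ofScalars]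

theorem summable_norm_ringChoose_mul_pow (r : ℂ) {q : ℝ} (hq0 : 0 ≤ q) (hq1 : q < 1) :
    Summable fun k : ℕ => ‖Ring.choose r k‖ * q ^ k := by
  lift q to NNReal using hq0
  have h1 : (q : ENNReal) < (binomialSeries ℂ r).radius :=
    lt_of_lt_of_le (by exact_mod_cast hq1) binomialSeries_radius_ge_one
  refine ((binomialSeries ℂ r).summable_norm_mul_pow h1).of_nonneg_of_le
    (fun k => by positivity) fun k => ?_
  gcongr
  rw [← coeff_binomialSeries]
  simp

theorem hasSum_ringChoose_mul_pow (r : ℂ) {x : ℂ} (hx : ‖x‖ < 1) :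
    HasSum (fun k : ℕ => Ring.choose r k * x ^ k) ((1 + x) ^ r) := by
  have h := (Complex.one_add_cpow_hasFPowerSeriesOnBall_zero (a := r)).hasSum
    (y := x) (by rw [← ENNReal.ofReal_one, Metric.eball_ofReal]; simpa using hx)
  simpa [coeff_binomialSeries, mul_comm] using h

theorem abs_arg_lt_of_re_pos {z : ℂ} (hz : 0 < z.re) : |z.arg| < π / 2 := by
  rw [Complex.abs_arg_lt_pi_div_two_iff]
  exact Or.inl hz

/-- Write z + δ = z (1 + δ/z). Both z e^{-iθ} and 1 + δ/z have positive real part, so their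
arguments add without leaving (-π, π) and the chosen branch is multiplicative here. -/
theorem hasSum_branchPow_add {θ : ℝ} {z δ : ℂ} (hz : z ∈ halfPlane θ) (hδ : ‖δ‖ < ‖z‖) (s : ℂ) :
    HasSum (fun k : ℕ => Ring.choose (-s) k * δ ^ k * branchPow θ z (-(s + k)))
      (branchPow θ (z + δ) (-s)) := by
  have hz0 : z ≠ 0 := mem_halfPlane_ne_zero hz
  have hx : ‖δ / z‖ < 1 := by
    rw [norm_div, div_lt_one (norm_pos_iff.2 hz0)]
    exact hδ
  set e := Complex.exp (-(θ * Complex.I)) with he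
  have hw0 : z * e ≠ 0 := mul_ne_zero hz0 (Complex.exp_ne_zero _)
  have hre : 0 < (1 + δ / z).re := by
    have := (abs_le.1 (Complex.abs_re_le_norm (δ / z))).1
    simp only [Complex.add_re, Complex.one_re]
    linarith
  have hx0 : 1 + δ / z ≠ 0 := by
    intro h
    simp [h] at hre
  have hlog : Complex.log ((z + δ) * e) = Complex.log (z * e) + Complex.log (1 + δ / z) := by
    rw [show (z + δ) * e = z * e * (1 + δ / z) by field_simp]
    have h1 := abs_lt.1 (abs_arg_lt_of_re_pos (z := z * e) hz)
    have h2 := abs_lt.1 (abs_arg_lt_of_re_pos hre)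
    exact Complex.log_mul hw0 hx0 ⟨by linarith, by linarith⟩
  have h1 := (hasSum_ringChoose_mul_pow (-s) hx).mul_left (branchPow θ z (-s))
  have h2 : branchPow θ z (-s) * (1 + δ / z) ^ (-s) = branchPow θ (z + δ) (-s) := by
    rw [Complex.cpow_def_of_ne_zero hx0, branchPow, branchPow, ← he, hlog, ← Complex.exp_add]
    congr 1
    ring
  rw [h2] at h1
  refine h1.congr_fun fun k => ?_
  have h3 : branchPow θ z (-(s + k)) = branchPow θ z (-s) * (z ^ k)⁻¹ := by
    have h4 : Complex.exp (Complex.log (z * e) + θ * Complex.I) = z := by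
      rw [Complex.exp_add, Complex.exp_log hw0, mul_assoc, he, ← Complex.exp_add]
      simp
    rw [branchPow, branchPow, ← he, neg_add, add_mul, Complex.exp_add, neg_mul (k : ℂ),
      Complex.exp_neg, Complex.exp_nat_mul, h4]
  rw [h3, div_pow]
  ring

/-- The Taylor series in the parameter: `∑ₖ (-s choose k) δᵏ Z (s + k)`. -/
noncomputable def taylorShift (Z : ℂ → ℂ) (δ s : ℂ) : ℂ :=
  ∑' k : ℕ, Ring.choose (-s) k * δ ^ k * Z (s + k)

theorem HasSum.of_fiberwise_comm {α β : Type*} {F : α → β → ℂ} {f : α → ℂ} {g : β → ℂ}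
    (hF : Summable fun p : α × β => F p.1 p.2) (hf : ∀ x, HasSum (F x) (f x))
    (hg : ∀ y, HasSum (fun x => F x y) (g y)) : HasSum f (∑' y, g y) := by
  have h1 : HasSum (fun p : β × α => F p.2 p.1) (∑' p : α × β, F p.1 p.2) :=
    (Equiv.hasSum_iff (Equiv.prodComm β α)).2 hF.hasSum
  rw [(h1.prod_fiberwise hg).tsum_eq]
  exact hF.hasSum.prod_fiberwise hf

/-- Each term of the Barnes series is expanded in powers of δ and the summations are interchanged;
the double series is dominated by a product, with ratio |δ|/ρ < 1 in k. -/
theorem BarnesCone.hasSum_taylorShift {n : ℕ} {ω : Fin n → ℂ} {a : ℂ} {ρ : ℝ}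
    (h : BarnesCone ω a ρ) {θ : ℝ} {Z : ℂ → ℂ}
    (hmem : ∀ m : Fin n → ℕ, a + ∑ j, ω j * (m j : ℂ) ∈ halfPlane θ)
    (hZ : ∀ s : ℂ, (n : ℝ) < s.re → HasSum (barnesSeriesTerm θ ω a s) (Z s))
    {δ : ℂ} (hδ : ‖δ‖ < ρ) {s : ℂ} (hs : (n : ℝ) < s.re) :
    HasSum (barnesSeriesTerm θ ω (a + δ) s) (taylorShift Z δ s) := by
  have hσ : 0 ≤ s.re := (Nat.cast_nonneg n).trans hs.le
  have hρ := h.pos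
  have hq0 : 0 ≤ ‖δ‖ * ρ⁻¹ := by positivity
  have hq1 : ‖δ‖ * ρ⁻¹ < 1 := by
    rw [← div_eq_mul_inv, div_lt_one hρ]
    exact hδ
  refine HasSum.of_fiberwise_comm (F := fun m k =>
    Ring.choose (-s) k * δ ^ k * barnesSeriesTerm θ ω a (s + k) m) ?_ (fun m => ?_) fun k => ?_
  · refine Summable.of_norm_bounded ((((h.summable s.re hs).mul_right
      (Real.exp (|Real.log ρ| * (‖s‖ + s.re) + (|θ| + π) * ‖s‖)))).mul_of_nonneg
      (summable_norm_ringChoose_mul_pow (-s) hq0 hq1) (fun m => by positivity)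
      fun k => by positivity) fun p => ?_
    have h1 := h.norm_term_le θ hσ le_rfl (le_refl ‖s‖) p.2 p.1
    simp only [norm_mul, norm_pow, mul_pow]
    refine (mul_le_mul_of_nonneg_left h1 (by positivity)).trans (le_of_eq ?_)
    ring
  · have h2 := hasSum_branchPow_add (hmem m) (hδ.trans_le (h.le_norm m)) s
    rw [barnesSeriesTerm, show a + δ + ∑ j, ω j * (m j : ℂ) = a + ∑ j, ω j * (m j : ℂ) + δ by ring]
    exact h2
  · refine (hZ (s + k) ?_).mul_left _
    rw [Complex.add_re, Complex.natCast_re]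
    have : (0 : ℝ) ≤ k := Nat.cast_nonneg k
    linarith

theorem BarnesCone.exists_norm_le {n : ℕ} {ω : Fin n → ℂ} {a : ℂ} {ρ : ℝ}
    (h : BarnesCone ω a ρ) {θ : ℝ} {Z : ℂ → ℂ}
    (hZ : ∀ s : ℂ, (n : ℝ) < s.re → HasSum (barnesSeriesTerm θ ω a s) (Z s))
    {σ : ℝ} (hσ : (n : ℝ) < σ) (R : ℝ) :
    ∃ C : ℝ, 0 ≤ C ∧ ∀ s : ℂ, σ ≤ s.re → ‖s‖ ≤ R → ∀ k : ℕ, ‖Z (s + k)‖ ≤ C * (ρ⁻¹) ^ k := by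
  have hσ0 : 0 ≤ σ := (Nat.cast_nonneg n).trans hσ.le
  have hS := (h.summable σ hσ).mul_right (Real.exp (|Real.log ρ| * (R + σ) + (|θ| + π) * R))
  refine ⟨∑' m : Fin n → ℕ, ‖a + ∑ j, ω j * (m j : ℂ)‖ ^ (-σ) *
    Real.exp (|Real.log ρ| * (R + σ) + (|θ| + π) * R),
    tsum_nonneg (fun m => by positivity), fun s hs hR k => ?_⟩
  · have hk : (0 : ℝ) ≤ k := Nat.cast_nonneg k
    have h1 : (n : ℝ) < (s + k).re := by
      rw [Complex.add_re, Complex.natCast_re]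
      linarith
    rw [← (hZ _ h1).tsum_eq]
    exact tsum_of_norm_bounded (hS.hasSum.mul_right _) fun m => h.norm_term_le θ hσ0 hs hR k m

/-- For bounded s, all but K of the arguments s + k lie in the half plane of convergence, where Z(s
+ k) = O(ρ^{-k}). Hence the Taylor series is locally a finite sum of meromorphic functions plus an
analytic tail. -/
theorem BarnesCone.exists_summable_tail_bound {n : ℕ} {ω : Fin n → ℂ} {a : ℂ} {ρ : ℝ}
    (h : BarnesCone ω a ρ) {θ : ℝ} {Z : ℂ → ℂ}
    (hZ : ∀ s : ℂ, (n : ℝ) < s.re → HasSum (barnesSeriesTerm θ ω a s) (Z s))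
    {δ : ℂ} (hδ : ‖δ‖ < ρ) (R : ℝ) (K : ℕ) :
    ∃ u : ℕ → ℝ, Summable u ∧ ∀ s : ℂ, ‖s‖ ≤ R → (n + 1 : ℝ) ≤ s.re + K → ∀ k : ℕ,
      ‖Ring.choose (-s) (k + K) * δ ^ (k + K) * Z (s + (k + K : ℕ))‖ ≤ u k := by
  have hρ := h.pos
  obtain ⟨C, hC0, hC⟩ := h.exists_norm_le hZ (lt_add_one (n : ℝ)) (R + K)
  have hq0 : 0 ≤ ‖δ‖ * ρ⁻¹ := by positivity
  have hq1 : ‖δ‖ * ρ⁻¹ < 1 := by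
    rw [← div_eq_mul_inv, div_lt_one hρ]
    exact hδ
  refine ⟨fun k => ‖Ring.choose (-(R : ℂ)) (k + K)‖ * (‖δ‖ * ρ⁻¹) ^ (k + K) * (C * ρ ^ K),
    ((summable_nat_add_iff K).2 (summable_norm_ringChoose_mul_pow _ hq0 hq1)).mul_right _,
    fun s hs hK k => ?_⟩
  have h1 : ‖Z (s + (k + K : ℕ))‖ ≤ C * (ρ⁻¹) ^ k := by
    rw [show (s + (k + K : ℕ) : ℂ) = s + K + k by push_cast; ring]
    refine hC (s + K) (by simpa using hK) ((norm_add_le _ _).trans ?_) k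
    simpa using hs
  rw [norm_mul, norm_mul, norm_pow]
  calc _ ≤ ‖Ring.choose (-(R : ℂ)) (k + K)‖ * ‖δ‖ ^ (k + K) * (C * (ρ⁻¹) ^ k) := by
        gcongr
        exact norm_ringChoose_neg_le hs _
    _ = _ := by
        beta_reduce
        rw [mul_pow, pow_add ρ⁻¹ k K]
        have : (ρ⁻¹) ^ K * ρ ^ K = 1 := by rw [← mul_pow, inv_mul_cancel₀ hρ.ne', one_pow]
        linear_combination (-‖Ring.choose (-(R : ℂ)) (k + K)‖ * ‖δ‖ ^ (k + K) * C * ρ⁻¹ ^ k) * this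

theorem BarnesCone.summable_norm_taylorShift {n : ℕ} {ω : Fin n → ℂ} {a : ℂ} {ρ : ℝ}
    (h : BarnesCone ω a ρ) {θ : ℝ} {Z : ℂ → ℂ}
    (hZ : ∀ s : ℂ, (n : ℝ) < s.re → HasSum (barnesSeriesTerm θ ω a s) (Z s))
    {δ : ℂ} (hδ : ‖δ‖ < ρ) (s : ℂ) :
    Summable fun k : ℕ => ‖Ring.choose (-s) k * δ ^ k * Z (s + k)‖ := by
  obtain ⟨K, hK⟩ := exists_nat_ge (n + 1 - s.re)
  obtain ⟨u, hu, hb⟩ := h.exists_summable_tail_bound hZ hδ ‖s‖ K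
  refine (summable_nat_add_iff K).1 (hu.of_nonneg_of_le (fun k => norm_nonneg _) fun k => ?_)
  exact hb s le_rfl (by linarith) k

theorem BarnesCone.exists_taylorShift_eventuallyEq {n : ℕ} {ω : Fin n → ℂ} {a : ℂ} {ρ : ℝ}
    (h : BarnesCone ω a ρ) {θ : ℝ} {Z : ℂ → ℂ}
    (hZ : ∀ s : ℂ, (n : ℝ) < s.re → HasSum (barnesSeriesTerm θ ω a s) (Z s))
    (hZa : ∀ s : ℂ, (n : ℝ) < s.re → AnalyticAt ℂ Z s)
    {δ : ℂ} (hδ : ‖δ‖ < ρ) (s₀ : ℂ) :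
    ∃ (K : ℕ) (g : ℂ → ℂ), AnalyticAt ℂ g s₀ ∧ taylorShift Z δ =ᶠ[𝓝 s₀]
      fun s => ∑ k ∈ Finset.range K, Ring.choose (-s) k * δ ^ k * Z (s + k) + g s := by
  -- One more than n + 1, since Re s may drop by up to 1 in the unit ball around s₀.
  obtain ⟨K, hK⟩ := exists_nat_ge (n + 2 - s₀.re)
  obtain ⟨u, hu, hb⟩ := h.exists_summable_tail_bound hZ hδ (‖s₀‖ + 1) K
  have hball : ∀ s ∈ Metric.ball s₀ 1, ‖s‖ ≤ ‖s₀‖ + 1 ∧ (n + 1 : ℝ) ≤ s.re + K := by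
    intro s hs
    rw [mem_ball_iff_norm] at hs
    have h2 := norm_le_norm_add_norm_sub' s s₀
    have h3 := (abs_le.1 (Complex.abs_re_le_norm (s - s₀))).1
    rw [Complex.sub_re] at h3
    exact ⟨by linarith, by linarith⟩
  refine ⟨K, fun s => ∑' k : ℕ, Ring.choose (-s) (k + K) * δ ^ (k + K) * Z (s + (k + K : ℕ)),
    DifferentiableOn.analyticAt (s := Metric.ball s₀ 1)
      (Complex.differentiableOn_tsum_of_summable_norm hu (fun k => ?_) Metric.isOpen_ball
        fun k s hs => hb s (hball s hs).1 (hball s hs).2 k)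
      (Metric.ball_mem_nhds _ one_pos), Eventually.of_forall fun s => ?_⟩
  · intro s hs
    have h1 : (n : ℝ) < (s + (k + K : ℕ)).re := by
      have := (hball s hs).2
      have hk : (0 : ℝ) ≤ k := Nat.cast_nonneg k
      rw [Complex.add_re, Complex.natCast_re]
      push_cast
      linarith
    have h2 : DifferentiableAt ℂ (fun s => Z (s + (k + K : ℕ))) s :=
      (hZa _ h1).differentiableAt.comp s (by fun_prop)
    exact (((differentiable_ringChoose_neg (k + K) s).mul_const _).mul h2).differentiableWithinAt
  · exact ((h.summable_norm_taylorShift hZ hδ s).of_norm.sum_add_tsum_nat_add K).symm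

theorem BarnesCone.meromorphicOn_taylorShift {n : ℕ} {ω : Fin n → ℂ} {a : ℂ} {ρ : ℝ}
    (h : BarnesCone ω a ρ) {θ : ℝ} {Z : ℂ → ℂ}
    (hZ : ∀ s : ℂ, (n : ℝ) < s.re → HasSum (barnesSeriesTerm θ ω a s) (Z s))
    (hZa : ∀ s : ℂ, (n : ℝ) < s.re → AnalyticAt ℂ Z s) (hZm : MeromorphicOn Z Set.univ)
    {δ : ℂ} (hδ : ‖δ‖ < ρ) : MeromorphicOn (taylorShift Z δ) Set.univ := by
  intro s₀ _
  obtain ⟨K, g, hg, hev⟩ := h.exists_taylorShift_eventuallyEq hZ hZa hδ s₀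
  refine MeromorphicAt.congr ?_ (hev.symm.filter_mono nhdsWithin_le_nhds)
  refine (MeromorphicAt.fun_sum fun k _ => ?_).add hg.meromorphicAt
  have h1 : MeromorphicAt (fun s => Z (s + k)) s₀ := by
    refine (hZm (s₀ + k) (Set.mem_univ _)).comp_analyticAt (g := fun s : ℂ => s + k) ?_
    fun_prop
  have h2 := (differentiable_ringChoose_neg k).analyticAt s₀
  exact (h2.meromorphicAt.mul (MeromorphicAt.const _ _)).mul h1

theorem BarnesCone.analyticAt_taylorShift {n : ℕ} {ω : Fin n → ℂ} {a : ℂ} {ρ : ℝ}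
    (h : BarnesCone ω a ρ) {θ : ℝ} {Z : ℂ → ℂ}
    (hZ : ∀ s : ℂ, (n : ℝ) < s.re → HasSum (barnesSeriesTerm θ ω a s) (Z s))
    (hZa : ∀ s : ℂ, (n : ℝ) < s.re → AnalyticAt ℂ Z s)
    (hZN : ∀ s : ℂ, (∀ N : ℤ, s ≠ N) → AnalyticAt ℂ Z s)
    {δ : ℂ} (hδ : ‖δ‖ < ρ) {s : ℂ} (hs : ∀ N : ℤ, s ≠ N) :
    AnalyticAt ℂ (taylorShift Z δ) s := by
  obtain ⟨K, g, hg, hev⟩ := h.exists_taylorShift_eventuallyEq hZ hZa hδ s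
  refine AnalyticAt.congr ?_ hev.symm
  refine (Finset.analyticAt_fun_sum _ fun k _ => ?_).add hg
  have h1 : AnalyticAt ℂ (fun s => Z (s + k)) s := by
    refine AnalyticAt.fun_comp (hZN (s + k) fun N hN => hs (N - k) ?_) (by fun_prop)
    push_cast
    linear_combination hN
  exact (((differentiable_ringChoose_neg k).analyticAt s).mul analyticAt_const).mul h1

/-- Dominated convergence with the terms at δ₀ as majorant, which is why δ must approach δ₀ with |δ|
≤ |δ₀|. -/
theorem BarnesCone.tendsto_taylorShift {n : ℕ} {ω : Fin n → ℂ} {a : ℂ} {ρ : ℝ}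
    (h : BarnesCone ω a ρ) {θ : ℝ} {Z : ℂ → ℂ}
    (hZ : ∀ s : ℂ, (n : ℝ) < s.re → HasSum (barnesSeriesTerm θ ω a s) (Z s))
    {δ₀ : ℂ} (hδ₀ : ‖δ₀‖ < ρ) {α : Type*} {l : Filter α} [l.NeBot] {δ : α → ℂ}
    (hδ : ∀ᶠ y in l, ‖δ y‖ ≤ ‖δ₀‖) (hlim : Tendsto δ l (𝓝 δ₀)) (s : ℂ) :
    Tendsto (fun y => taylorShift Z (δ y) s) l (𝓝 (taylorShift Z δ₀ s)) := by
  refine tendsto_tsum_of_dominated_convergence (h.summable_norm_taylorShift hZ hδ₀ s)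
    (fun k => ?_) ?_
  · exact ((hlim.pow k).const_mul _).mul_const _
  · filter_upwards [hδ] with y hy k
    simp only [norm_mul, norm_pow]
    gcongr

/-- Since every point z of the cone has |z| ≥ ρ, one has |z + δ| ≥ (1 - |δ|/ρ) |z|, and powers of
the norms are compared with a constant factor. -/
theorem BarnesCone.add {n : ℕ} {ω : Fin n → ℂ} {a : ℂ} {ρ : ℝ} (h : BarnesCone ω a ρ) {δ : ℂ}
    (hδ : ‖δ‖ < ρ) : BarnesCone ω (a + δ) (ρ - ‖δ‖) := by
  have hρ := h.pos
  set q := 1 - ‖δ‖ / ρ with hq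
  have hq0 : 0 < q := by
    rw [hq, sub_pos, div_lt_one hρ]
    exact hδ
  have key : ∀ m : Fin n → ℕ, ‖a + ∑ j, ω j * (m j : ℂ)‖ - ‖δ‖ ≤
      ‖a + δ + ∑ j, ω j * (m j : ℂ)‖ := fun m => by
    rw [show a + δ + ∑ j, ω j * (m j : ℂ) = a + ∑ j, ω j * (m j : ℂ) + δ by ring]
    exact norm_sub_le_norm_add _ _
  refine ⟨sub_pos.2 hδ, fun m => ?_, fun σ hσ => ?_⟩
  · have := h.le_norm m
    linarith [key m]
  · refine ((h.summable σ hσ).mul_left (q ^ (-σ))).of_nonneg_of_le (fun m => by positivity)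
      fun m => ?_
    have h1 := h.le_norm m
    have h2 : 0 < ‖a + ∑ j, ω j * (m j : ℂ)‖ := hρ.trans_le h1
    have hσ0 : 0 ≤ σ := (Nat.cast_nonneg n).trans hσ.le
    rw [← Real.mul_rpow hq0.le h2.le]
    refine Real.rpow_le_rpow_of_nonpos (by positivity) ?_ (by linarith)
    have h3 : ‖δ‖ ≤ ‖δ‖ / ρ * ‖a + ∑ j, ω j * (m j : ℂ)‖ := by
      rw [div_mul_eq_mul_div, le_div_iff₀ hρ]
      gcongr
    have := key m
    rw [hq, sub_mul, one_mul]
    linarith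

/-! ### The limit y → 0+. -/

theorem barnesParam_eq_add {n : ℕ} (ω : Fin n → ℂ) (y₀ y : ℝ) :
    barnesParam ω y = barnesParam ω y₀ + (y₀ - y : ℝ) * ∑ j, ω j := by
  rw [barnesParam, barnesParam, ← Finset.sum_mul, ← Finset.sum_mul]
  push_cast
  ring

/-- With B = |ω_1 + ⋯ + ω_n| and A its component along e^{iθ}, the inequality says that a(0) lies in
the Taylor disc around a(y₀). -/
theorem exists_shift_lt {A B : ℝ} (hA : 0 < A) (hB : 0 ≤ B) :
    ∃ y : ℝ, 0 < y ∧ y < 1 ∧ y * B < (1 - y) * A := by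
  refine ⟨A / (2 * (A + B)), by positivity, ?_, ?_⟩
  · rw [div_lt_one (by positivity)]
    linarith
  · have h1 : A / (2 * (A + B)) * (A + B) = A / 2 := by field_simp
    nlinarith

theorem norm_shift_le (Ω : ℂ) {y₀ y : ℝ} (hy : 0 ≤ y) (hy' : y ≤ y₀) :
    ‖((y₀ - y : ℝ) : ℂ) * Ω‖ ≤ y₀ * ‖Ω‖ := by
  rw [norm_mul, Complex.norm_real, Real.norm_of_nonneg (by linarith)]
  gcongr
  linarith

theorem analyticAt_barnesZeta_of_ne_intCast {n : ℕ} (hn : 2 ≤ n) {θ : ℝ} {ω : Fin n → ℂ}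
    (hω : ∀ j, ω j ∈ halfPlane θ) (hratio : ∀ j k, j ≠ k → (ω j / ω k).im ≠ 0)
    {y : ℝ} (hy0 : 0 < y) (hy1 : y < 1) {s : ℂ} (hs : ∀ N : ℤ, s ≠ N) :
    AnalyticAt ℂ (barnesZeta θ ω (barnesParam ω y)) s := by
  refine ((analyticAt_gammaFactor hs).mul ((differentiable_funcEqSum hn θ
    (fun j => mem_halfPlane_ne_zero (hω j)) hratio hy0 hy1).analyticAt s)).congr ?_
  filter_upwards [eventually_ne_intCast_nhds hs] with z hz
  exact ((equalsOn_barnesZeta_of_pos hn hω hratio hy0 hy1).1 z (Set.mem_univ _) hz).symm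

/-- Near `y = 0` the Barnes series has a family of continuations which is continuous at `0`. -/
theorem exists_continuation_family {n : ℕ} (hn : 2 ≤ n) {θ : ℝ} {ω : Fin n → ℂ}
    (hω : ∀ j, ω j ∈ halfPlane θ) (hratio : ∀ j k, j ≠ k → (ω j / ω k).im ≠ 0) :
    ∃ y₀ : ℝ, 0 < y₀ ∧ y₀ < 1 ∧ (∃ ρ, BarnesCone ω (barnesParam ω 0) ρ) ∧ ∃ T : ℝ → ℂ → ℂ,
      (∀ s, Tendsto (fun y => T y s) (𝓝[>] 0) (𝓝 (T 0 s))) ∧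
      ∀ y, 0 ≤ y → y ≤ y₀ → MeromorphicOn (T y) Set.univ ∧
        (∀ s : ℂ, (∀ N : ℤ, s ≠ N) → AnalyticAt ℂ (T y) s) ∧
        ∀ s : ℂ, (n : ℝ) < s.re → HasSum (barnesSeriesTerm θ ω (barnesParam ω y) s) (T y s) := by
  have hA : ∑ j, ω j ∈ halfPlane θ := by
    simpa using smul_mem_halfPlane_sum (by omega) hω (x := fun _ => 1) fun _ => one_pos
  obtain ⟨y₀, hy0, hy1, hlt⟩ := exists_shift_lt (show 0 <
    ((∑ j, ω j) * Complex.exp (-(θ * Complex.I))).re from hA) (norm_nonneg (∑ j, ω j))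
  have hcone := barnesCone_param hn hω hy0 hy1
  have hZ := exists_isBarnesContinuation_of_pos hn hω hratio hy0 hy1
  have hZa : ∀ s : ℂ, (n : ℝ) < s.re → AnalyticAt ℂ (barnesZeta θ ω (barnesParam ω y₀)) s :=
    fun s hs => analyticAt_barnesZeta_of_pos hn hω hratio hy0 hy1 hs
  have hδ : ∀ y, 0 ≤ y → y ≤ y₀ → ‖((y₀ - y : ℝ) : ℂ) * ∑ j, ω j‖ <
      (1 - y₀) * ((∑ j, ω j) * Complex.exp (-(θ * Complex.I))).re :=
    fun y h1 h2 => (norm_shift_le _ h1 h2).trans_lt hlt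
  refine ⟨y₀, hy0, hy1, ?_, fun y => taylorShift (barnesZeta θ ω (barnesParam ω y₀))
    ((y₀ - y : ℝ) * ∑ j, ω j), fun s => ?_, fun y h1 h2 => ⟨?_, fun s hs => ?_, fun s hs => ?_⟩⟩
  · rw [barnesParam_eq_add ω y₀ 0]
    exact ⟨_, hcone.add (hδ 0 le_rfl hy0.le)⟩
  · refine hcone.tendsto_taylorShift hZ.hasSum (hδ 0 le_rfl hy0.le) ?_ ?_ s
    · filter_upwards [self_mem_nhdsWithin,
        mem_nhdsWithin_of_mem_nhds (gt_mem_nhds hy0)] with y h1 h2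
      have h3 : (0 : ℝ) < y := h1
      rw [norm_mul, norm_mul, Complex.norm_real, Complex.norm_real,
        Real.norm_of_nonneg (by linarith), Real.norm_of_nonneg (by linarith)]
      gcongr
    · refine Tendsto.mono_left ?_ nhdsWithin_le_nhds
      have : Continuous fun y : ℝ => ((y₀ - y : ℝ) : ℂ) * ∑ j, ω j := by fun_prop
      exact this.tendsto 0
  · exact hcone.meromorphicOn_taylorShift hZ.hasSum hZa hZ.meromorphic.meromorphicOn (hδ y h1 h2)
  · exact hcone.analyticAt_taylorShift hZ.hasSum hZa
      (fun s hs => analyticAt_barnesZeta_of_ne_intCast hn hω hratio hy0 hy1 hs) (hδ y h1 h2) hs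
  · rw [barnesParam_eq_add ω y₀ y]
    exact hcone.hasSum_taylorShift (param_add_mem (by omega) hω hy1) hZ.hasSum (hδ y h1 h2) hs

/-- The family T is continuous at y = 0 for each s, and for y > 0 it satisfies the functional
equation off the integers. Both sides have limits as y → 0+ when Re s < 0, and T 0 continues the
series with parameter a(0). -/
theorem barnesZeta_zero {n : ℕ} (hn : 2 ≤ n) {θ : ℝ} {ω : Fin n → ℂ}
    (hω : ∀ j, ω j ∈ halfPlane θ) (hratio : ∀ j k, j ≠ k → (ω j / ω k).im ≠ 0) :
    IsBarnesContinuation θ ω (barnesParam ω 0) (barnesZeta θ ω (barnesParam ω 0)) ∧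
      EqualsOn n (barnesZeta θ ω (barnesParam ω 0)) (funcEqRHS θ ω 0) {s : ℂ | s.re < 0} := by
  obtain ⟨y₀, hy0, hy1, ⟨ρ, hcone⟩, T, hlim, hT⟩ := exists_continuation_family hn hω hratio
  have h0 := fun j => mem_halfPlane_ne_zero (hω j)
  obtain ⟨hm, ha, hsum⟩ := hT 0 le_rfl hy0.le
  have hZ : IsBarnesContinuation θ ω (barnesParam ω 0) (barnesZeta θ ω (barnesParam ω 0)) :=
    isBarnesContinuation_barnesZeta (isBarnesContinuation_toMeromorphicNFOn hm
      (fun _ hs => hcone.analyticAt_tsum θ hs) (fun _ hs => (hcone.summable_term θ hs).hasSum)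
      fun s hs _ => (hsum s hs).tsum_eq.symm)
  refine ⟨hZ, equalsOn_gammaFactor_mul (S := funcEqSum θ ω 0) hZ.meromorphic (fun s hs => ?_)
    (fun s hs => ?_) fun s hs hs' => ?_⟩
  · refine DifferentiableOn.analyticAt (s := {s : ℂ | s.re < 0}) (fun z hz =>
      (differentiableAt_funcEqSum_zero hn θ h0 hratio hz).differentiableWithinAt)
      ((isOpen_lt Complex.continuous_re continuous_const).mem_nhds hs)
  · have hpos : ∀ y, 0 < y → y ≤ y₀ → ∀ z : ℂ, (∀ N : ℤ, z ≠ N) →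
        T y z = gammaFactor z * funcEqSum θ ω y z := by
      intro y h1 h2 z hz
      obtain ⟨hm', ha', hsum'⟩ := hT y h1.le h2
      have hy1' : y < 1 := h2.trans_lt hy1
      have hZy := exists_isBarnesContinuation_of_pos hn hω hratio h1 hy1'
      have h3 := hZy.eventuallyEq hm' (fun s hs _ => hsum' s hs) z
      have h4 := (hZy.meromorphic (Set.mem_univ z)).eventuallyEq_nhds_of_analyticAt (ha' z hz) h3
      rw [← h4.eq_of_nhds]
      exact (equalsOn_barnesZeta_of_pos hn hω hratio h1 hy1').1 z (Set.mem_univ _) hz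
    refine (hZ.eventuallyEq hm (fun s hs _ => hsum s hs) s).trans ?_
    filter_upwards [eventually_ne_intCast s, mem_nhdsWithin_of_mem_nhds
      ((isOpen_lt Complex.continuous_re continuous_const).mem_nhds hs)] with z hz1 hz2
    refine tendsto_nhds_unique (hlim z) (Tendsto.congr' ?_
      ((tendsto_funcEqSum_zero hn θ h0 hratio hz2).const_mul (gammaFactor z)))
    filter_upwards [self_mem_nhdsWithin,
      mem_nhdsWithin_of_mem_nhds (gt_mem_nhds hy0)] with y h1 h2
    exact (hpos y h1 (le_of_lt h2) z hz1).symm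
  · have h1 : s.re < 0 := hs
    have h2 : (0 : ℝ) ≤ n := Nat.cast_nonneg n
    linarith

/-! ### The case y = 1/2 and the theorem. -/

theorem exp_half_div_exp_sub_one (z : ℂ) :
    Complex.exp (2 * z * ((1 / 2 : ℝ) : ℂ)) / (Complex.exp (2 * z) - 1) =
      1 / 2 * (1 / Complex.sinh z) := by
  have h1 : Complex.exp (2 * z) - 1 = Complex.exp z * (2 * Complex.sinh z) := by
    rw [Complex.two_sinh, mul_sub, ← Complex.exp_add, ← Complex.exp_add, two_mul, add_neg_cancel,
      Complex.exp_zero]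
  rw [h1, show 2 * z * ((1 / 2 : ℝ) : ℂ) = z by push_cast; ring,
    div_mul_cancel_left₀ (Complex.exp_ne_zero z)]
  ring

theorem exp_int_mul_pi_mul_I (m : ℤ) :
    Complex.exp (2 * (m : ℂ) * π * Complex.I * ((1 / 2 : ℝ) : ℂ)) = (-1) ^ m := by
  rw [← Complex.exp_pi_mul_I, ← Complex.exp_int_mul]
  congr 1
  push_cast
  ring

theorem funcEqTerm_half {n : ℕ} (θ : ℝ) (ω : Fin n → ℂ) (p : Fin n × {m : ℤ // m ≠ 0}) (s : ℂ) :
    funcEqTerm θ ω (1 / 2) p s = 1 / 2 ^ (n - 1) * sinhTerm θ ω p s := by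
  have h1 : ∀ j, Complex.exp (2 * (p.2.1 : ℂ) * π * Complex.I * (ω j / ω p.1) *
        ((1 / 2 : ℝ) : ℂ)) / (Complex.exp (2 * (p.2.1 : ℂ) * π * Complex.I * (ω j / ω p.1)) - 1) =
      1 / 2 * (1 / Complex.sinh ((p.2.1 : ℂ) * π * Complex.I * (ω j / ω p.1))) := fun j => by
    rw [← exp_half_div_exp_sub_one]
    ring_nf
  rw [funcEqTerm, sinhTerm, exp_int_mul_pi_mul_I]
  simp only [h1, Finset.prod_mul_distrib, Finset.prod_const, Finset.card_erase_of_mem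
    (Finset.mem_univ _), Finset.card_univ, Fintype.card_fin, one_div_pow]
  ring

theorem sinhRHS_eq {n : ℕ} (θ : ℝ) (ω : Fin n → ℂ) : sinhRHS θ ω = funcEqRHS θ ω (1 / 2) := by
  funext s
  simp only [sinhRHS, funcEqRHS, funcEqTerm_half, tsum_mul_left, ← Finset.mul_sum]
  ring

theorem convergesAbsUniformlyOn_sinhTerm {n : ℕ} (hn : 2 ≤ n) (θ : ℝ) {ω : Fin n → ℂ}
    (h0 : ∀ j, ω j ≠ 0) (hratio : ∀ j k, j ≠ k → (ω j / ω k).im ≠ 0) :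
    ConvergesAbsUniformlyOn (sinhTerm θ ω) Set.univ := by
  refine convergesAbsUniformlyOn_of_bound fun K _ hK => ?_
  obtain ⟨R, hR⟩ := hK.exists_bound_of_continuousOn continuousOn_id
  obtain ⟨C, hC⟩ := norm_funcEqTerm_le_of_pos hn θ h0 hratio one_half_pos one_half_lt_one R
  refine ⟨2 ^ (n - 1) * C, 2, one_lt_two, fun p s hs => ?_⟩
  have h1 : sinhTerm θ ω p s = 2 ^ (n - 1) * funcEqTerm θ ω (1 / 2) p s := by
    rw [funcEqTerm_half]
    field_simp
  rw [h1, norm_mul, norm_pow, Complex.norm_ofNat, mul_assoc]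
  exact mul_le_mul_of_nonneg_left (hC p s (hR s hs)) (by positivity)

theorem barnesParam_half {n : ℕ} (ω : Fin n → ℂ) : barnesParam ω (1 / 2) = (∑ j, ω j) / 2 := by
  rw [barnesParam, ← Finset.sum_mul]
  push_cast
  ring

theorem theorem2p1 (n : ℕ) (hn : 2 ≤ n) (θ : ℝ) (ω : Fin n → ℂ)
    (hω : ∀ j, ω j ∈ halfPlane θ)
    (hratio : ∀ j k, j ≠ k → (ω j / ω k).im ≠ 0) :
    -- the Barnes zeta-function is the meromorphic continuation of its Dirichlet series
    (∀ y : ℝ, 0 ≤ y → y < 1 →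
      IsBarnesContinuation θ ω (barnesParam ω y) (barnesZeta θ ω (barnesParam ω y))) ∧
    -- the functional equation for `0 < y < 1`, on the whole plane
    (∀ y : ℝ, 0 < y → y < 1 →
      ConvergesAbsUniformlyOn (funcEqTerm θ ω y) Set.univ ∧
      EqualsOn n (barnesZeta θ ω (barnesParam ω y)) (funcEqRHS θ ω y) Set.univ) ∧
    -- the functional equation for `y = 0`, on `Re s < 0`
    (ConvergesAbsUniformlyOn (funcEqTerm θ ω 0) {s : ℂ | s.re < 0} ∧
      EqualsOn n (barnesZeta θ ω (barnesParam ω 0)) (funcEqRHS θ ω 0) {s : ℂ | s.re < 0}) ∧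
    -- the case `y = 1/2`
    (ConvergesAbsUniformlyOn (sinhTerm θ ω) Set.univ ∧
      EqualsOn n (barnesZeta θ ω ((∑ j, ω j) / 2)) (sinhRHS θ ω) Set.univ) := by
  have h0 := fun j => mem_halfPlane_ne_zero (hω j)
  refine ⟨fun y hy0 hy1 => ?_, fun y hy0 hy1 =>
    ⟨convergesAbsUniformlyOn_funcEqTerm hn θ h0 hratio hy0 hy1,
      equalsOn_barnesZeta_of_pos hn hω hratio hy0 hy1⟩,
    ⟨convergesAbsUniformlyOn_funcEqTerm_zero hn θ h0 hratio, (barnesZeta_zero hn hω hratio).2⟩,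
    convergesAbsUniformlyOn_sinhTerm hn θ h0 hratio, ?_⟩
  · rcases hy0.eq_or_lt with rfl | hy0
    · exact (barnesZeta_zero hn hω hratio).1
    · exact exists_isBarnesContinuation_of_pos hn hω hratio hy0 hy1
  · rw [← barnesParam_half, sinhRHS_eq]
    exact equalsOn_barnesZeta_of_pos hn hω hratio one_half_pos one_half_lt_one
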